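/- Let $\mathcal G=(\pi,\Sigma,\mathcal N,\mathcal P,S)$ be an unambiguous weighted context-free grammar in binary Chomsky normal form: $\Sigma$ and $\mathcal N$ are finite, every non-terminal is productive and has either one production of the form $N\to N'.N''$, $N\to t$ or $N\to\varepsilon$, or two productions $N\to N'\mid N''$ with $N'\ne N''$; unambiguous means that every word has at most one leftmost derivation from $S$; and $\pi:\Sigma\to\mathbb R_{>0}$ is extended multiplicatively to words and additively to finite sets of words. Let $\mathcal L_n$ be the set of words of length $n$ generated from $S$, and for a set $\mathcal R\subseteq\mathcal L_n$ of $k$ words put $$\mathbb P(\mathcal R\mid k,n)=\sum_{\sigma}\prod_{i=1}^{k}\frac{\pi(\sigma_i)}{\pi(\mathcal L_n)-\sum_{j<i}\pi(\sigma_j)},$$ the sum being over all orderings $\sigma=(\sigma_1,\dots,\sigma_k)$ of $\mathcal R$. Consider the following algorithm, which computes with exact real numbers. (1) For every $N\in\mathcal N$ the weights $\pi(N_0),\dots,\pi(N_n)$ of the words of length $0,\dots,n$ generated from $N$ are tabulated by a linear recurrence with polynomial coefficients. (2) The following is repeated $k$ times: a number is drawn uniformly in $[0,\pi(\mathcal L_n)-\pi(\mathcal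 F))$, where $\mathcal F$ is the set of words generated so far; it is shifted past the intervals of the words of $\mathcal F$, which are kept in an AVL tree whose nodes also store the total weight of their left subtree; the resulting rank in $[0,\pi(\mathcal L_n))$ is unranked recursively into a word and its interval, the decompositions of the length at product-type non-terminals being investigated in the boustrophedon order $0,m,1,m-1,\dots$; and the word with its interval is inserted into the tree. Then there are recurrences for step (1), with finitely many constants that depend only on $\mathcal G$, and a constant $C$ that depends only on $\mathcal G$, such that for all integers $n\ge1$ and $1\le k\le|\mathcal L_n|$ the following holds. For every outcome of the random draws the algorithm returns $k$ distinct words of $\mathcal L_n$, uses at most $C\,(n\,|\mathcal N|+k\,n\log n)$ arithmetic operations (additions, subtractions, multiplications, divisions, comparisons and draws of numbers), and never stores more than $C\,(n\,|\mathcal N|+k)$ numbers at the same time. Moreover, each set $\mathcal R\subseteq\mathcal L_n$ of $k$ words is returned with probability $\mathbb P(\mathcal R\mid k,n)$. -/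

import Mathlib

noncomputable section

namespace NonRedundant

open Set

/-! ### Weighted context-free grammars in binary Chomsky normal form -/

/-- The four types of non-terminals of a grammar in binary Chomsky normal form. -/
inductive Rule (T N : Type) where
  | prod (B C : N)
  | union (B C : N)
  | term (t : T)
  | eps

/-- The right-hand sides of the productions of a non-terminal of the given type. -/
def Rule.rhs {T N : Type} : Rule T N → List (List (Symbol T N))
  | .prod B C => [[.nonterminal B, .nonterminal C]]
  | .union B C => [[.nonterminal B], [.nonterminal C]]
  | .term t => [[.terminal t]]
  | .eps => [[]]

/-- A context-free grammar each of whose non-terminals is of product, union, terminal or epsilon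
type, with a positive weight on every terminal symbol. -/
structure WeightedGrammar (T N : Type) where
  rule : N → Rule T N
  start : N
  weight : T → ℝ
  weight_pos : ∀ t, 0 < weight t

namespace WeightedGrammar

variable {T N : Type}

open Classical in
/-- The finite set of production rules. -/
def productions [Fintype N] (G : WeightedGrammar T N) : Finset (ContextFreeRule T N) :=
  Finset.univ.biUnion fun A => ((G.rule A).rhs.map fun α => ⟨A, α⟩).toFinset

/-- The underlying context-free grammar. -/
def toCFG [Fintype N] (G : WeightedGrammar T N) : ContextFreeGrammar T where
  NT := N
  initial := G.start
  rules := G.productions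

/-- The language of a non-terminal. -/
def lang [Fintype N] (G : WeightedGrammar T N) (A : N) : Set (List T) :=
  {w | G.toCFG.Derives [Symbol.nonterminal A] (w.map Symbol.terminal)}

/-- The words of length `n` generated from the axiom. -/
def words [Fintype N] (G : WeightedGrammar T N) (n : ℕ) : Set (List T) :=
  {w | w ∈ G.lang G.start ∧ w.length = n}

/-- The weight of a word is the product of the weights of its letters. -/
def wordWeight (G : WeightedGrammar T N) (w : List T) : ℝ := (w.map G.weight).prod

/-- The weight of a (finite) set of words. -/
def setWeight (G : WeightedGrammar T N) (s : Set (List T)) : ℝ := ∑ᶠ w ∈ s, G.wordWeight w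

/-- Every non-terminal is productive, and a union-type non-terminal has two productions. -/
structure IsBCNF [Fintype N] (G : WeightedGrammar T N) : Prop where
  productive : ∀ A, (G.lang A).Nonempty
  union_ne : ∀ A B C, G.rule A = .union B C → B ≠ C

/-- One atomic derivation, rewriting the leftmost non-terminal. -/
def LeftmostStep [Fintype N] (G : WeightedGrammar T N) (x y : List (Symbol T N)) : Prop :=
  ∃ r ∈ G.productions, ∃ (p : List T) (q : List (Symbol T N)),
    x = p.map Symbol.terminal ++ [Symbol.nonterminal r.input] ++ q ∧
    y = p.map Symbol.terminal ++ r.output ++ q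

/-- `d` is a sequence of leftmost atomic derivations that produces `w` from the axiom. -/
def IsLeftmostDerivation [Fintype N] (G : WeightedGrammar T N) (d : List (List (Symbol T N)))
    (w : List T) : Prop :=
  d.head? = some [Symbol.nonterminal G.start] ∧ d.IsChain G.LeftmostStep ∧
    d.getLast? = some (w.map Symbol.terminal)

/-- Every word has at most one leftmost derivation from the axiom. -/
def Unambiguous [Fintype N] (G : WeightedGrammar T N) : Prop :=
  ∀ w d d', G.IsLeftmostDerivation d w → G.IsLeftmostDerivation d' w → d = d'

/-- The probability that successive weighted draws from the words of length `n`, repeated until `k`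
distinct words have been seen, produce exactly the set `R`: the sum over all orderings `σ` of `R` of
`∏ i, π(σ i) / (π(L_n) - ∑ j < i, π(σ j))`. -/
def setProb [Fintype N] (G : WeightedGrammar T N) (n k : ℕ) (R : Finset (List T)) : ℝ :=
  open Classical in
  ∑ σ : Fin k ≃ R, ∏ i : Fin k,
    G.wordWeight (σ i) /
      (G.setWeight (G.words n) - ∑ j ∈ Finset.univ.filter (· < i), G.wordWeight (σ j))

end WeightedGrammar

/-! ### Counting arithmetic operations and stored numbers

Numbers are exact reals. Every sum, difference, product, quotient and comparison of two numbers,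
every conversion of an index into a number and every random draw costs one operation. Every number
that is produced occupies a cell until it is released. -/

/-- A result together with the number `ops` of arithmetic operations spent on it, the number `live`
of cells that are still occupied at the end by numbers the computation has produced, and the largest
number `peak` of such cells that are occupied at any one time. -/
structure Cost (α : Type) where
  val : α
  ops : ℕ
  live : ℕ
  peak : ℕ

namespace Cost

variable {α β ι : Type}

instance : Monad Cost where
  pure a := ⟨a, 0, 0, 0⟩
  bind x f :=
    ⟨(f x.val).val, x.ops + (f x.val).ops, x.live + (f x.val).live,
      max x.peak (x.live + (f x.val).peak)⟩

/-- One operation that produces a number. -/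
def number (x : ℝ) : Cost ℝ := ⟨x, 1, 1, 1⟩

def add (x y : ℝ) : Cost ℝ := number (x + y)
def sub (x y : ℝ) : Cost ℝ := number (x - y)
def mul (x y : ℝ) : Cost ℝ := number (x * y)
def div (x y : ℝ) : Cost ℝ := number (x / y)
def ofIndex (m : ℕ) : Cost ℝ := number m

open Classical in
def lt (x y : ℝ) : Cost Bool := ⟨decide (x < y), 1, 0, 0⟩

/-- `s` numbers are present from now on. -/
def given (s : ℕ) : Cost Unit := ⟨(), 0, s, s⟩

/-- Run `x` and release everything except the `s` numbers that its result consists of. -/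
def scope (s : ℕ) (x : Cost α) : Cost α := ⟨x.val, x.ops, s, max x.peak s⟩

/-- Run `x` and overwrite the stored object `a` by its result; `size` is the number of numbers
that an object consists of. -/
def overwrite (size : α → ℕ) (a : α) (x : Cost α) : Cost α :=
  ⟨x.val, x.ops, size x.val - size a, max x.peak (size x.val - size a)⟩

/-- Run one computation for every index. -/
def forAll [Fintype ι] (x : ι → Cost α) : Cost (ι → α) :=
  ⟨fun i => (x i).val, ∑ i, (x i).ops, ∑ i, (x i).live, ∑ i, (x i).peak⟩

end Cost

/-! ### Precomputation of the weights of the non-terminals -/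

/-- A linear recurrence with polynomial coefficients for a sequence `a`: the initial values
`a 0, …, a (s - 1)`, and for `m ≥ s` the relation
`lead(m) * a m = coeff₀(m) * a (m - 1) + coeff₁(m) * a (m - 2) + ⋯`.
A polynomial is the list of its coefficients, constant term first. -/
structure Recurrence where
  init : List ℝ
  lead : List ℝ
  coeff : List (List ℝ)

namespace Recurrence

/-- The number of constants of a recurrence. -/
def size (D : Recurrence) : ℕ :=
  D.init.length + D.lead.length + (D.coeff.map List.length).sum

/-- Horner evaluation. -/
def evalPoly (x : ℝ) : List ℝ → Cost ℝ
  | [] => pure 0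
  | c :: cs => do
    let v ← evalPoly x cs
    let y ← Cost.mul v x
    Cost.add c y

/-- The right-hand side of the relation, from the previous values, latest first. -/
def combine (x : ℝ) : List (List ℝ) → List ℝ → Cost ℝ
  | p :: ps, a :: as => do
    let c ← evalPoly x p
    let y ← Cost.mul c a
    let s ← combine x ps as
    Cost.add y s
  | _, _ => pure 0

/-- The value of index `m`, from the previous values, latest first. -/
def entry (D : Recurrence) (m : ℕ) (prev : List ℝ) : Cost ℝ :=
  if m < D.init.length then pure (D.init.getD m 0)
  else do
    let x ← Cost.ofIndex m
    let y ← combine x D.coeff prev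
    let z ← evalPoly x D.lead
    Cost.div y z

/-- The values of index `m - 1, …, 0`. -/
def fill (D : Recurrence) : ℕ → Cost (List ℝ)
  | 0 => pure []
  | m + 1 => do
    let prev ← D.fill m
    let a ← Cost.scope 1 (D.entry m prev)
    pure (a :: prev)

end Recurrence

/-- The table of the values of index `0, …, n` for every non-terminal. -/
def precompute {N : Type} [Fintype N] (D : N → Recurrence) (n : ℕ) : Cost (N → List ℝ) :=
  Cost.forAll fun A => do
    let l ← (D A).fill (n + 1)
    pure l.reverse

/-! ### Weighted unranking -/

/-- The boustrophedon order `0, m, 1, m - 1, 2, …` on `{0, …, m}`. -/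
def boustrophedon (m : ℕ) : List ℕ :=
  (List.range (m + 1)).map fun j => if j % 2 = 0 then j / 2 else m - j / 2

/-- Investigates the decompositions `m = i + (m - i)` in the given order, where `b i` and `c (m - i)`
are the weights of the two factors. Returns the first `i` at which the rank falls, the rank that
remains, and the total weight that was skipped. -/
def findSplit (b c : ℕ → ℝ) (m : ℕ) : List ℕ → ℝ → ℝ → Cost (ℕ × ℝ × ℝ)
  | [], r, L => pure (0, r, L)
  | i :: is, r, L => do
    let p ← Cost.mul (b i) (c (m - i))
    if ← Cost.lt r p then
      pure (i, r, L)
    else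
      let r' ← Cost.sub r p
      let L' ← Cost.add L p
      findSplit b c m is r' L'

/-- Unranking: the word of length `m` generated from `A` to which the rank `r` belongs, and its
interval `[I_L, I_R)`. `tbl` holds the weights of the non-terminals. The first explicit argument
bounds the depth of the recursion. -/
def unrank {T N : Type} (G : WeightedGrammar T N) (tbl : N → ℕ → ℝ) :
    ℕ → N → ℕ → ℝ → Cost (List T × ℝ × ℝ)
  | 0, _, _, _ => pure ([], 0, 0)
  | d + 1, A, m, r => Cost.scope 2 <|
    match G.rule A with
    | .union B C => do
      if ← Cost.lt r (tbl B m) then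
        unrank G tbl d B m r
      else
        let r' ← Cost.sub r (tbl B m)
        let (w, L, R) ← unrank G tbl d C m r'
        let IL ← Cost.add L (tbl B m)
        let IR ← Cost.add R (tbl B m)
        pure (w, IL, IR)
    | .prod B C => do
      let (i, r', L) ← Cost.scope 2 (findSplit (tbl B) (tbl C) m (boustrophedon m) r 0)
      let r₁ ← Cost.div r' (tbl C (m - i))
      let (w₁, L₁, R₁) ← unrank G tbl d B i r₁
      let p₁ ← Cost.sub R₁ L₁
      let x ← Cost.mul L₁ (tbl C (m - i))
      let y ← Cost.sub r' x
      let r₂ ← Cost.div y p₁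
      let (w₂, L₂, R₂) ← unrank G tbl d C (m - i) r₂
      let p₂ ← Cost.sub R₂ L₂
      let z ← Cost.mul L₂ p₁
      let s ← Cost.add L x
      let IL ← Cost.add s z
      let p ← Cost.mul p₁ p₂
      let IR ← Cost.add IL p
      pure (w₁ ++ w₂, IL, IR)
    | .term t => pure ([t], 0, G.weight t)
    | .eps => pure ([], 0, 1)

/-! ### The AVL tree of forbidden intervals -/

/-- A node holds its left subtree, a forbidden word `w` with its interval `[L, R)`, the total weight
`δ` of the forbidden words of the left subtree, the right subtree, and the height. -/
inductive GapTree (T : Type) where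
  | nil
  | node (left : GapTree T) (w : List T) (L R δ : ℝ) (right : GapTree T) (h : ℕ)

namespace GapTree

variable {T : Type}

def height : GapTree T → ℕ
  | nil => 0
  | node _ _ _ _ _ _ h => h

/-- The number of numbers that are stored in a tree. -/
def size : GapTree T → ℕ
  | nil => 0
  | node l _ _ _ _ r _ => l.size + r.size + 3

def mk (l : GapTree T) (w : List T) (L R δ : ℝ) (r : GapTree T) : GapTree T :=
  node l w L R δ r (max l.height r.height + 1)

def rotateRight : GapTree T → Cost (GapTree T)
  | node (node a w L R δ b _) w' L' R' δ' c _ => do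
    let p ← Cost.sub R L
    let s ← Cost.add δ p
    let d ← Cost.sub δ' s
    pure (mk a w L R δ (mk b w' L' R' d c))
  | t => pure t

def rotateLeft : GapTree T → Cost (GapTree T)
  | node a w L R δ (node b w' L' R' δ' c _) _ => do
    let p ← Cost.sub R L
    let s ← Cost.add δ p
    let d ← Cost.add δ' s
    pure (mk (mk a w L R δ b) w' L' R' d c)
  | t => pure t

/-- Is the left (resp. right) subtree higher than the other one? -/
def leftHeavy : GapTree T → Bool
  | nil => false
  | node l _ _ _ _ r _ => decide (r.height < l.height)

def rightHeavy : GapTree T → Bool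
  | nil => false
  | node l _ _ _ _ r _ => decide (l.height < r.height)

/-- The AVL balancing step at the root. -/
def rebalance : GapTree T → Cost (GapTree T)
  | nil => pure nil
  | node l w L R δ r h =>
    if r.height + 1 < l.height then
      if l.rightHeavy then do
        let l' ← rotateLeft l
        rotateRight (mk l' w L R δ r)
      else rotateRight (node l w L R δ r h)
    else if l.height + 1 < r.height then
      if r.leftHeavy then do
        let r' ← rotateRight r
        rotateLeft (mk l w L R δ r')
      else rotateLeft (node l w L R δ r h)
    else pure (node l w L R δ r h)

/-- Insertion of the word `w` with its interval `[L, R)`. -/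
def insert (w : List T) (L R : ℝ) : GapTree T → Cost (GapTree T)
  | nil => pure (mk nil w L R 0 nil)
  | node l w' L' R' δ' r _ => do
    if ← Cost.lt L L' then
      let p ← Cost.sub R L
      let d ← Cost.add δ' p
      let l' ← insert w L R l
      rebalance (mk l' w' L' R' d r)
    else
      let r' ← insert w L R r
      rebalance (mk l w' L' R' δ' r')

/-- Shifts the number `x` to the right so that it avoids every interval of the tree. -/
def modRandom (x : ℝ) : GapTree T → Cost ℝ
  | nil => pure x
  | node l _ L R δ r _ => do
    let y ← Cost.sub L δ
    if ← Cost.lt x y then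
      modRandom x l
    else
      let p ← Cost.sub R L
      let s ← Cost.add δ p
      let x' ← Cost.add x s
      modRandom x' r

end GapTree

/-! ### Non-redundant generation -/

/-- The state between two draws: the words generated so far, the tree of their intervals, and the
total weight of the words of length `n` that have not been generated. -/
structure State (T : Type) where
  out : List (List T)
  tree : GapTree T
  mass : ℝ

/-- The number of numbers that are stored in a state. -/
def State.size {T : Type} (s : State T) : ℕ := s.tree.size + 1

section Generate

variable {T N : Type} [Fintype T] [Fintype N]

/-- Generation of one more word, where `u` is drawn uniformly in `[0, 1)`. -/
def step (G : WeightedGrammar T N) (tbl : N → ℕ → ℝ) (n : ℕ) (s : State T) (u : ℝ) :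
    Cost (State T) :=
  Cost.overwrite State.size s do
    let v ← Cost.number u
    let x ← Cost.mul v s.mass
    let y ← s.tree.modRandom x
    let (w, L, R) ← unrank G tbl ((n + 1) * (Fintype.card N + 1)) G.start n y
    let tree ← s.tree.insert w L R
    let p ← Cost.sub R L
    let mass ← Cost.sub s.mass p
    pure ⟨s.out ++ [w], tree, mass⟩

/-- One step for each random number. -/
def run (G : WeightedGrammar T N) (tbl : N → ℕ → ℝ) (n : ℕ) : State T → List ℝ → Cost (State T)
  | s, [] => pure s
  | s, u :: us => do
    let s' ← step G tbl n s u
    run G tbl n s' us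

/-- Non-redundant generation of `k` words of length `n` by unranking, where `u` are the random
numbers that are drawn. The weights of the letters and the constants of the recurrences `D` are
counted among the stored numbers. -/
def generate (G : WeightedGrammar T N) (D : N → Recurrence) (n k : ℕ) (u : Fin k → ℝ) :
    Cost (List (List T)) := do
  Cost.given (Fintype.card T + ∑ A, (D A).size)
  let table ← precompute D n
  let tbl : N → ℕ → ℝ := fun A m => (table A).getD m 0
  Cost.given 1
  let s ← run G tbl n ⟨[], GapTree.nil, tbl G.start n⟩ (List.ofFn u)
  pure s.out

end Generate

end NonRedundant

end

noncomputable section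

namespace NonRedundant

set_option linter.unusedSectionVars false

namespace WeightedGrammar
open Relation

variable {T N : Type} [Fintype N] {G : WeightedGrammar T N}

/-! ### Leftmost derivations -/

/-! Uniqueness of leftmost derivations is inherited from the axiom by every non-terminal below it
(`Good.union`, `Good.prod`). At such `Good` non-terminals unions are disjoint and product
factorisations unique, so weights add and convolve. Moreover a cycle of `Succ` would enlarge a parse
tree without changing its word; hence the number `rk` of non-terminals below is less than `|N|` and
drops along `Succ`. This rank controls everything that ε-productions could spoil. Non-terminals out
of reach of the axiom may be ambiguous, so all claims are confined to good ones.

Recurrences: the generating functions `f` of the good non-terminals solve a polynomial system with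
Jacobian matrix `J`. At `z = 0` the matrix lowers the rank, so `det (1 - J) ≠ 0`. Differentiating
the system and applying Cramer's rule has two consequences. The Kähler differentials of `ℝ(z)(f)`
over `ℝ(z)` vanish, so this extension is finite (`System.finiteDimensional`); and it contains all
iterates of `z d/dz` on `f`. These are therefore linearly dependent (`System.exists_equation`), and
comparing coefficients in the resulting differential equation gives a recurrence
(`exists_computes_of_equation`).

Cost of a draw: the boustrophedon order reaches the split `i` of `m` after `O(min i (m - i))`
trials, and a recursion that pays the smaller part at every split costs `O(m log m)`
(`unrankCost_prod`, `exists_locates`). The AVL tree has fewer than `|L_n| ≤ |Σ| ^ n` nodes, so its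
height is `O(n)` (`height_le`).

Probability: the words own consecutive intervals of length `π(w)` that tile `[0, π(L_n))`
(`exists_partition`). Shifting past the forbidden intervals moves the numbers that lead to a given
new word by a constant (`Separated.shift_mem_iff`), so these numbers form an interval of length
`π(w)` within the remaining mass. The tuples of draws that output `R` in the order `σ` are then a
box whose volume is the summand of `σ`, and boxes of different orders are disjoint
(`volume_eq_setProb`). -/

theorem mem_productions {r : ContextFreeRule T N} :
    r ∈ G.productions ↔ r.output ∈ (G.rule r.input).rhs := by
  classical
  simp only [productions, Finset.mem_biUnion, Finset.mem_univ, true_and, List.mem_toFinset,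
    List.mem_map]
  constructor
  · rintro ⟨A, α, h, rfl⟩
    exact h
  · intro h
    exact ⟨r.input, r.output, h, rfl⟩

/-- `LD G x d w`: `d` is the list of sentential forms of a leftmost derivation of `w` from `x`. -/
inductive LD (G : WeightedGrammar T N) :
    List (Symbol T N) → List (List (Symbol T N)) → List T → Prop
  | nil (w : List T) : LD G (w.map Symbol.terminal) [w.map Symbol.terminal] w
  | cons {x y d w} : G.LeftmostStep x y → LD G y d w → LD G x (x :: d) w

/-- Every word has at most one leftmost derivation from the sentential form `x`. -/
def Unique (G : WeightedGrammar T N) (x : List (Symbol T N)) : Prop :=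
  ∀ w d d', LD G x d w → LD G x d' w → d = d'

theorem LD.head {x : List (Symbol T N)} {d w} (h : LD G x d w) : d.head? = some x := by
  cases h <;> rfl

theorem LD.isChain {x : List (Symbol T N)} {d w} (h : LD G x d w) :
    d.IsChain G.LeftmostStep := by
  induction h with
  | nil w => simp
  | cons hs hd ih =>
    rename_i x y d w
    rw [List.isChain_cons]
    refine ⟨?_, ih⟩
    intro z hz
    rw [hd.head] at hz
    simp only [Option.mem_def, Option.some.injEq] at hz
    exact hz ▸ hs

theorem LD.getLast {x : List (Symbol T N)} {d w} (h : LD G x d w) :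
    d.getLast? = some (w.map Symbol.terminal) := by
  induction h with
  | nil w => simp
  | cons hs hd ih =>
    rename_i x y d w
    rw [List.getLast?_cons, ih]
    rfl

theorem Unambiguous.unique_start (h : G.Unambiguous) :
    Unique G [Symbol.nonterminal G.start] := fun w d d' hd hd' =>
  h w d d' ⟨hd.head, hd.isChain, hd.getLast⟩ ⟨hd'.head, hd'.isChain, hd'.getLast⟩

theorem LeftmostStep.append {x y : List (Symbol T N)} (h : G.LeftmostStep x y)
    (z : List (Symbol T N)) : G.LeftmostStep (x ++ z) (y ++ z) := by
  obtain ⟨r, hr, p, q, rfl, rfl⟩ := h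
  exact ⟨r, hr, p, q ++ z, by simp, by simp⟩

theorem LeftmostStep.prepend {x y : List (Symbol T N)} (h : G.LeftmostStep x y)
    (z : List T) : G.LeftmostStep (z.map Symbol.terminal ++ x) (z.map Symbol.terminal ++ y) := by
  obtain ⟨r, hr, p, q, rfl, rfl⟩ := h
  exact ⟨r, hr, z ++ p, q, by simp, by simp⟩

theorem not_leftmostStep_terminal (w : List T) (y : List (Symbol T N)) :
    ¬ G.LeftmostStep (w.map Symbol.terminal) y := by
  rintro ⟨r, -, p, q, h, -⟩
  have : Symbol.nonterminal r.input ∈ w.map (Symbol.terminal (N := N)) := by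
    rw [h]; simp
  simp at this

theorem leftmostStep_rule {A : N} {α : List (Symbol T N)} (h : α ∈ (G.rule A).rhs) :
    G.LeftmostStep [Symbol.nonterminal A] α :=
  ⟨⟨A, α⟩, mem_productions.2 h, [], [], by simp, by simp⟩

theorem LD.prepend {x : List (Symbol T N)} {d v} (h : LD G x d v) (w : List T) :
    LD G (w.map Symbol.terminal ++ x) (d.map (w.map Symbol.terminal ++ ·)) (w ++ v) := by
  induction h with
  | nil v =>
    have := LD.nil (G := G) (w ++ v)
    simpa using this
  | cons hs hd ih => exact LD.cons (hs.prepend w) ih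

/-- The leftmost rule exhausts `x` while `y` waits. The end of the first derivation and the start of
the second merge into one sentential form, which is the 1 in the length identity. -/
theorem LD.append {x y : List (Symbol T N)} {d e w v} (hx : LD G x d w) (hy : LD G y e v) :
    ∃ f, LD G (x ++ y) f (w ++ v) ∧ f.length + 1 = d.length + e.length := by
  induction hx with
  | nil w => exact ⟨_, hy.prepend w, by simp [add_comm]⟩
  | cons hs hd ih =>
    obtain ⟨f, hf, hl⟩ := ih
    exact ⟨_, LD.cons (hs.append y) hf, by simp only [List.length_cons]; omega⟩

theorem LD.eq_nil {x : List (Symbol T N)} {d w v} (h : LD G x d w)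
    (hx : x = v.map Symbol.terminal) : d = [x] ∧ w = v := by
  have inj : Function.Injective (Symbol.terminal (T := T) (N := N)) := fun a b h => by
    simpa using h
  cases h with
  | nil => exact ⟨rfl, (List.map_injective_iff.2 inj) hx⟩
  | cons hs hd => subst hx; exact absurd hs (not_leftmostStep_terminal _ _)

theorem Unique.step {x y : List (Symbol T N)} (h : Unique G x) (hs : G.LeftmostStep x y) :
    Unique G y := fun w d d' hd hd' => by
  have := h w _ _ (LD.cons hs hd) (LD.cons hs hd')
  simpa using this

theorem Unique.step_eq {x x' x'' : List (Symbol T N)} (h : Unique G x)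
    (hs : G.LeftmostStep x x') (hs' : G.LeftmostStep x x'') {d d' w} (hd : LD G x' d w)
    (hd' : LD G x'' d' w) : x' = x'' := by
  have := h w _ _ (LD.cons hs hd) (LD.cons hs' hd')
  simp only [List.cons.injEq, true_and] at this
  subst this
  have := hd.head.symm.trans hd'.head
  simpa using this

/-- A fixed derivation from `y` completes two derivations of `w` from `x` to derivations of one word
from `x ++ y`. These agree step by step, and cancelling `y` carries the agreement back to `x`. -/
theorem Unique.append_left {x y : List (Symbol T N)} (h : Unique G (x ++ y)) {e v}
    (hy : LD G y e v) : Unique G x := by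
  intro w d d' hd hd'
  induction hd generalizing d' with
  | nil w => exact (hd'.eq_nil rfl).1.symm
  | cons hs hd ih =>
    cases hd' with
    | nil => exact absurd hs (not_leftmostStep_terminal _ _)
    | cons hs' hd' =>
      obtain ⟨f, hf, -⟩ := hd.append hy
      obtain ⟨f', hf', -⟩ := hd'.append hy
      have := h.step_eq (hs.append y) (hs'.append y) hf hf'
      have := List.append_cancel_right this
      subst this
      rw [ih (h.step (hs.append y)) _ hd']

/-- Running the derivation of `x` to its end leaves a terminal prefix, which is inert. -/
theorem Unique.append_right {x y : List (Symbol T N)} (h : Unique G (x ++ y)) {d w}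
    (hx : LD G x d w) : Unique G y := by
  induction hx with
  | nil w =>
    intro v e e' he he'
    have := h _ _ _ (he.prepend w) (he'.prepend w)
    exact (List.map_injective_iff.2 fun a b h => List.append_cancel_left h) this
  | cons hs hd ih => exact ih (h.step (hs.append y))

/-- The two derivations of the common word are equal, and while `x` still contains a non-terminal
both act inside `x`. So `x` is rewritten into the same terminal word in both. -/
theorem Unique.factor {x y : List (Symbol T N)} (h : Unique G (x ++ y)) {d d' e e' w w' v v'}
    (hx : LD G x d w) (hx' : LD G x d' w') (hy : LD G y e v) (hy' : LD G y e' v')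
    (hw : w ++ v = w' ++ v') : w = w' := by
  induction hx generalizing d' with
  | nil w => exact (hx'.eq_nil rfl).2.symm
  | cons hs hd ih =>
    cases hx' with
    | nil => exact absurd hs (not_leftmostStep_terminal _ _)
    | cons hs' hd' =>
      obtain ⟨f, hf, -⟩ := hd.append hy
      obtain ⟨f', hf', -⟩ := hd'.append hy'
      have := h.step_eq (hs.append y) (hs'.append y) hf (hw ▸ hf')
      have := List.append_cancel_right this
      subst this
      exact ih (h.step (hs.append y)) hd' hw

/-! ### Parse trees -/

/-- `Gen G A w k`: there is a parse tree with `k` inner nodes of the word `w` from `A`. -/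
inductive Gen (G : WeightedGrammar T N) : N → List T → ℕ → Prop
  | term {A t} : G.rule A = .term t → Gen G A [t] 1
  | eps {A} : G.rule A = .eps → Gen G A [] 1
  | unionLeft {A B C w k} : G.rule A = .union B C → Gen G B w k → Gen G A w (k + 1)
  | unionRight {A B C w k} : G.rule A = .union B C → Gen G C w k → Gen G A w (k + 1)
  | prod {A B C w v k l} : G.rule A = .prod B C → Gen G B w k → Gen G C v l →
      Gen G A (w ++ v) (k + l + 1)

/-- Every inner node is expanded by exactly one leftmost step. The length is recorded because it
turns uniqueness of derivations into uniqueness of tree sizes. -/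
theorem Gen.exists_ld {A : N} {w k} (h : Gen G A w k) :
    ∃ d, LD G [Symbol.nonterminal A] d w ∧ d.length = k + 1 := by
  induction h with
  | @term A t hr =>
    exact ⟨_, LD.cons (leftmostStep_rule (by simp [hr, Rule.rhs])) (LD.nil [t]), by simp⟩
  | @eps A hr => exact ⟨_, LD.cons (leftmostStep_rule (by simp [hr, Rule.rhs])) (LD.nil []), by simp⟩
  | unionLeft hr hg ih =>
    obtain ⟨d, hd, hl⟩ := ih
    exact ⟨_, LD.cons (leftmostStep_rule (by simp [hr, Rule.rhs])) hd, by simp [hl]⟩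
  | unionRight hr hg ih =>
    obtain ⟨d, hd, hl⟩ := ih
    exact ⟨_, LD.cons (leftmostStep_rule (by simp [hr, Rule.rhs])) hd, by simp [hl]⟩
  | prod hr hg hg' ih ih' =>
    obtain ⟨d, hd, hl⟩ := ih
    obtain ⟨d', hd', hl'⟩ := ih'
    obtain ⟨f, hf, hl''⟩ := hd.append hd'
    exact ⟨_, LD.cons (leftmostStep_rule (by simp [hr, Rule.rhs])) hf, by
      simp only [List.length_cons]; omega⟩

/-- A sentential form generates a word. -/
def GenForm (G : WeightedGrammar T N) : List (Symbol T N) → List T → Prop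
  | [], w => w = []
  | .terminal t :: x, w => ∃ v, w = t :: v ∧ GenForm G x v
  | .nonterminal A :: x, w => ∃ u v k, w = u ++ v ∧ Gen G A u k ∧ GenForm G x v

theorem genForm_append {x y : List (Symbol T N)} {w : List T} :
    GenForm G (x ++ y) w ↔ ∃ u v, w = u ++ v ∧ GenForm G x u ∧ GenForm G y v := by
  induction x generalizing w with
  | nil => simp [GenForm]
  | cons s x ih =>
    cases s with
    | terminal t =>
      simp only [List.cons_append, GenForm, ih]
      constructor
      · rintro ⟨_, rfl, u, v, rfl, h, h'⟩
        exact ⟨t :: u, v, rfl, ⟨u, rfl, h⟩, h'⟩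
      · rintro ⟨_, v, rfl, ⟨u, rfl, h⟩, h'⟩
        exact ⟨_, rfl, u, v, rfl, h, h'⟩
    | nonterminal A =>
      simp only [List.cons_append, GenForm, ih]
      constructor
      · rintro ⟨a, _, k, rfl, hA, u, v, rfl, h, h'⟩
        exact ⟨a ++ u, v, by simp, ⟨a, u, k, rfl, hA, h⟩, h'⟩
      · rintro ⟨_, v, rfl, ⟨a, u, k, rfl, hA, h⟩, h'⟩
        exact ⟨a, u ++ v, k, by simp, hA, u, v, rfl, h, h'⟩

theorem genForm_terminal (w : List T) : GenForm G (w.map Symbol.terminal) w := by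
  induction w with
  | nil => rfl
  | cons t w ih => exact ⟨w, rfl, ih⟩

theorem genForm_rule {A : N} {α : List (Symbol T N)} (hα : α ∈ (G.rule A).rhs) {w : List T}
    (h : GenForm G α w) : ∃ k, Gen G A w k := by
  rcases hr : G.rule A with ⟨B, C⟩ | ⟨B, C⟩ | t | _ <;> rw [hr] at hα <;>
    simp only [Rule.rhs, List.mem_cons, List.not_mem_nil, or_false] at hα
  · subst hα
    obtain ⟨u, _, k, rfl, hu, v, v', l, rfl, hv, rfl⟩ := h
    rw [List.append_nil]
    exact ⟨_, .prod hr hu hv⟩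
  · rcases hα with rfl | rfl
    · obtain ⟨u, _, k, rfl, hu, rfl⟩ := h
      rw [List.append_nil]
      exact ⟨_, .unionLeft hr hu⟩
    · obtain ⟨u, _, k, rfl, hu, rfl⟩ := h
      rw [List.append_nil]
      exact ⟨_, .unionRight hr hu⟩
  · subst hα
    obtain ⟨_, rfl, rfl⟩ := h
    exact ⟨_, .term hr⟩
  · subst hα
    obtain rfl := h
    exact ⟨_, .eps hr⟩

/-- Read backwards from the terminal word, a step folds the words of a right-hand side into one
node. Its position plays no role, so arbitrary derivations reduce to parse trees and, by
`Gen.exists_ld`, to leftmost ones. -/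
theorem genForm_of_derives {x : List (Symbol T N)} {w : List T}
    (h : G.toCFG.Derives x (w.map Symbol.terminal)) : GenForm G x w := by
  induction h using Relation.ReflTransGen.head_induction_on with
  | refl => exact genForm_terminal w
  | head h _ ih =>
    obtain ⟨r, hr, hrw⟩ := h
    obtain ⟨p, q, rfl, rfl⟩ := hrw.exists_parts
    obtain ⟨_, v, rfl, h1, hv⟩ := genForm_append.1 ih
    obtain ⟨p', u, rfl, hp, hu⟩ := genForm_append.1 h1
    obtain ⟨k, hk⟩ := genForm_rule (mem_productions.1 hr) hu
    refine genForm_append.2 ⟨p' ++ u, v, rfl, genForm_append.2 ⟨p', u, rfl, hp, ?_⟩, hv⟩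
    exact ⟨u, [], k, by simp, hk, rfl⟩

theorem LeftmostStep.produces {x y : List (Symbol T N)} (h : G.LeftmostStep x y) :
    G.toCFG.Produces x y := by
  obtain ⟨r, hr, p, q, rfl, rfl⟩ := h
  exact ⟨r, hr, ContextFreeRule.rewrites_iff.2 ⟨_, q, rfl, rfl⟩⟩

theorem LD.derives {x : List (Symbol T N)} {d w} (h : LD G x d w) :
    G.toCFG.Derives x (w.map Symbol.terminal) := by
  induction h with
  | nil w => exact Relation.ReflTransGen.refl
  | cons hs _ ih => exact Relation.ReflTransGen.head hs.produces ih

theorem mem_lang {A : N} {w : List T} : w ∈ G.lang A ↔ ∃ k, Gen G A w k := by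
  constructor
  · intro h
    obtain ⟨u, v, k, rfl, hu, rfl⟩ := genForm_of_derives h
    exact ⟨k, by simpa using hu⟩
  · rintro ⟨k, h⟩
    obtain ⟨d, hd, -⟩ := h.exists_ld
    exact hd.derives

theorem mem_lang_ld {A : N} {w : List T} (h : w ∈ G.lang A) :
    ∃ d, LD G [Symbol.nonterminal A] d w := by
  obtain ⟨k, hk⟩ := mem_lang.1 h
  obtain ⟨d, hd, -⟩ := hk.exists_ld
  exact ⟨d, hd⟩

theorem lang_term {A : N} {t : T} (hr : G.rule A = .term t) : G.lang A = {[t]} := by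
  ext w
  rw [mem_lang]
  constructor
  · rintro ⟨k, h⟩
    cases h <;> simp_all
  · rintro rfl
    exact ⟨_, .term hr⟩

theorem lang_eps {A : N} (hr : G.rule A = .eps) : G.lang A = {[]} := by
  ext w
  rw [mem_lang]
  constructor
  · rintro ⟨k, h⟩
    cases h <;> simp_all
  · rintro rfl
    exact ⟨_, .eps hr⟩

theorem lang_union {A B C : N} (hr : G.rule A = .union B C) :
    G.lang A = G.lang B ∪ G.lang C := by
  ext w
  simp only [Set.mem_union, mem_lang]
  constructor
  · rintro ⟨k, h⟩
    cases h with
    | unionLeft hr' h => rw [hr] at hr'; cases hr'; exact .inl ⟨_, h⟩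
    | unionRight hr' h => rw [hr] at hr'; cases hr'; exact .inr ⟨_, h⟩
    | _ => simp_all
  · rintro (⟨k, h⟩ | ⟨k, h⟩)
    · exact ⟨_, .unionLeft hr h⟩
    · exact ⟨_, .unionRight hr h⟩

theorem mem_lang_prod {A B C : N} (hr : G.rule A = .prod B C) {w : List T} :
    w ∈ G.lang A ↔ ∃ u ∈ G.lang B, ∃ v ∈ G.lang C, u ++ v = w := by
  simp only [mem_lang]
  constructor
  · rintro ⟨k, h⟩
    cases h with
    | prod hr' h h' => rw [hr] at hr'; cases hr'; exact ⟨_, ⟨_, h⟩, _, ⟨_, h'⟩, rfl⟩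
    | _ => simp_all
  · rintro ⟨u, ⟨k, hu⟩, v, ⟨l, hv⟩, rfl⟩
    exact ⟨_, .prod hr hu hv⟩

/-! ### Unambiguous non-terminals -/

/-- Every word has at most one leftmost derivation from the non-terminal `A`. -/
def Good (G : WeightedGrammar T N) (A : N) : Prop := Unique G [Symbol.nonterminal A]

theorem Good.union {A B C : N} (h : Good G A) (hr : G.rule A = .union B C) :
    Good G B ∧ Good G C :=
  ⟨h.step (leftmostStep_rule (by simp [hr, Rule.rhs])),
    h.step (leftmostStep_rule (by simp [hr, Rule.rhs]))⟩

theorem Good.unique_pair {A B C : N} (h : Good G A) (hr : G.rule A = .prod B C) :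
    Unique G ([Symbol.nonterminal B] ++ [Symbol.nonterminal C]) :=
  h.step (leftmostStep_rule (by simp [hr, Rule.rhs]))

/-- Productivity of each factor supplies the derivation that `Unique.append_left` or
`Unique.append_right` needs for the other one. -/
theorem Good.prod (hG : G.IsBCNF) {A B C : N} (h : Good G A) (hr : G.rule A = .prod B C) :
    Good G B ∧ Good G C := by
  obtain ⟨u, hu⟩ := hG.productive B
  obtain ⟨v, hv⟩ := hG.productive C
  obtain ⟨d, hd⟩ := mem_lang_ld hu
  obtain ⟨e, he⟩ := mem_lang_ld hv
  exact ⟨(h.unique_pair hr).append_left he, (h.unique_pair hr).append_right hd⟩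

/-- A common word would have derivations with first steps to `B` and to `C`; `union_ne` is what
makes these steps different. -/
theorem Good.disjoint (hG : G.IsBCNF) {A B C : N} (h : Good G A) (hr : G.rule A = .union B C)
    {w : List T} (hB : w ∈ G.lang B) (hC : w ∈ G.lang C) : False := by
  obtain ⟨d, hd⟩ := mem_lang_ld hB
  obtain ⟨e, he⟩ := mem_lang_ld hC
  have := Unique.step_eq h (leftmostStep_rule (α := [.nonterminal B]) (by simp [hr, Rule.rhs]))
    (leftmostStep_rule (α := [.nonterminal C]) (by simp [hr, Rule.rhs])) hd he
  exact hG.union_ne A B C hr (by simpa using this)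

theorem Good.factor {A B C : N} (h : Good G A) (hr : G.rule A = .prod B C)
    {u u' v v' : List T} (hu : u ∈ G.lang B) (hu' : u' ∈ G.lang B) (hv : v ∈ G.lang C)
    (hv' : v' ∈ G.lang C) (he : u ++ v = u' ++ v') : u = u' ∧ v = v' := by
  obtain ⟨d, hd⟩ := mem_lang_ld hu
  obtain ⟨d', hd'⟩ := mem_lang_ld hu'
  obtain ⟨e, hve⟩ := mem_lang_ld hv
  obtain ⟨e', hve'⟩ := mem_lang_ld hv'
  have := (h.unique_pair hr).factor hd hd' hve hve' he
  subst this
  exact ⟨rfl, List.append_cancel_left he⟩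

theorem Good.size_unique {A : N} (h : Good G A) {w : List T} {k l : ℕ} (hk : Gen G A w k)
    (hl : Gen G A w l) : k = l := by
  obtain ⟨d, hd, h1⟩ := hk.exists_ld
  obtain ⟨e, he, h2⟩ := hl.exists_ld
  have := h w d e hd he
  subst this
  omega

/-- `B` is a successor of `A` that may generate the same words as `A`. -/
def Succ (G : WeightedGrammar T N) (A B : N) : Prop :=
  ∃ C, G.rule A = .union B C ∨ G.rule A = .union C B ∨
    (G.rule A = .prod B C ∧ [] ∈ G.lang C) ∨ (G.rule A = .prod C B ∧ [] ∈ G.lang C)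

theorem Succ.good (hG : G.IsBCNF) {A B : N} (h : Succ G A B) (hA : Good G A) : Good G B := by
  obtain ⟨C, h | h | ⟨h, -⟩ | ⟨h, -⟩⟩ := h
  · exact (hA.union h).1
  · exact (hA.union h).2
  · exact (hA.prod hG h).1
  · exact (hA.prod hG h).2

theorem Succ.gen {A B : N} (h : Succ G A B) {w : List T} {k : ℕ} (hw : Gen G B w k) :
    ∃ l, k < l ∧ Gen G A w l := by
  obtain ⟨C, h | h | ⟨h, hC⟩ | ⟨h, hC⟩⟩ := h
  · exact ⟨_, by omega, .unionLeft h hw⟩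
  · exact ⟨_, by omega, .unionRight h hw⟩
  · obtain ⟨l, hl⟩ := mem_lang.1 hC
    have := Gen.prod h hw hl
    rw [List.append_nil] at this
    exact ⟨_, by omega, this⟩
  · obtain ⟨l, hl⟩ := mem_lang.1 hC
    have := Gen.prod h hl hw
    rw [List.nil_append] at this
    exact ⟨_, by omega, this⟩

theorem gen_of_transGen_succ {A B : N} (h : TransGen (Succ G) A B) {w : List T} {k : ℕ}
    (hw : Gen G B w k) : ∃ l, k < l ∧ Gen G A w l := by
  induction h using TransGen.head_induction_on with
  | single h => exact h.gen hw
  | head h _ ih =>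
    obtain ⟨l, hl, hl'⟩ := ih
    obtain ⟨l', h1, h2⟩ := h.gen hl'
    exact ⟨l', by omega, h2⟩

/-- A cycle would lead from a tree of some word of `A` to a larger tree of the same word, against
`Good.size_unique`. -/
theorem Good.acyclic (hG : G.IsBCNF) {A : N} (h : Good G A) : ¬ TransGen (Succ G) A A := by
  intro hA
  obtain ⟨w, hw⟩ := hG.productive A
  obtain ⟨k, hk⟩ := mem_lang.1 hw
  obtain ⟨l, hl, hl'⟩ := gen_of_transGen_succ hA hk
  have := h.size_unique hk hl'
  omega

/-- The number of non-terminals below `A`. -/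
def rk (G : WeightedGrammar T N) (A : N) : ℕ := {B | TransGen (Succ G) A B}.ncard

/-- By acyclicity `A` itself is missing from the set that is counted. -/
theorem Good.rk_lt_card (hG : G.IsBCNF) {A : N} (h : Good G A) : rk G A < Fintype.card N := by
  rw [rk, ← Nat.card_eq_fintype_card, ← Set.ncard_univ]
  refine Set.ncard_lt_ncard ?_ (Set.toFinite _)
  rw [Set.ssubset_univ_iff, ne_eq, Set.eq_univ_iff_forall]
  exact fun h' => h.acyclic hG (h' A)

theorem Succ.rk_lt (hG : G.IsBCNF) {A B : N} (h : Succ G A B) (hA : Good G A) :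
    rk G B < rk G A := by
  refine Set.ncard_lt_ncard ?_ (Set.toFinite _)
  refine ⟨fun C hC => TransGen.head h hC, fun h' => ?_⟩
  exact (h.good hG hA).acyclic hG (h' (TransGen.single h))

end WeightedGrammar

namespace WeightedGrammar
open Relation

/-! ### Weights of the non-terminals -/

variable {T N : Type} [Fintype T] [Fintype N] {G : WeightedGrammar T N}

theorem finite_length_lang (G : WeightedGrammar T N) (A : N) (m : ℕ) :
    {w | w ∈ G.lang A ∧ w.length = m}.Finite :=
  (List.finite_length_eq T m).subset fun _ h => h.2

/-- The words of length `m` generated from `A`. -/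
def wordsOf (G : WeightedGrammar T N) (A : N) (m : ℕ) : Finset (List T) :=
  (finite_length_lang G A m).toFinset

/-- The total weight of the words of length `m` generated from `A`. -/
def total (G : WeightedGrammar T N) (A : N) (m : ℕ) : ℝ := ∑ w ∈ wordsOf G A m, G.wordWeight w

@[simp]
theorem mem_wordsOf {A : N} {m : ℕ} {w : List T} :
    w ∈ wordsOf G A m ↔ w ∈ G.lang A ∧ w.length = m := by
  simp [wordsOf]

theorem wordWeight_pos (G : WeightedGrammar T N) (w : List T) : 0 < G.wordWeight w := by
  induction w with
  | nil => simp [wordWeight]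
  | cons t w ih =>
    simp only [wordWeight, List.map_cons, List.prod_cons] at ih ⊢
    exact mul_pos (G.weight_pos t) ih

theorem wordWeight_append (G : WeightedGrammar T N) (u v : List T) :
    G.wordWeight (u ++ v) = G.wordWeight u * G.wordWeight v := by
  simp [wordWeight]

theorem total_nonneg (G : WeightedGrammar T N) (A : N) (m : ℕ) : 0 ≤ total G A m :=
  Finset.sum_nonneg fun w _ => (wordWeight_pos G w).le

theorem total_pos_iff {A : N} {m : ℕ} : 0 < total G A m ↔ ∃ w ∈ G.lang A, w.length = m := by
  constructor
  · intro h
    obtain ⟨w, hw, -⟩ := Finset.exists_ne_zero_of_sum_ne_zero h.ne'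
    exact ⟨w, mem_wordsOf.1 hw⟩
  · rintro ⟨w, hw⟩
    exact Finset.sum_pos (fun w _ => wordWeight_pos G w) ⟨w, mem_wordsOf.2 hw⟩

theorem coe_wordsOf_start (G : WeightedGrammar T N) (n : ℕ) :
    (wordsOf G G.start n : Set (List T)) = G.words n := by
  ext w
  simp [words]

theorem setWeight_words (G : WeightedGrammar T N) (n : ℕ) :
    G.setWeight (G.words n) = total G G.start n := by
  rw [← coe_wordsOf_start, setWeight, finsum_mem_coe_finset]
  rfl

theorem total_term {A : N} {t : T} (hr : G.rule A = .term t) (m : ℕ) :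
    total G A m = if m = 1 then G.weight t else 0 := by
  have : wordsOf G A m = if m = 1 then {[t]} else ∅ := by
    ext w
    rw [mem_wordsOf, lang_term hr]
    split_ifs with h
    · simp only [Set.mem_singleton_iff, Finset.mem_singleton]
      exact ⟨fun h => h.1, fun h' => ⟨h', by simp [h', h]⟩⟩
    · simp only [Set.mem_singleton_iff, Finset.notMem_empty, iff_false]
      rintro ⟨rfl, h'⟩
      exact h (by simpa using h'.symm)
  rw [total, this]
  split_ifs <;> simp [wordWeight]

theorem total_eps {A : N} (hr : G.rule A = .eps) (m : ℕ) :
    total G A m = if m = 0 then 1 else 0 := by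
  have : wordsOf G A m = if m = 0 then {[]} else ∅ := by
    ext w
    rw [mem_wordsOf, lang_eps hr]
    split_ifs with h
    · simp only [Set.mem_singleton_iff, Finset.mem_singleton]
      exact ⟨fun h => h.1, fun h' => ⟨h', by simp [h', h]⟩⟩
    · simp only [Set.mem_singleton_iff, Finset.notMem_empty, iff_false]
      rintro ⟨rfl, h'⟩
      exact h (by simpa using h'.symm)
  rw [total, this]
  split_ifs <;> simp [wordWeight]

theorem Good.total_union (hG : G.IsBCNF) {A B C : N} (h : Good G A)
    (hr : G.rule A = .union B C) (m : ℕ) : total G A m = total G B m + total G C m := by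
  classical
  have : wordsOf G A m = wordsOf G B m ∪ wordsOf G C m := by
    ext w
    simp only [mem_wordsOf, lang_union hr, Finset.mem_union, Set.mem_union]
    tauto
  rw [total, this, Finset.sum_union]
  · rfl
  · rw [Finset.disjoint_left]
    intro w hB hC
    exact h.disjoint hG hr (mem_wordsOf.1 hB).1 (mem_wordsOf.1 hC).1

/-- Unique factorisation makes concatenation a bijection from the pairs of factors, sorted by their
lengths, onto the words of length `m`. Otherwise the convolution would count words repeatedly. -/
theorem Good.total_prod {A B C : N} (h : Good G A) (hr : G.rule A = .prod B C) (m : ℕ) :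
    total G A m = ∑ ij ∈ Finset.HasAntidiagonal.antidiagonal m, total G B ij.1 * total G C ij.2 := by
  have h1 : ∀ ij : ℕ × ℕ, total G B ij.1 * total G C ij.2 =
      ∑ x ∈ wordsOf G B ij.1 ×ˢ wordsOf G C ij.2, G.wordWeight (x.1 ++ x.2) := by
    intro ij
    simp only [total, Finset.sum_mul_sum, Finset.sum_product, wordWeight_append]
  simp only [h1]
  rw [Finset.sum_sigma', total]
  symm
  refine Finset.sum_bij (fun x _ => x.2.1 ++ x.2.2) ?_ ?_ ?_ ?_
  · rintro ⟨⟨i, j⟩, u, v⟩ hx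
    simp only [Finset.mem_sigma, Finset.HasAntidiagonal.mem_antidiagonal, Finset.mem_product, mem_wordsOf] at hx
    rw [mem_wordsOf, mem_lang_prod hr]
    exact ⟨⟨u, hx.2.1.1, v, hx.2.2.1, rfl⟩, by simp [hx]⟩
  · rintro ⟨⟨i, j⟩, u, v⟩ hx ⟨⟨i', j'⟩, u', v'⟩ hx' he
    simp only [Finset.mem_sigma, Finset.HasAntidiagonal.mem_antidiagonal, Finset.mem_product, mem_wordsOf] at hx hx'
    obtain ⟨rfl, rfl⟩ := h.factor hr hx.2.1.1 hx'.2.1.1 hx.2.2.1 hx'.2.2.1 he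
    obtain ⟨-, ⟨-, rfl⟩, -, rfl⟩ := hx
    obtain ⟨-, ⟨-, rfl⟩, -, rfl⟩ := hx'
    rfl
  · intro w hw
    rw [mem_wordsOf, mem_lang_prod hr] at hw
    obtain ⟨⟨u, hu, v, hv, rfl⟩, hl⟩ := hw
    exact ⟨⟨(u.length, v.length), u, v⟩, by simpa [hu, hv] using hl, rfl⟩
  · intros; rfl

end WeightedGrammar

namespace Holonomic
open PowerSeries LaurentSeries
open scoped Polynomial RatFunc

/-! ### Polynomial systems are holonomic -/

/-- Cramer's rule for `(1 - J) v = b`, with unknowns in a module so that it serves Kähler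
differentials as well as power series. -/
theorem det_smul_eq {M R V : Type*} [Fintype M] [DecidableEq M] [CommRing R] [AddCommGroup V]
    [Module R V] (J : Matrix M M R) (v b : M → V)
    (h : ∀ A, v A = ∑ B, J A B • v B + b A) (C : M) :
    (1 - J).det • v C = ∑ A, (1 - J).adjugate C A • b A := by
  have hb : ∀ A, b A = ∑ B, (1 - J) A B • v B := by
    intro A
    simp only [Matrix.sub_apply, sub_smul, Finset.sum_sub_distrib, Matrix.one_apply, ite_smul,
      one_smul, zero_smul, Finset.sum_ite_eq, Finset.mem_univ, if_true]
    rw [eq_sub_iff_add_eq, add_comm]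
    exact (h A).symm
  simp only [hb, Finset.smul_sum, smul_smul]
  rw [Finset.sum_comm]
  simp only [← Finset.sum_smul, ← Matrix.mul_apply, Matrix.adjugate_mul]
  simp [Matrix.smul_apply, Matrix.one_apply, ite_smul]

/-- At `z = 0` the matrix `J` is strictly triangular with respect to `ρ`, so a kernel vector of `1 -
J` at `z = 0` vanishes by strong induction on `ρ`. -/
theorem det_one_sub_ne_zero {M : Type*} [Fintype M] [DecidableEq M] (J : Matrix M M ℝ⟦X⟧)
    (ρ : M → ℕ) (h : ∀ A B, constantCoeff (J A B) ≠ 0 → ρ B < ρ A) : (1 - J).det ≠ 0 := by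
  intro h0
  have h1 : ((constantCoeff (R := ℝ)).mapMatrix (1 - J)).det = 0 := by
    rw [← RingHom.map_det, h0, map_zero]
  obtain ⟨v, hv, hv0⟩ := Matrix.exists_mulVec_eq_zero_iff.2 h1
  apply hv
  have key : ∀ A, v A = ∑ B, constantCoeff (J A B) * v B := by
    intro A
    have := congrFun hv0 A
    rw [map_sub, map_one, Matrix.sub_mulVec, Matrix.one_mulVec, Pi.sub_apply, Pi.zero_apply,
      sub_eq_zero] at this
    rw [this]
    rfl
  have : ∀ k A, ρ A = k → v A = 0 := by
    intro k
    induction k using Nat.strong_induction_on with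
    | _ k ih =>
      intro A hA
      rw [key A]
      refine Finset.sum_eq_zero fun B _ => ?_
      by_cases hB : constantCoeff (J A B) = 0
      · rw [hB, zero_mul]
      · rw [ih (ρ B) (hA ▸ h A B hB) B rfl, mul_zero]
  funext A
  exact this _ A rfl

/-- The elements `f` solve a system of polynomial equations over `R` with the Jacobian matrix `J`. -/
def System (R : Type*) {S M : Type*} [DecidableEq M] [CommRing R] [CommRing S] [Algebra R S]
    (f : M → S) (J : Matrix M M S) : Prop :=
  ∀ A, (∃ B C, f A = f B * f C ∧
      ∀ E, J A E = (if E = B then f C else 0) + (if E = C then f B else 0)) ∨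
    (∃ B C, f A = f B + f C ∧
      ∀ E, J A E = (if E = B then 1 else 0) + (if E = C then 1 else 0)) ∨
    (∃ p : R, f A = algebraMap R S p ∧ ∀ E, J A E = 0)

section

variable {R S M : Type*} [Fintype M] [DecidableEq M] [CommRing R] [CommRing S] [Algebra R S]

theorem System.map {f : M → S} {J : Matrix M M S} (h : System R f J) {K E : Type*} [CommRing K]
    [CommRing E] [Algebra K E] (φ : S →+* E)
    (hφ : ∀ p : R, ∃ q : K, φ (algebraMap R S p) = algebraMap K E q) :
    System K (fun A => φ (f A)) (J.map φ) := by
  intro A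
  rcases h A with ⟨B, C, hf, hJ⟩ | ⟨B, C, hf, hJ⟩ | ⟨p, hf, hJ⟩
  · exact .inl ⟨B, C, by simp only [hf, map_mul], fun E => by simp [hJ, apply_ite φ]⟩
  · exact .inr (.inl ⟨B, C, by simp only [hf, map_add], fun E => by simp [hJ, apply_ite φ]⟩)
  · obtain ⟨q, hq⟩ := hφ p
    exact .inr (.inr ⟨q, by simp only [hf, hq], fun E => by simp [hJ]⟩)

theorem System.mem_adjoin {f : M → S} {J : Matrix M M S} (h : System R f J) (A B : M) :
    J A B ∈ Algebra.adjoin R (Set.range f) := by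
  have hf : ∀ A, f A ∈ Algebra.adjoin R (Set.range f) := fun A => Algebra.subset_adjoin ⟨A, rfl⟩
  rcases h A with ⟨C, E, -, hJ⟩ | ⟨C, E, -, hJ⟩ | ⟨p, -, hJ⟩
  · rw [hJ]
    refine add_mem ?_ ?_ <;> split_ifs <;> first | exact hf _ | exact zero_mem _
  · rw [hJ]
    refine add_mem ?_ ?_ <;> split_ifs <;> first | exact one_mem _ | exact zero_mem _
  · rw [hJ]; exact zero_mem _

/-- A derivation that vanishes on `R` satisfies the linearised system. -/
theorem System.derivation {f : M → S} {J : Matrix M M S} (h : System R f J) {V : Type*}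
    [AddCommGroup V] [Module S V] (D : S → V) (hadd : ∀ x y, D (x + y) = D x + D y)
    (hmul : ∀ x y, D (x * y) = x • D y + y • D x) :
    ∃ b : M → V, (∀ A, D (f A) = ∑ B, J A B • D (f B) + b A) ∧
      ∀ A, b A = 0 ∨ ∃ p : R, b A = D (algebraMap R S p) := by
  have : ∀ A, ∃ b : V, D (f A) = ∑ B, J A B • D (f B) + b ∧
      (b = 0 ∨ ∃ p : R, b = D (algebraMap R S p)) := by
    intro A
    rcases h A with ⟨B, C, hf, hJ⟩ | ⟨B, C, hf, hJ⟩ | ⟨p, hf, hJ⟩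
    · refine ⟨0, ?_, .inl rfl⟩
      simp [hJ, add_smul, Finset.sum_add_distrib, hf, hmul, add_comm]
    · refine ⟨0, ?_, .inl rfl⟩
      simp [hJ, add_smul, Finset.sum_add_distrib, hf, hadd]
    · exact ⟨D (algebraMap R S p), by simp [hJ, hf], .inr ⟨p, rfl⟩⟩
  choose b hb using this
  exact ⟨b, fun A => (hb A).1, fun A => (hb A).2⟩

theorem derivation_eq_zero_of_adjoin {K E V : Type*} [Field K] [Field E] [Algebra K E] {s : Set E}
    [AddCommGroup V] [Module (IntermediateField.adjoin K s) V] [Module K V]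
    (D : Derivation K (IntermediateField.adjoin K s) V)
    (h : ∀ x (hx : x ∈ s), D ⟨x, IntermediateField.subset_adjoin K s hx⟩ = 0)
    (x : IntermediateField.adjoin K s) : D x = 0 := by
  obtain ⟨x, hx⟩ := x
  induction hx using IntermediateField.adjoin_induction with
  | mem x hx => exact h x hx
  | algebraMap x => exact D.map_algebraMap x
  | add x y hx hy ihx ihy =>
    have := D.map_add ⟨x, hx⟩ ⟨y, hy⟩
    rw [ihx, ihy, add_zero] at this
    exact this
  | inv x hx ihx =>
    have := D.leibniz_inv ⟨x, hx⟩
    rw [ihx, smul_zero] at this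
    exact this
  | mul x y hx hy ihx ihy =>
    have := D.leibniz ⟨x, hx⟩ ⟨y, hy⟩
    rw [ihx, ihy, smul_zero, smul_zero, add_zero] at this
    exact this

/-- This is the Jacobian criterion: an invertible `1 - J` makes the universal derivation vanish on
the generators, hence on the field `L` generated by `f`. An extension that is formally unramified
and essentially of finite type is finite. -/
theorem System.finiteDimensional {K E : Type*} [Field K] [Field E] [Algebra K E] {f : M → E}
    {J : Matrix M M E} (h : System K f J) (hdet : (1 - J).det ≠ 0) :
    FiniteDimensional K (IntermediateField.adjoin K (Set.range f)) := by
  let L := IntermediateField.adjoin K (Set.range f)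
  let D := KaehlerDifferential.D K L
  let g : M → L := fun A => ⟨f A, IntermediateField.subset_adjoin K _ ⟨A, rfl⟩⟩
  let J' : Matrix M M L := fun A B =>
    ⟨J A B, IntermediateField.algebra_adjoin_le_adjoin K _ (h.mem_adjoin A B)⟩
  have hdet' : (1 - J').det ≠ 0 := by
    intro h0
    have h1 : (algebraMap L E) (1 - J').det = (1 - J).det := by
      rw [RingHom.map_det, map_sub, map_one]
      rfl
    rw [h0, map_zero] at h1
    exact hdet h1.symm
  have hs : System K g J' := by
    intro A
    rcases h A with ⟨B, C, hf, hJ⟩ | ⟨B, C, hf, hJ⟩ | ⟨p, hf, hJ⟩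
    · refine .inl ⟨B, C, Subtype.ext hf, fun F => Subtype.ext ((hJ F).trans ?_)⟩
      push_cast [apply_ite Subtype.val]
      rfl
    · refine .inr (.inl ⟨B, C, Subtype.ext hf, fun F => Subtype.ext ((hJ F).trans ?_)⟩)
      push_cast [apply_ite Subtype.val]
      rfl
    · exact .inr (.inr ⟨p, Subtype.ext hf, fun F => Subtype.ext (hJ F)⟩)
  obtain ⟨b, hb, hb0⟩ := hs.derivation D (map_add D) D.leibniz
  -- The inhomogeneous terms are zero or differentials of elements of `K`, so Cramer's rule leaves
  -- zero on the right.
  have hDg : ∀ A, D (g A) = 0 := by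
    intro A
    have := det_smul_eq J' (fun A => D (g A)) b hb A
    rw [Finset.sum_eq_zero] at this
    · exact (smul_eq_zero.1 this).resolve_left hdet'
    · intro B _
      rcases hb0 B with h0 | ⟨p, h0⟩
      · rw [h0, smul_zero]
      · rw [h0, D.map_algebraMap, smul_zero]
  have hsub : Subsingleton (Ω[L⁄K]) := by
    rw [← Submodule.subsingleton_iff L, ← subsingleton_iff_bot_eq_top,
      ← KaehlerDifferential.span_range_derivation, eq_comm, Submodule.span_eq_bot]
    rintro _ ⟨x, rfl⟩
    refine derivation_eq_zero_of_adjoin D ?_ x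
    rintro _ ⟨A, rfl⟩
    exact hDg A
  have : Algebra.FormallyUnramified K L := ⟨hsub⟩
  have : Algebra.EssFiniteType K L := by
    rw [IntermediateField.essFiniteType_iff]
    exact ⟨(Set.finite_range f).toFinset, by simp [L]⟩
  exact Algebra.FormallyUnramified.finite_of_free (R := K) (S := L)

theorem det_mem {S' : Subalgebra R S} {J : Matrix M M S} (h : ∀ A B, J A B ∈ S') :
    J.det ∈ S' := by
  rw [Matrix.det_apply]
  refine sum_mem fun σ _ => ?_
  rw [Units.smul_def]
  exact zsmul_mem (prod_mem fun A _ => h _ _) _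

theorem adjugate_mem {S' : Subalgebra R S} {J : Matrix M M S} (h : ∀ A B, J A B ∈ S')
    (A B : M) : J.adjugate A B ∈ S' := by
  rw [Matrix.adjugate_apply]
  refine det_mem fun C E => ?_
  rw [Matrix.updateRow_apply]
  split_ifs
  · rw [Pi.single_apply]
    split_ifs
    · exact one_mem _
    · exact zero_mem _
  · exact h _ _

theorem System.one_sub_mem_adjoin {f : M → S} {J : Matrix M M S} (h : System R f J) (A B : M) :
    (1 - J) A B ∈ Algebra.adjoin R (Set.range f) := by
  rw [Matrix.sub_apply, Matrix.one_apply]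
  refine sub_mem ?_ (h.mem_adjoin A B)
  split_ifs
  · exact one_mem _
  · exact zero_mem _

end

/-! ### Linear differential equations for power series solutions -/

section

variable {M : Type*} [Fintype M] [DecidableEq M] {f : M → ℝ⟦X⟧} {J : Matrix M M ℝ⟦X⟧}

/-- The operator `z d/dz`. -/
def euler (y : ℝ⟦X⟧) : ℝ⟦X⟧ := PowerSeries.X * PowerSeries.derivative ℝ y

theorem euler_add (y z : ℝ⟦X⟧) : euler (y + z) = euler y + euler z := by
  simp [euler, mul_add]

theorem euler_mul (y z : ℝ⟦X⟧) : euler (y * z) = y * euler z + z * euler y := by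
  simp only [euler, Derivation.leibniz, smul_eq_mul]
  ring

/-- The reason for `z d/dz` in place of `d/dz`: coefficients are multiplied by their index and stay
in place. -/
theorem coeff_euler (y : ℝ⟦X⟧) (m : ℕ) : coeff m (euler y) = m * coeff m y := by
  cases m with
  | zero => simp [euler]
  | succ m =>
    rw [euler, PowerSeries.coeff_succ_X_mul, PowerSeries.coeff_derivative]
    push_cast
    ring

theorem coeff_euler_iterate (y : ℝ⟦X⟧) (i m : ℕ) :
    coeff m (euler^[i] y) = (m : ℝ) ^ i * coeff m y := by
  induction i with
  | zero => simp
  | succ i ih => rw [Function.iterate_succ_apply', coeff_euler, ih, pow_succ]; ring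

theorem euler_polynomial (p : ℝ[X]) :
    euler (p : ℝ⟦X⟧) = ((Polynomial.X * Polynomial.derivative p : ℝ[X]) : ℝ⟦X⟧) := by
  rw [euler, PowerSeries.derivative_coe, Polynomial.coe_mul, Polynomial.coe_X]

/-- The field generated by the series `f` over the rational functions. -/
abbrev genField (f : M → ℝ⟦X⟧) : IntermediateField (RatFunc ℝ) ℝ⸨X⸩ :=
  IntermediateField.adjoin (RatFunc ℝ) (Set.range fun A => HahnSeries.ofPowerSeries ℤ ℝ (f A))

/-- The algebra generated by the series `f` over the polynomials. -/
abbrev genAlgebra (f : M → ℝ⟦X⟧) : Subalgebra ℝ[X] ℝ⟦X⟧ := Algebra.adjoin ℝ[X] (Set.range f)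

theorem ofPowerSeries_polynomial (p : ℝ[X]) :
    HahnSeries.ofPowerSeries ℤ ℝ (algebraMap ℝ[X] ℝ⟦X⟧ p) =
      algebraMap (RatFunc ℝ) ℝ⸨X⸩ (algebraMap ℝ[X] (RatFunc ℝ) p) :=
  RatFunc.coe_coe p

theorem ofPowerSeries_mem_genField {y : ℝ⟦X⟧} (hy : y ∈ genAlgebra f) :
    HahnSeries.ofPowerSeries ℤ ℝ y ∈ genField f := by
  induction hy using Algebra.adjoin_induction with
  | mem y hy => obtain ⟨A, rfl⟩ := hy; exact IntermediateField.subset_adjoin _ _ ⟨A, rfl⟩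
  | algebraMap p => rw [ofPowerSeries_polynomial]; exact (genField f).algebraMap_mem _
  | add x y _ _ hx hy => rw [map_add]; exact add_mem hx hy
  | mul x y _ _ hx hy => rw [map_mul]; exact mul_mem hx hy

theorem euler_algebraMap_mem (p : ℝ[X]) : euler (algebraMap ℝ[X] ℝ⟦X⟧ p) ∈ genAlgebra f := by
  have := euler_polynomial p
  change euler (p : ℝ⟦X⟧) ∈ _
  rw [this]
  exact (genAlgebra f).algebraMap_mem _

/-- For a generator Cramer's rule shows that the determinant is the only denominator of its
derivative; the Leibniz rule extends this to the whole algebra. -/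
theorem System.det_mul_euler_mem (h : System ℝ[X] f J) {y : ℝ⟦X⟧} (hy : y ∈ genAlgebra f) :
    (1 - J).det * euler y ∈ genAlgebra f := by
  induction hy using Algebra.adjoin_induction with
  | mem y hy =>
    obtain ⟨A, rfl⟩ := hy
    obtain ⟨b, hb, hb'⟩ := h.derivation euler euler_add euler_mul
    have := det_smul_eq J (fun A => euler (f A)) _ hb A
    rw [smul_eq_mul] at this
    rw [this]
    refine sum_mem fun B _ => mul_mem (adjugate_mem h.one_sub_mem_adjoin _ _) ?_
    rcases hb' B with h0 | ⟨p, h0⟩ <;> rw [h0]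
    · exact zero_mem _
    · exact euler_algebraMap_mem p
  | algebraMap p => exact mul_mem (det_mem h.one_sub_mem_adjoin) (euler_algebraMap_mem p)
  | add x y _ _ hx hy => rw [euler_add, mul_add]; exact add_mem hx hy
  | mul x y hx' hy' hx hy =>
    rw [euler_mul]
    have : (1 - J).det * (x * euler y + y * euler x) =
      x * ((1 - J).det * euler y) + y * ((1 - J).det * euler x) := by ring
    rw [this]
    exact add_mem (mul_mem hx' hy) (mul_mem hy' hx)

/-- The extra factor `d` avoids the exponent `k - 1`, which is truncated at `k = 0`. -/
theorem mul_euler_pow (d : ℝ⟦X⟧) (k : ℕ) : d * euler (d ^ k) = k * d ^ k * euler d := by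
  simp only [euler, Derivation.leibniz_pow, nsmul_eq_mul, smul_eq_mul]
  cases k with
  | zero => simp
  | succ k => simp only [Nat.add_sub_cancel, pow_succ]; ring

/-- Derivatives leave the algebra only through powers of the determinant in the denominator; each
further derivative costs two more of them. -/
theorem System.iterate_mem (h : System ℝ[X] f J) (A : M) (i : ℕ) :
    ∃ k, (1 - J).det ^ k * euler^[i] (f A) ∈ genAlgebra f := by
  induction i with
  | zero =>
    have : f A ∈ genAlgebra f := Algebra.subset_adjoin ⟨A, rfl⟩
    exact ⟨0, by simpa using this⟩
  | succ i ih =>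
    obtain ⟨k, hk⟩ := ih
    refine ⟨k + 2, ?_⟩
    rw [Function.iterate_succ_apply']
    have hdm : (1 - J).det ∈ genAlgebra f := det_mem h.one_sub_mem_adjoin
    have h1 := h.det_mul_euler_mem hk
    have h2 := h.det_mul_euler_mem hdm
    generalize (1 - J).det = d at *
    generalize euler^[i] (f A) = y at *
    -- The Leibniz rule for `d ^ k * y`, solved for `euler y`. In the correction term one factor `d`
    -- turns `euler (d ^ k)` into a multiple of `d ^ k`, the other puts `d * euler d` into the
    -- algebra.
    have e : d ^ (k + 2) * euler y =
        d * (d * euler (d ^ k * y)) - (k : ℝ⟦X⟧) * (d * euler d) * (d ^ k * y) := by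
      rw [euler_mul]
      have : d * (d * (d ^ k * euler y + y * euler (d ^ k))) =
        d ^ (k + 2) * euler y + d * y * (d * euler (d ^ k)) := by ring
      rw [this, mul_euler_pow d k]
      ring
    rw [e]
    exact sub_mem (mul_mem hdm h1) (mul_mem (mul_mem (natCast_mem _ _) h2) hk)

theorem System.ofPowerSeries_iterate_mem (h : System ℝ[X] f J) (hdet : (1 - J).det ≠ 0) (A : M)
    (i : ℕ) : HahnSeries.ofPowerSeries ℤ ℝ (euler^[i] (f A)) ∈ genField f := by
  obtain ⟨k, hk⟩ := h.iterate_mem A i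
  have h1 := ofPowerSeries_mem_genField hk
  have h2 := ofPowerSeries_mem_genField (pow_mem (det_mem h.one_sub_mem_adjoin) k)
  rw [map_mul] at h1
  have h3 : HahnSeries.ofPowerSeries ℤ ℝ ((1 - J).det ^ k) ≠ 0 := by
    intro h0
    exact pow_ne_zero k hdet (HahnSeries.ofPowerSeries_injective (by rw [h0, map_zero]))
  have := div_mem h1 h2
  rwa [mul_div_cancel_left₀ _ h3] at this

/-- Every series of the system satisfies a linear differential equation. -/
theorem System.exists_equation (h : System ℝ[X] f J) (hdet : (1 - J).det ≠ 0) (A : M) :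
    ∃ (d : ℕ) (q : Fin d → ℝ[X]), (∃ i, q i ≠ 0) ∧
      ∑ i, (q i : ℝ⟦X⟧) * euler^[i] (f A) = 0 := by
  have hs : System (RatFunc ℝ) (fun A => HahnSeries.ofPowerSeries ℤ ℝ (f A))
      (J.map (HahnSeries.ofPowerSeries ℤ ℝ)) :=
    h.map _ fun p => ⟨_, ofPowerSeries_polynomial p⟩
  have hdet' : (1 - J.map (HahnSeries.ofPowerSeries ℤ ℝ)).det ≠ 0 := by
    intro h0
    refine hdet (HahnSeries.ofPowerSeries_injective (Γ := ℤ) (R := ℝ) ?_)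
    rw [RingHom.map_det, map_sub, map_one, map_zero]
    exact h0
  have := hs.finiteDimensional hdet'
  -- One more iterate than the dimension of the field forces a linear relation.
  let d := Module.finrank (RatFunc ℝ) (genField f) + 1
  let y : Fin d → genField f := fun i => ⟨_, h.ofPowerSeries_iterate_mem hdet A i⟩
  have h1 : ¬ LinearIndependent (RatFunc ℝ) y := by
    intro hl
    have := hl.fintype_card_le_finrank
    simp [d] at this
  have h2 : ¬ LinearIndependent (RatFunc ℝ) fun i => (y i : ℝ⸨X⸩) := fun hl =>
    h1 (LinearIndependent.of_comp (genField f).val.toLinearMap hl)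
  -- Clearing denominators: dependence over the rational functions is dependence over the
  -- polynomials.
  rw [← LinearIndependent.iff_fractionRing (R := ℝ[X]), Fintype.not_linearIndependent_iff] at h2
  obtain ⟨q, hq, hi⟩ := h2
  refine ⟨d, q, hi, ?_⟩
  apply HahnSeries.ofPowerSeries_injective (Γ := ℤ) (R := ℝ)
  rw [map_sum, map_zero, ← hq]
  refine Finset.sum_congr rfl fun i _ => ?_
  rw [map_mul, Algebra.smul_def]
  rfl

end
end Holonomic

/-! ### Cost calculus -/

namespace Cost

variable {α β ι : Type}

@[simp] theorem pure_val (a : α) : (pure a : Cost α).val = a := rfl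
@[simp] theorem pure_ops (a : α) : (pure a : Cost α).ops = 0 := rfl
@[simp] theorem pure_live (a : α) : (pure a : Cost α).live = 0 := rfl
@[simp] theorem pure_peak (a : α) : (pure a : Cost α).peak = 0 := rfl
@[simp] theorem bind_val (x : Cost α) (f : α → Cost β) : (x >>= f).val = (f x.val).val := rfl
@[simp] theorem bind_ops (x : Cost α) (f : α → Cost β) :
    (x >>= f).ops = x.ops + (f x.val).ops := rfl
@[simp] theorem bind_live (x : Cost α) (f : α → Cost β) :
    (x >>= f).live = x.live + (f x.val).live := rfl
@[simp] theorem bind_peak (x : Cost α) (f : α → Cost β) :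
    (x >>= f).peak = max x.peak (x.live + (f x.val).peak) := rfl
@[simp] theorem add_val (x y : ℝ) : (add x y).val = x + y := rfl
@[simp] theorem sub_val (x y : ℝ) : (sub x y).val = x - y := rfl
@[simp] theorem mul_val (x y : ℝ) : (mul x y).val = x * y := rfl
@[simp] theorem div_val (x y : ℝ) : (div x y).val = x / y := rfl
@[simp] theorem ofIndex_val (m : ℕ) : (ofIndex m).val = m := rfl
@[simp] theorem number_val (x : ℝ) : (number x).val = x := rfl
@[simp] theorem add_ops (x y : ℝ) : (add x y).ops = 1 := rfl
@[simp] theorem sub_ops (x y : ℝ) : (sub x y).ops = 1 := rfl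
@[simp] theorem mul_ops (x y : ℝ) : (mul x y).ops = 1 := rfl
@[simp] theorem div_ops (x y : ℝ) : (div x y).ops = 1 := rfl
@[simp] theorem ofIndex_ops (m : ℕ) : (ofIndex m).ops = 1 := rfl
@[simp] theorem number_ops (x : ℝ) : (number x).ops = 1 := rfl
@[simp] theorem add_live (x y : ℝ) : (add x y).live = 1 := rfl
@[simp] theorem sub_live (x y : ℝ) : (sub x y).live = 1 := rfl
@[simp] theorem mul_live (x y : ℝ) : (mul x y).live = 1 := rfl
@[simp] theorem div_live (x y : ℝ) : (div x y).live = 1 := rfl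
@[simp] theorem number_live (x : ℝ) : (number x).live = 1 := rfl
@[simp] theorem add_peak (x y : ℝ) : (add x y).peak = 1 := rfl
@[simp] theorem sub_peak (x y : ℝ) : (sub x y).peak = 1 := rfl
@[simp] theorem mul_peak (x y : ℝ) : (mul x y).peak = 1 := rfl
@[simp] theorem div_peak (x y : ℝ) : (div x y).peak = 1 := rfl
@[simp] theorem number_peak (x : ℝ) : (number x).peak = 1 := rfl
@[simp] theorem lt_ops (x y : ℝ) : (lt x y).ops = 1 := rfl
@[simp] theorem lt_live (x y : ℝ) : (lt x y).live = 0 := rfl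
@[simp] theorem lt_peak (x y : ℝ) : (lt x y).peak = 0 := rfl
@[simp] theorem lt_val (x y : ℝ) : (lt x y).val = true ↔ x < y := by simp [lt]
@[simp] theorem scope_val (s : ℕ) (x : Cost α) : (scope s x).val = x.val := rfl
@[simp] theorem scope_ops (s : ℕ) (x : Cost α) : (scope s x).ops = x.ops := rfl
@[simp] theorem scope_live (s : ℕ) (x : Cost α) : (scope s x).live = s := rfl
@[simp] theorem scope_peak (s : ℕ) (x : Cost α) : (scope s x).peak = max x.peak s := rfl

/-- The computation keeps or needs at most one number for every operation. -/
def Tame (x : Cost α) : Prop := x.live ≤ x.ops ∧ x.peak ≤ x.ops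

theorem tame_pure (a : α) : Tame (pure a) := ⟨le_rfl, le_rfl⟩
theorem tame_add (x y : ℝ) : Tame (add x y) := ⟨le_rfl, le_rfl⟩
theorem tame_sub (x y : ℝ) : Tame (sub x y) := ⟨le_rfl, le_rfl⟩
theorem tame_mul (x y : ℝ) : Tame (mul x y) := ⟨le_rfl, le_rfl⟩
theorem tame_div (x y : ℝ) : Tame (div x y) := ⟨le_rfl, le_rfl⟩
theorem tame_ofIndex (m : ℕ) : Tame (ofIndex m) := ⟨le_rfl, le_rfl⟩
theorem tame_lt (x y : ℝ) : Tame (lt x y) := ⟨zero_le_one, zero_le_one⟩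

theorem Tame.bind {x : Cost α} {f : α → Cost β} (hx : x.Tame) (hf : (f x.val).Tame) :
    (x >>= f).Tame := by
  obtain ⟨h1, h2⟩ := hx
  obtain ⟨h3, h4⟩ := hf
  refine ⟨?_, ?_⟩ <;> simp only [bind_live, bind_ops, bind_peak]
  · omega
  · omega

end Cost

/-! ### Recurrences -/

namespace Recurrence

theorem tame_evalPoly (x : ℝ) (p : List ℝ) : (evalPoly x p).Tame := by
  induction p with
  | nil => exact Cost.tame_pure _
  | cons c p ih => exact ih.bind ((Cost.tame_mul _ _).bind (Cost.tame_add _ _))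

theorem ops_evalPoly (x : ℝ) (p : List ℝ) : (evalPoly x p).ops = 2 * p.length := by
  induction p with
  | nil => rfl
  | cons c p ih => simp [evalPoly, ih]; ring

theorem tame_combine (x : ℝ) (ps : List (List ℝ)) (as : List ℝ) : (combine x ps as).Tame := by
  induction ps generalizing as with
  | nil => exact Cost.tame_pure _
  | cons p ps ih =>
    cases as with
    | nil => exact Cost.tame_pure _
    | cons a as =>
      exact (tame_evalPoly _ _).bind ((Cost.tame_mul _ _).bind ((ih as).bind (Cost.tame_add _ _)))

theorem ops_combine_le (x : ℝ) (ps : List (List ℝ)) (as : List ℝ) :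
    (combine x ps as).ops ≤ (ps.map fun p => 2 * p.length + 2).sum := by
  induction ps generalizing as with
  | nil => exact Nat.zero_le _
  | cons p ps ih =>
    cases as with
    | nil => exact Nat.zero_le _
    | cons a as =>
      have := ih as
      simp only [combine, Cost.bind_ops, ops_evalPoly, Cost.mul_ops, Cost.add_ops, List.map_cons,
        List.sum_cons]
      omega

/-- A bound for the number of operations that give one value. -/
def entryCost (D : Recurrence) : ℕ :=
  (D.coeff.map fun p => 2 * p.length + 2).sum + 2 * D.lead.length + 2

theorem tame_entry (D : Recurrence) (m : ℕ) (prev : List ℝ) : (D.entry m prev).Tame := by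
  unfold entry
  split_ifs
  · exact Cost.tame_pure _
  · exact (Cost.tame_ofIndex _).bind ((tame_combine _ _ _).bind
      ((tame_evalPoly _ _).bind (Cost.tame_div _ _)))

theorem ops_entry_le (D : Recurrence) (m : ℕ) (prev : List ℝ) :
    (D.entry m prev).ops ≤ D.entryCost := by
  unfold entry
  split_ifs
  · exact Nat.zero_le _
  · have := ops_combine_le (m : ℝ) D.coeff prev
    simp only [Cost.bind_ops, Cost.ofIndex_ops, Cost.ofIndex_val, ops_evalPoly, Cost.div_ops,
      entryCost]
    omega

theorem ops_fill_le (D : Recurrence) (m : ℕ) : (D.fill m).ops ≤ m * D.entryCost := by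
  induction m with
  | zero => exact Nat.zero_le _
  | succ m ih =>
    have := ops_entry_le D m (D.fill m).val
    simp only [fill, Cost.bind_ops, Cost.scope_ops, Cost.pure_ops, Nat.succ_mul]
    omega

theorem live_fill (D : Recurrence) (m : ℕ) : (D.fill m).live = m := by
  induction m with
  | zero => rfl
  | succ m ih => simp [fill, ih]

/-- Every entry is computed in a scope that retains one number, so the intermediate results of
different entries do not accumulate. -/
theorem peak_fill_le (D : Recurrence) (m : ℕ) : (D.fill m).peak ≤ m + D.entryCost := by
  induction m with
  | zero => exact Nat.zero_le _
  | succ m ih =>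
    have := ops_entry_le D m (D.fill m).val
    have := (tame_entry D m (D.fill m).val).2
    have : 1 ≤ D.entryCost := by unfold entryCost; omega
    simp only [fill, Cost.bind_peak, Cost.scope_peak, Cost.pure_peak, live_fill, Cost.scope_live]
    omega

/-- The recurrence computes the sequence `a`. -/
def Computes (D : Recurrence) (a : ℕ → ℝ) : Prop :=
  ∀ m, (D.fill m).val = ((List.range m).map a).reverse

theorem exists_evalPoly (p : Polynomial ℝ) : ∃ l, ∀ x, (evalPoly x l).val = p.eval x := by
  have : ∀ n (p : Polynomial ℝ), p.natDegree < n → ∃ l, ∀ x, (evalPoly x l).val = p.eval x := by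
    intro n
    induction n with
    | zero => intro p hp; omega
    | succ n ih =>
      intro p hp
      by_cases h0 : p.natDegree = 0
      · refine ⟨[p.coeff 0], fun x => ?_⟩
        rw [Polynomial.eq_C_of_natDegree_eq_zero h0]
        simp [evalPoly]
      · obtain ⟨l, hl⟩ := ih p.divX (by rw [Polynomial.natDegree_divX_eq_natDegree_tsub_one]; omega)
        refine ⟨p.coeff 0 :: l, fun x => ?_⟩
        conv_rhs => rw [← Polynomial.divX_mul_X_add p]
        simp [evalPoly, hl, add_comm]
  exact this _ p (Nat.lt_succ_self _)

theorem val_combine (x : ℝ) (c : ℕ → List ℝ) (B m : ℕ) (a : ℕ → ℝ) :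
    (combine x ((List.range B).map c) ((List.range m).map a)).val =
      ∑ t ∈ Finset.range (min B m), (evalPoly x (c t)).val * a t := by
  induction B generalizing m c a with
  | zero => simp [combine]
  | succ B ih =>
    cases m with
    | zero => simp [List.range_succ_eq_map, combine]
    | succ m =>
      rw [List.range_succ_eq_map, List.range_succ_eq_map, List.map_cons, List.map_cons,
        List.map_map, List.map_map, Nat.succ_min_succ, Finset.sum_range_succ']
      simp only [combine, Cost.bind_val, Cost.mul_val, Cost.add_val]
      rw [ih (c ∘ Nat.succ) m (a ∘ Nat.succ), add_comm]
      rfl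

theorem reverse_map_range (m : ℕ) (a : ℕ → ℝ) :
    ((List.range m).map a).reverse = (List.range m).map fun t => a (m - 1 - t) := by
  apply List.ext_getElem
  · simp
  · intro i h1 h2
    simp

/-- The nonzero polynomial `Q 0` has finitely many natural roots. The values up to the last of them
become initial values, and afterwards the division by `Q 0` is legitimate. Since only `Q 0, …, Q B`
matter, finitely many constants suffice for all `m`. -/
theorem exists_computes_of_relation (a : ℕ → ℝ) (Q : ℕ → Polynomial ℝ) (B : ℕ) (h0 : Q 0 ≠ 0)
    (hB : ∀ t, B < t → Q t = 0)
    (h : ∀ m : ℕ, ∑ t ∈ Finset.range (m + 1), (Q t).eval (m : ℝ) * a (m - t) = 0) :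
    ∃ D : Recurrence, D.Computes a := by
  choose l hl using exists_evalPoly
  obtain ⟨s, hs⟩ : ∃ s : ℕ, ∀ m : ℕ, s ≤ m → (Q 0).eval (m : ℝ) ≠ 0 := by
    have hfin : {m : ℕ | (Q 0).eval (m : ℝ) = 0}.Finite := by
      have : {m : ℕ | (Q 0).eval (m : ℝ) = 0} ⊆ (fun m : ℕ => (m : ℝ)) ⁻¹' (Q 0).rootSet ℝ := by
        intro m hm
        simp only [Set.mem_preimage, Polynomial.mem_rootSet, Polynomial.coe_aeval_eq_eval]
        exact ⟨h0, hm⟩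
      exact ((Polynomial.rootSet_finite _ _).preimage Nat.cast_injective.injOn).subset this
    obtain ⟨s, hs⟩ := hfin.bddAbove
    exact ⟨s + 1, fun m hm h => by have := hs h; omega⟩
  refine ⟨⟨(List.range s).map a, l (Q 0), (List.range B).map fun t => l (-Q (t + 1))⟩, fun m => ?_⟩
  induction m with
  | zero => rfl
  | succ m ih =>
    rw [fill, Cost.bind_val, ih, Cost.bind_val, Cost.pure_val, Cost.scope_val, List.range_succ,
      List.map_append, List.reverse_append]
    suffices hs : (entry ⟨(List.range s).map a, l (Q 0), (List.range B).map fun t => l (-Q (t + 1))⟩ m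
        ((List.range m).map a).reverse).val = a m by rw [hs]; rfl
    unfold entry
    split_ifs with hm
    · simp only [List.length_map, List.length_range] at hm
      simp [hm]
    · simp only [List.length_map, List.length_range, not_lt] at hm
      simp only [Cost.bind_val, Cost.ofIndex_val, Cost.div_val, reverse_map_range, hl]
      rw [val_combine, div_eq_iff (hs m hm)]
      simp only [hl, Polynomial.eval_neg]
      have h1 := h m
      rw [Finset.sum_range_succ'] at h1
      -- If the history is longer than the list of coefficients, the missing terms have coefficient
      -- zero.
      have h2 : ∑ t ∈ Finset.range (min B m), -(Q (t + 1)).eval (m : ℝ) * a (m - 1 - t) =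
          ∑ t ∈ Finset.range m, -(Q (t + 1)).eval (m : ℝ) * a (m - 1 - t) := by
        refine Finset.sum_subset (Finset.range_mono (min_le_right _ _)) fun t ht ht' => ?_
        simp only [Finset.mem_range] at ht ht'
        rw [hB (t + 1) (by omega)]
        simp
      rw [h2]
      simp only [neg_mul, Finset.sum_neg_distrib]
      rw [neg_eq_iff_add_eq_zero, ← h1]
      simp only [Nat.sub_zero, mul_comm]
      congr 1
      refine Finset.sum_congr rfl fun t _ => ?_
      rw [show m - (t + 1) = m - 1 - t by omega]

-- The coefficient of `z ^ m` in the equation is the sum over `j` of `R j (m - j)` times the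
-- coefficient of `f` at `m - j`, where `R j` gathers the coefficients of `z ^ j` in all `q i`. The
-- first nonzero `R j` takes the role of the leading polynomial.
open Holonomic in
theorem exists_computes_of_equation (f : PowerSeries ℝ) (d : ℕ) (q : Fin d → Polynomial ℝ)
    (hq : ∃ i, q i ≠ 0) (h : ∑ i, (q i : PowerSeries ℝ) * euler^[i] f = 0) :
    ∃ D : Recurrence, D.Computes fun m => PowerSeries.coeff m f := by
  classical
  let R : ℕ → Polynomial ℝ := fun j => ∑ i : Fin d, Polynomial.monomial i ((q i).coeff j)
  have hR : ∀ j (x : ℝ), (R j).eval x = ∑ i : Fin d, (q i).coeff j * x ^ (i : ℕ) := by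
    intro j x
    simp [R, Polynomial.eval_finsetSum, Polynomial.eval_monomial]
  have hR0 : ∀ j, R j = 0 → ∀ i, (q i).coeff j = 0 := by
    intro j hj i
    have : (R j).coeff i = 0 := by rw [hj, Polynomial.coeff_zero]
    simpa [R, Polynomial.finsetSum_coeff, Polynomial.coeff_monomial, Fin.val_inj] using this
  have hrel : ∀ m, ∑ j ∈ Finset.range (m + 1), (R j).eval ((m - j : ℕ) : ℝ) * PowerSeries.coeff (m - j) f = 0 := by
    intro m
    have h1 := congrArg (PowerSeries.coeff m) h
    rw [map_sum, map_zero] at h1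
    simp only [PowerSeries.coeff_mul, coeff_euler_iterate, Polynomial.coeff_coe] at h1
    rw [Finset.sum_comm, Finset.Nat.sum_antidiagonal_eq_sum_range_succ_mk] at h1
    rw [← h1]
    refine Finset.sum_congr rfl fun j _ => ?_
    rw [hR, Finset.sum_mul]
    exact Finset.sum_congr rfl fun i _ => by ring
  have hex : ∃ j, R j ≠ 0 := by
    obtain ⟨i, hi⟩ := hq
    by_contra! hall
    exact hi (Polynomial.ext fun j => by simpa using hR0 j (hall j) i)
  have hbd : ∀ j, (Finset.univ.sup fun i : Fin d => (q i).natDegree) < j → R j = 0 := by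
    intro j hj
    refine Finset.sum_eq_zero fun i _ => ?_
    rw [Polynomial.coeff_eq_zero_of_natDegree_lt, map_zero]
    exact lt_of_le_of_lt (Finset.le_sup (f := fun i => (q i).natDegree) (Finset.mem_univ i)) hj
  -- With `j₀ = Nat.find hex`, the coefficient of index `j₀ + m` is used. Substituting `X - t`
  -- rewrites `R (j₀ + t)` at `m - t` as a polynomial in `m`.
  refine exists_computes_of_relation _
    (fun t => (R (Nat.find hex + t)).comp (Polynomial.X - Polynomial.C (t : ℝ)))
    (Finset.univ.sup fun i : Fin d => (q i).natDegree) ?_ ?_ ?_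
  · simpa using Nat.find_spec hex
  · intro t ht
    rw [hbd _ (by omega), Polynomial.zero_comp]
  · intro m
    have h1 := hrel (Nat.find hex + m)
    rw [add_assoc, Finset.sum_range_add, Finset.sum_eq_zero, zero_add] at h1
    · rw [← h1]
      refine Finset.sum_congr rfl fun t ht => ?_
      have ht' : t ≤ m := by simpa [Nat.lt_succ_iff] using ht
      rw [show Nat.find hex + m - (Nat.find hex + t) = m - t by omega, Nat.cast_sub ht']
      simp
    · intro j hj
      have := Nat.find_min hex (Finset.mem_range.1 hj)
      rw [not_not] at this
      rw [this]
      simp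

end Recurrence

/-! ### The generating functions of the grammar and the cost of their tables -/

namespace WeightedGrammar

variable {T N : Type} [Fintype T] [Fintype N] {G : WeightedGrammar T N}

open PowerSeries in
/-- The generating function of the weights of the words of a non-terminal. -/
def genFun (G : WeightedGrammar T N) (A : {A // Good G A}) : PowerSeries ℝ :=
  PowerSeries.mk (total G A.1)

open Classical in
/-- The Jacobian matrix of the system of the generating functions. -/
def jacobian (G : WeightedGrammar T N) : Matrix {A // Good G A} {A // Good G A} (PowerSeries ℝ) :=
  fun A E => match G.rule A.1 with
    | .prod B C => (if E.1 = B then PowerSeries.mk (total G C) else 0) +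
        (if E.1 = C then PowerSeries.mk (total G B) else 0)
    | .union B C => (if E.1 = B then 1 else 0) + (if E.1 = C then 1 else 0)
    | .term _ => 0
    | .eps => 0

-- The index set is closed under the rules by `Good.prod` and `Good.union`. Ambiguous non-terminals
-- have to be left out, because their weights need not satisfy the equations.
open Classical PowerSeries Holonomic in
theorem system_genFun (hG : G.IsBCNF) : System (Polynomial ℝ) (genFun G) (jacobian G) := by
  rintro ⟨A, hA⟩
  rcases hr : G.rule A with ⟨B, C⟩ | ⟨B, C⟩ | t | _
  · obtain ⟨hB, hC⟩ := hA.prod hG hr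
    refine .inl ⟨⟨B, hB⟩, ⟨C, hC⟩, ?_, fun E => by simp [jacobian, hr, genFun, Subtype.ext_iff]⟩
    ext m
    rw [coeff_mul, genFun, coeff_mk, hA.total_prod hr]
    simp [genFun]
  · obtain ⟨hB, hC⟩ := hA.union hr
    refine .inr (.inl ⟨⟨B, hB⟩, ⟨C, hC⟩, ?_, fun E => by simp [jacobian, hr, Subtype.ext_iff]⟩)
    ext m
    simp [genFun, hA.total_union hG hr]
  · refine .inr (.inr ⟨Polynomial.monomial 1 (G.weight t), ?_, fun E => by simp [jacobian, hr]⟩)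
    ext m
    change _ = coeff m ((Polynomial.monomial 1 (G.weight t) : Polynomial ℝ) : PowerSeries ℝ)
    rw [Polynomial.coeff_coe, Polynomial.coeff_monomial, genFun, coeff_mk, total_term hr]
    simp [eq_comm]
  · refine .inr (.inr ⟨1, ?_, fun E => by simp [jacobian, hr]⟩)
    ext m
    rw [map_one, genFun, coeff_mk, total_eps hr, coeff_one]

/-- An entry survives at `z = 0` only at a union, or at a product whose other factor generates the
empty word; both are instances of `Succ`. -/
theorem rk_lt_of_jacobian (hG : G.IsBCNF) (A E : {A // Good G A})
    (h : PowerSeries.constantCoeff (jacobian G A E) ≠ 0) : rk G E.1 < rk G A.1 := by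
  have h0 : ∀ B, total G B 0 ≠ 0 → [] ∈ G.lang B := by
    intro B hB
    obtain ⟨w, hw, hl⟩ := total_pos_iff.1 (lt_of_le_of_ne (total_nonneg G B 0) hB.symm)
    rw [List.length_eq_zero_iff] at hl
    exact hl ▸ hw
  refine Succ.rk_lt hG ?_ A.2
  rcases hr : G.rule A.1 with ⟨B, C⟩ | ⟨B, C⟩ | t | _ <;>
    simp only [jacobian, hr, map_add, apply_ite PowerSeries.constantCoeff, map_zero, map_one] at h
  · by_cases h1 : E.1 = B ∧ total G C 0 ≠ 0
    · exact ⟨C, .inr (.inr (.inl ⟨by rw [hr, h1.1], h0 _ h1.2⟩))⟩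
    · by_cases h2 : E.1 = C ∧ total G B 0 ≠ 0
      · exact ⟨B, .inr (.inr (.inr ⟨by rw [hr, h2.1], h0 _ h2.2⟩))⟩
      · exfalso
        apply h
        simp only [PowerSeries.constantCoeff_mk]
        split_ifs <;> simp_all
  · by_cases h1 : E.1 = B
    · exact ⟨C, .inl (by rw [hr, h1])⟩
    · by_cases h2 : E.1 = C
      · exact ⟨B, .inr (.inl (by rw [hr, h2]))⟩
      · simp [h1, h2] at h
  · simp at h
  · simp at h

theorem exists_recurrences (hG : G.IsBCNF) :
    ∃ D : N → Recurrence, ∀ A, Good G A → (D A).Computes (total G A) := by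
  classical
  have : ∀ A, ∃ D : Recurrence, Good G A → D.Computes (total G A) := by
    intro A
    by_cases hA : Good G A
    · have hs := system_genFun hG
      have hdet := Holonomic.det_one_sub_ne_zero (jacobian G) (fun A => rk G A.1)
        (rk_lt_of_jacobian hG)
      obtain ⟨d, q, hq, he⟩ := hs.exists_equation hdet ⟨A, hA⟩
      obtain ⟨D, hD⟩ := Recurrence.exists_computes_of_equation _ d q hq he
      refine ⟨D, fun _ => ?_⟩
      simpa [genFun] using hD
    -- Nothing is claimed about the other non-terminals, so the empty recurrence will do.
    · exact ⟨⟨[], [], []⟩, fun h => absurd h hA⟩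
  choose D hD using this
  exact ⟨D, hD⟩

theorem val_precompute {D : N → Recurrence} {A : N} (h : (D A).Computes (total G A)) {n m : ℕ}
    (hm : m ≤ n) : ((precompute D n).val A).getD m 0 = total G A m := by
  change ((D A).fill (n + 1)).val.reverse.getD m 0 = _
  rw [h, List.reverse_reverse]
  simp [List.getD_eq_getElem?_getD, Nat.lt_succ_of_le hm]

theorem ops_precompute_le (D : N → Recurrence) (n : ℕ) :
    (precompute D n).ops ≤ (n + 1) * ∑ A, (D A).entryCost := by
  rw [Finset.mul_sum]
  exact Finset.sum_le_sum fun A _ => by simpa using (D A).ops_fill_le (n + 1)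

theorem live_precompute (D : N → Recurrence) (n : ℕ) :
    (precompute D n).live = Fintype.card N * (n + 1) := by
  simp [precompute, Cost.forAll, Recurrence.live_fill]

theorem peak_precompute_le (D : N → Recurrence) (n : ℕ) :
    (precompute D n).peak ≤ Fintype.card N * (n + 1) + ∑ A, (D A).entryCost := by
  have : Fintype.card N * (n + 1) + ∑ A, (D A).entryCost =
      ∑ A : N, ((n + 1) + (D A).entryCost) := by
    simp [Finset.sum_add_distrib]
  rw [this]
  refine Finset.sum_le_sum fun A _ => ?_
  have := (D A).peak_fill_le (n + 1)
  have := (D A).live_fill (n + 1)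
  simp only [Cost.bind_peak, Cost.pure_peak]
  omega

end WeightedGrammar

/-! ### The boustrophedon order -/

theorem length_boustrophedon (m : ℕ) : (boustrophedon m).length = m + 1 := by
  simp [boustrophedon]

theorem mem_boustrophedon {m i : ℕ} : i ∈ boustrophedon m ↔ i ≤ m := by
  simp only [boustrophedon, List.mem_map, List.mem_range]
  constructor
  · rintro ⟨j, hj, rfl⟩
    split_ifs <;> omega
  · intro h
    by_cases h2 : 2 * i ≤ m
    · exact ⟨2 * i, by omega, by rw [if_pos (by omega)]; omega⟩
    · exact ⟨2 * (m - i) + 1, by omega, by rw [if_neg (by omega)]; omega⟩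

theorem nodup_boustrophedon (m : ℕ) : (boustrophedon m).Nodup := by
  refine List.Nodup.map_on ?_ List.nodup_range
  intro i hi j hj h
  rw [List.mem_range] at hi hj
  split_ifs at h <;> omega

/-- The entry `i` stands at position `2 * i` or `2 * (m - i) + 1`, so the smaller part of the split
governs the search. -/
theorem position_boustrophedon {m i : ℕ} {l₁ l₂ : List ℕ}
    (h : boustrophedon m = l₁ ++ i :: l₂) : l₁.length ≤ 2 * min i (m - i) + 1 := by
  have hl := length_boustrophedon m
  rw [h] at hl
  simp only [List.length_append, List.length_cons] at hl
  have h1 : (boustrophedon m)[l₁.length]? = some i := by rw [h]; simp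
  rw [boustrophedon, List.getElem?_map, List.getElem?_range (by omega)] at h1
  simp only [Option.map_some, Option.some.injEq] at h1
  split_ifs at h1 <;> omega

/-! ### Investigation of the decompositions -/

theorem tame_findSplit (b c : ℕ → ℝ) (m : ℕ) (l : List ℕ) (r L : ℝ) :
    (findSplit b c m l r L).Tame := by
  induction l generalizing r L with
  | nil => exact Cost.tame_pure _
  | cons i l ih =>
    refine (Cost.tame_mul _ _).bind ((Cost.tame_lt _ _).bind ?_)
    split_ifs
    · exact Cost.tame_pure _
    · exact (Cost.tame_sub _ _).bind ((Cost.tame_add _ _).bind (ih _ _))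

theorem ops_findSplit_le (b c : ℕ → ℝ) (m : ℕ) (l : List ℕ) (r L : ℝ) :
    (findSplit b c m l r L).ops ≤ 4 * l.length := by
  induction l generalizing r L with
  | nil => exact Nat.zero_le _
  | cons i l ih =>
    have h := ih (r - b i * c (m - i)) (L + b i * c (m - i))
    simp only [findSplit, Cost.bind_ops, Cost.mul_ops, Cost.lt_ops, Cost.mul_val, List.length_cons]
    split_ifs
    · simp only [Cost.pure_ops]; omega
    · simp only [Cost.bind_ops, Cost.sub_ops, Cost.add_ops, Cost.sub_val, Cost.add_val]; omega

theorem findSplit_index_le (b c : ℕ → ℝ) (m : ℕ) (l : List ℕ) (r L : ℝ) (h : ∀ i ∈ l, i ≤ m) :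
    (findSplit b c m l r L).val.1 ≤ m := by
  induction l generalizing r L with
  | nil => exact Nat.zero_le _
  | cons i l ih =>
    simp only [findSplit, Cost.bind_val]
    split_ifs
    · exact h i (by simp)
    · exact ih _ _ fun j hj => h j (by simp [hj])

/-- A skipped split costs four operations, the successful one two. Nonnegativity of the skipped
products keeps a test from succeeding too early. -/
theorem findSplit_spec (b c : ℕ → ℝ) (m i : ℕ) (l₁ l₂ : List ℕ) (r L : ℝ)
    (hp : ∀ j ∈ l₁, 0 ≤ b j * c (m - j))
    (h1 : (l₁.map fun j => b j * c (m - j)).sum ≤ r)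
    (h2 : r < (l₁.map fun j => b j * c (m - j)).sum + b i * c (m - i)) :
    (findSplit b c m (l₁ ++ i :: l₂) r L).val =
        (i, r - (l₁.map fun j => b j * c (m - j)).sum, L + (l₁.map fun j => b j * c (m - j)).sum) ∧
      (findSplit b c m (l₁ ++ i :: l₂) r L).ops ≤ 4 * l₁.length + 2 := by
  induction l₁ generalizing r L with
  | nil =>
    simp only [List.map_nil, List.sum_nil, zero_add] at h1 h2
    have : (Cost.lt r (b i * c (m - i))).val = true := by simpa using h2
    simp [findSplit, this]
  | cons j l ih =>
    simp only [List.map_cons, List.sum_cons] at h1 h2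
    have hs : 0 ≤ (l.map fun j => b j * c (m - j)).sum :=
      List.sum_nonneg (by simpa using fun j hj => hp j (by simp [hj]))
    have : (Cost.lt r (b j * c (m - j))).val = false := by
      rw [Bool.eq_false_iff, ne_eq, Cost.lt_val]
      linarith
    have h3 := ih (r - b j * c (m - j)) (L + b j * c (m - j))
      (fun j hj => hp j (by simp [hj])) (by linarith) (by linarith)
    simp only [List.cons_append, findSplit, Cost.bind_val, Cost.bind_ops, Cost.mul_val,
      this, Cost.sub_val, Cost.add_val, Cost.mul_ops, Cost.lt_ops, Cost.sub_ops, Cost.add_ops,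
      Bool.false_eq_true, if_false, h3.1, List.map_cons, List.sum_cons, List.length_cons]
    refine ⟨?_, ?_⟩
    · rw [sub_sub, add_assoc]
    · have := h3.2
      omega

/-- Applied twice, this recovers first the split and then the left factor of an enumerated word. -/
theorem flatMap_eq_append_cons {α β : Type*} {l : List α} {g : α → List β} {a b : List β} {w : β}
    (h : l.flatMap g = a ++ w :: b) :
    ∃ l₁ i l₂ a' b', l = l₁ ++ i :: l₂ ∧ g i = a' ++ w :: b' ∧ a = l₁.flatMap g ++ a' := by
  induction l generalizing a with
  | nil => simp at h
  | cons x l ih =>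
    rw [List.flatMap_cons, List.append_eq_append_iff] at h
    rcases h with ⟨a', rfl, h⟩ | ⟨c', h, h'⟩
    · obtain ⟨l₁, i, l₂, a'', b', rfl, h1, rfl⟩ := ih h
      exact ⟨x :: l₁, i, l₂, a'', b', rfl, h1, by simp⟩
    · cases c' with
      | nil =>
        rw [List.nil_append] at h'
        rw [List.append_nil] at h
        obtain ⟨l₁, i, l₂, a'', b', rfl, h1, h2⟩ := ih (a := []) (by simpa using h'.symm)
        exact ⟨x :: l₁, i, l₂, a'', b', rfl, h1, by rw [List.flatMap_cons, List.append_assoc, ← h2,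
          h, List.append_nil]⟩
      | cons y c' =>
        simp only [List.cons_append, List.cons.injEq] at h'
        obtain ⟨rfl, -⟩ := h'
        exact ⟨[], x, l, a, c', rfl, h, by simp⟩

namespace WeightedGrammar

variable {T N : Type} [Fintype T] [Fintype N] {G : WeightedGrammar T N}

/-! ### Correctness of unranking -/

/-- The total weight of a list of words. -/
def wsum (G : WeightedGrammar T N) (l : List (List T)) : ℝ := (l.map G.wordWeight).sum

@[simp] theorem wsum_nil : wsum G [] = 0 := rfl

@[simp] theorem wsum_cons (w : List T) (l : List (List T)) :
    wsum G (w :: l) = G.wordWeight w + wsum G l := by simp [wsum]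

@[simp] theorem wsum_append (l l' : List (List T)) : wsum G (l ++ l') = wsum G l + wsum G l' := by
  simp [wsum]

theorem wsum_nonneg (l : List (List T)) : 0 ≤ wsum G l :=
  List.sum_nonneg (by simpa using fun w _ => (wordWeight_pos G w).le)

theorem wsum_map_append (u : List T) (l : List (List T)) :
    wsum G (l.map (u ++ ·)) = G.wordWeight u * wsum G l := by
  induction l with
  | nil => simp
  | cons v l ih => simp [ih, wordWeight_append, mul_add]

theorem wsum_flatMap {ι : Type} (l : List ι) (g : ι → List (List T)) :
    wsum G (l.flatMap g) = (l.map fun i => wsum G (g i)).sum := by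
  induction l with
  | nil => rfl
  | cons x l ih => simp [ih]

theorem wsum_products (l l' : List (List T)) :
    wsum G (l.flatMap fun u => l'.map (u ++ ·)) = wsum G l * wsum G l' := by
  induction l with
  | nil => simp
  | cons u l ih => simp [wsum_map_append, ih, add_mul]

/-- The list enumerates the words of length `m` generated from `A`. -/
def Lists (G : WeightedGrammar T N) (A : N) (m : ℕ) (l : List (List T)) : Prop :=
  l.Nodup ∧ ∀ w, w ∈ l ↔ w ∈ wordsOf G A m

theorem lists_toList (A : N) (m : ℕ) : Lists G A m (wordsOf G A m).toList :=
  ⟨Finset.nodup_toList _, fun _ => Finset.mem_toList⟩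

theorem Lists.wsum {A : N} {m : ℕ} {l : List (List T)} (h : Lists G A m l) :
    wsum G l = total G A m := by
  classical
  rw [total, WeightedGrammar.wsum, ← List.sum_toFinset _ h.1]
  refine Finset.sum_congr ?_ fun _ _ => rfl
  ext w
  rw [List.mem_toFinset, h.2]

/-- The procedure `f` finds the word of the list to which a rank belongs, and its interval, with at
most `c` operations. -/
def Locates (G : WeightedGrammar T N) (f : ℝ → Cost (List T × ℝ × ℝ)) (l : List (List T)) (c : ℝ) :
    Prop :=
  ∀ a w b, l = a ++ w :: b → ∀ r, wsum G a ≤ r → r < wsum G a + G.wordWeight w →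
    (f r).val = (w, wsum G a, wsum G a + G.wordWeight w) ∧ ((f r).ops : ℝ) ≤ c

theorem Locates.mono {f : ℝ → Cost (List T × ℝ × ℝ)} {l : List (List T)} {c c' : ℝ}
    (h : Locates G f l c) (hc : c ≤ c') : Locates G f l c' := fun a w b he r h1 h2 =>
  ⟨(h a w b he r h1 h2).1, (h a w b he r h1 h2).2.trans hc⟩

/-- The rank `r` belongs to one of the words. -/
theorem exists_locate {l : List (List T)} {r : ℝ} (h0 : 0 ≤ r) (h : r < wsum G l) :
    ∃ a w b, l = a ++ w :: b ∧ wsum G a ≤ r ∧ r < wsum G a + G.wordWeight w := by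
  induction l generalizing r with
  | nil => simp at h; linarith
  | cons w l ih =>
    by_cases hw : r < G.wordWeight w
    · exact ⟨[], w, l, rfl, by simpa, by simpa⟩
    · rw [wsum_cons] at h
      obtain ⟨a, v, b, rfl, h1, h2⟩ := ih (r := r - G.wordWeight w) (by linarith) (by linarith)
      exact ⟨w :: a, v, b, rfl, by rw [wsum_cons]; linarith, by rw [wsum_cons]; linarith⟩

theorem Lists.union (hG : G.IsBCNF) {A B C : N} (hA : Good G A) (hr : G.rule A = .union B C)
    {m : ℕ} {l l' : List (List T)} (h : Lists G B m l) (h' : Lists G C m l') :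
    Lists G A m (l ++ l') := by
  refine ⟨List.nodup_append'.2 ⟨h.1, h'.1, ?_⟩, fun w => ?_⟩
  · intro w hw hw'
    rw [h.2, mem_wordsOf] at hw
    rw [h'.2, mem_wordsOf] at hw'
    exact hA.disjoint hG hr hw.1 hw'.1
  · rw [List.mem_append, h.2, h'.2]
    simp only [mem_wordsOf, lang_union hr, Set.mem_union]
    tauto

/-- The order is dictated by the algorithm: by split, then by left factor, then by right factor.
Unique factorisation excludes repetitions. -/
theorem Lists.prod {A B C : N} (hA : Good G A) (hr : G.rule A = .prod B C)
    {m : ℕ} {lB lC : ℕ → List (List T)} (hB : ∀ i ≤ m, Lists G B i (lB i))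
    (hC : ∀ i ≤ m, Lists G C (m - i) (lC i)) :
    Lists G A m ((boustrophedon m).flatMap fun i => (lB i).flatMap fun u => (lC i).map (u ++ ·)) := by
  have key : ∀ {i u v}, i ≤ m → u ∈ lB i → v ∈ lC i →
      u ∈ G.lang B ∧ u.length = i ∧ v ∈ G.lang C ∧ v.length = m - i := by
    intro i u v hi hu hv
    rw [(hB i hi).2, mem_wordsOf] at hu
    rw [(hC i hi).2, mem_wordsOf] at hv
    exact ⟨hu.1, hu.2, hv.1, hv.2⟩
  refine ⟨List.nodup_flatMap.2 ⟨fun i hi => ?_, ?_⟩, fun w => ?_⟩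
  · rw [mem_boustrophedon] at hi
    refine List.nodup_flatMap.2 ⟨fun u _ => (hC i hi).1.map (List.append_right_injective u), ?_⟩
    refine (hB i hi).1.imp_of_mem ?_
    intro u u' hu hu' hne w hw hw'
    obtain ⟨v, hv, rfl⟩ := List.mem_map.1 hw
    obtain ⟨v', hv', he⟩ := List.mem_map.1 hw'
    have k := key hi hu hv
    have k' := key hi hu' hv'
    exact hne (hA.factor hr k.1 k'.1 k.2.2.1 k'.2.2.1 he.symm).1
  · refine (nodup_boustrophedon m).imp_of_mem ?_
    intro i i' hi hi' hne w hw hw'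
    rw [mem_boustrophedon] at hi hi'
    obtain ⟨u, hu, hw⟩ := List.mem_flatMap.1 hw
    obtain ⟨u', hu', hw'⟩ := List.mem_flatMap.1 hw'
    obtain ⟨v, hv, rfl⟩ := List.mem_map.1 hw
    obtain ⟨v', hv', he⟩ := List.mem_map.1 hw'
    have k := key hi hu hv
    have k' := key hi' hu' hv'
    have := (hA.factor hr k.1 k'.1 k.2.2.1 k'.2.2.1 he.symm).1
    exact hne (by rw [← k.2.1, ← k'.2.1, this])
  · simp only [List.mem_flatMap, List.mem_map, mem_boustrophedon, mem_wordsOf, mem_lang_prod hr]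
    constructor
    · rintro ⟨i, hi, u, hu, v, hv, rfl⟩
      have k := key hi hu hv
      exact ⟨⟨u, k.1, v, k.2.2.1, rfl⟩, by rw [List.length_append]; omega⟩
    · rintro ⟨⟨u, hu, v, hv, rfl⟩, hl⟩
      rw [List.length_append] at hl
      have hi : u.length ≤ m := by omega
      exact ⟨u.length, hi, u, ((hB _ hi).2 u).2 (mem_wordsOf.2 ⟨hu, rfl⟩), v,
        ((hC _ hi).2 v).2 (mem_wordsOf.2 ⟨hv, by omega⟩), rfl⟩

/-! ### Unranking at a single non-terminal -/

section Locate

variable {tbl : N → ℕ → ℝ} {d m : ℕ} {A B C : N}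

theorem locates_term {t : T} (hr : G.rule A = .term t) :
    Locates G (unrank G tbl (d + 1) A m) [[t]] 0 := by
  intro a w b he r _ _
  rw [List.singleton_eq_append_iff] at he
  rcases he with ⟨rfl, he⟩ | ⟨-, he⟩
  · simp only [List.cons.injEq] at he
    obtain ⟨rfl, -⟩ := he
    simp [unrank, hr, wordWeight]
  · simp at he

theorem locates_eps (hr : G.rule A = .eps) :
    Locates G (unrank G tbl (d + 1) A m) [[]] 0 := by
  intro a w b he r _ _
  rw [List.singleton_eq_append_iff] at he
  rcases he with ⟨rfl, he⟩ | ⟨-, he⟩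
  · simp only [List.cons.injEq] at he
    obtain ⟨rfl, -⟩ := he
    simp [unrank, hr, wordWeight]
  · simp at he

theorem locates_union (hr : G.rule A = .union B C) {l l' : List (List T)} {c c' : ℝ}
    (hB : Locates G (unrank G tbl d B m) l c) (hC : Locates G (unrank G tbl d C m) l' c')
    (htbl : tbl B m = wsum G l) :
    Locates G (unrank G tbl (d + 1) A m) (l ++ l') (4 + max c c') := by
  intro a w b he r h1 h2
  have hm1 := le_max_left c c'
  have hm2 := le_max_right c c'
  have hcase : (∃ b', l = a ++ w :: b') ∨ ∃ a', a = l ++ a' ∧ l' = a' ++ w :: b := by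
    rw [List.append_eq_append_iff] at he
    rcases he with ⟨a', rfl, h⟩ | ⟨c', h, h'⟩
    · exact .inr ⟨a', rfl, h⟩
    · cases c' with
      | nil => exact .inr ⟨[], by simpa using h.symm, by simpa using h'.symm⟩
      | cons y c' =>
        simp only [List.cons_append, List.cons.injEq] at h'
        obtain ⟨rfl, -⟩ := h'
        exact .inl ⟨_, h⟩
  rcases hcase with ⟨b', hl⟩ | ⟨a', rfl, hl⟩
  · obtain ⟨h3, h4⟩ := hB a w b' hl r h1 h2
    have hlt : (Cost.lt r (tbl B m)).val = true := by
      rw [Cost.lt_val, htbl, hl, wsum_append, wsum_cons]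
      have := wsum_nonneg (G := G) b'
      linarith
    refine ⟨?_, ?_⟩
    · simp [unrank, hr, hlt, h3]
    · simp only [unrank, hr, Cost.scope_ops, Cost.bind_ops, Cost.lt_ops, hlt, if_true]
      push_cast
      linarith
  · rw [wsum_append] at h1 h2
    obtain ⟨h3, h4⟩ := hC a' w b hl (r - tbl B m) (by linarith) (by linarith)
    have hlt : (Cost.lt r (tbl B m)).val = false := by
      rw [Bool.eq_false_iff, ne_eq, Cost.lt_val, htbl]
      have := wsum_nonneg (G := G) a'
      linarith
    refine ⟨?_, ?_⟩
    · simp only [unrank, hr, Cost.scope_val, Cost.bind_val, hlt, Cost.sub_val, h3, Cost.add_val,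
        Bool.false_eq_true, if_false, Cost.pure_val, wsum_append, Prod.mk.injEq, true_and]
      rw [htbl]
      constructor <;> ring
    · simp only [unrank, hr, Cost.scope_ops, Cost.bind_ops, Cost.lt_ops, hlt, Cost.sub_val, h3,
        Bool.false_eq_true, if_false, Cost.sub_ops, Cost.add_ops, Cost.pure_ops]
      push_cast
      linarith

/-- Within the split `i`, a left word `u` owns a block of length `π(u) * tbl C (m - i)`. Dividing
the rank by `tbl C (m - i)` thus gives a rank of `u`, and dividing the remainder by `π(u)` a rank of
the right word. The search costs at most `4 * (2 * min + 1) + 2` operations and eleven more follow,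
hence `8 * min + 17`. -/
theorem locates_prod (hr : G.rule A = .prod B C) {lB lC : ℕ → List (List T)} {c : ℝ}
    (hB : ∀ i ≤ m, tbl B i = wsum G (lB i)) (hC : ∀ i ≤ m, tbl C (m - i) = wsum G (lC i))
    (h : ∀ i ≤ m, lB i ≠ [] → lC i ≠ [] → ∃ c₁ c₂, Locates G (unrank G tbl d B i) (lB i) c₁ ∧
      Locates G (unrank G tbl d C (m - i)) (lC i) c₂ ∧ 8 * (min i (m - i) : ℕ) + 17 + c₁ + c₂ ≤ c) :
    Locates G (unrank G tbl (d + 1) A m)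
      ((boustrophedon m).flatMap fun i => (lB i).flatMap fun u => (lC i).map (u ++ ·)) c := by
  intro a w b he r h1 h2
  obtain ⟨l₁, i, l₂, a', b', hl, he', rfl⟩ := flatMap_eq_append_cons he
  obtain ⟨B₁, u, B₂, a'', b'', hBi, he'', rfl⟩ := flatMap_eq_append_cons he'
  obtain ⟨C₁, C', hCi, rfl, he3⟩ := List.map_eq_append_iff.1 he''
  obtain ⟨v, C₂, rfl, rfl, rfl⟩ := List.map_eq_cons_iff.1 he3
  have hle : ∀ j ∈ boustrophedon m, j ≤ m := fun j hj => mem_boustrophedon.1 hj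
  have hi : i ≤ m := hle i (by rw [hl]; simp)
  obtain ⟨c₁, c₂, hloc₁, hloc₂, hc⟩ := h i hi (by rw [hBi]; simp) (by rw [hCi]; simp)
  have hpos := position_boustrophedon hl
  have hu := wordWeight_pos G u
  have hv := wordWeight_pos G v
  have hS : wsum G (l₁.flatMap fun i => (lB i).flatMap fun u => (lC i).map (u ++ ·)) =
      (l₁.map fun j => tbl B j * tbl C (m - j)).sum := by
    rw [wsum_flatMap]
    refine congrArg List.sum (List.map_congr_left fun j hj => ?_)
    have hj' : j ≤ m := hle j (by rw [hl]; simp [hj])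
    rw [wsum_products, hB j hj', hC j hj']
  have hWB : tbl B i = wsum G B₁ + G.wordWeight u + wsum G B₂ := by
    rw [hB i hi, hBi, wsum_append, wsum_cons]; ring
  have hWC : tbl C (m - i) = wsum G C₁ + G.wordWeight v + wsum G C₂ := by
    rw [hC i hi, hCi, wsum_append, wsum_cons]; ring
  have hB₂ := wsum_nonneg (G := G) B₂
  have hC₂ := wsum_nonneg (G := G) C₂
  have hB₁ := wsum_nonneg (G := G) B₁
  have hC₁ := wsum_nonneg (G := G) C₁
  have hWCpos : 0 < tbl C (m - i) := by rw [hWC]; linarith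
  simp only [wsum_append, wordWeight_append, wsum_products, wsum_map_append, hS,
    ← hC i hi] at h1 h2 ⊢
  set S := (l₁.map fun j => tbl B j * tbl C (m - j)).sum with hSdef
  -- The interval of `u ++ v` ends no later than the block of `u`.
  have hupper : wsum G B₁ * tbl C (m - i) + G.wordWeight u * wsum G C₁ +
      G.wordWeight u * G.wordWeight v ≤ (wsum G B₁ + G.wordWeight u) * tbl C (m - i) := by
    have : G.wordWeight u * (wsum G C₁ + G.wordWeight v) ≤ G.wordWeight u * tbl C (m - i) :=
      mul_le_mul_of_nonneg_left (by rw [hWC]; linarith) hu.le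
    linarith
  have huC : 0 ≤ G.wordWeight u * wsum G C₁ := by positivity
  have hBC : 0 ≤ wsum G B₁ * tbl C (m - i) := by positivity
  have hle2 : (wsum G B₁ + G.wordWeight u) * tbl C (m - i) ≤ tbl B i * tbl C (m - i) :=
    mul_le_mul_of_nonneg_right (by rw [hWB]; linarith) hWCpos.le
  have hfs := findSplit_spec (tbl B) (tbl C) m i l₁ l₂ r 0 (fun j hj => by
    have hj' : j ≤ m := hle j (by rw [hl]; simp [hj])
    rw [hB j hj', hC j hj']
    exact mul_nonneg (wsum_nonneg _) (wsum_nonneg _)) (by linarith) (by linarith)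
  rw [← hl, ← hSdef] at hfs
  obtain ⟨h3, h4⟩ := hloc₁ B₁ u B₂ hBi ((r - S) / tbl C (m - i))
    ((le_div_iff₀ hWCpos).2 (by linarith)) ((div_lt_iff₀ hWCpos).2 (by linarith))
  -- The algorithm obtains `π(u)` as the length of the returned interval.
  have hp₁ : wsum G B₁ + G.wordWeight u - wsum G B₁ = G.wordWeight u := by ring
  obtain ⟨h5, h6⟩ := hloc₂ C₁ v C₂ hCi ((r - S - wsum G B₁ * tbl C (m - i)) /
    (wsum G B₁ + G.wordWeight u - wsum G B₁))
    (by rw [hp₁, le_div_iff₀ hu]; linarith) (by rw [hp₁, div_lt_iff₀ hu]; linarith)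
  refine ⟨?_, ?_⟩
  · simp only [unrank, hr, Cost.scope_val, Cost.bind_val, hfs.1, Cost.div_val, h3, Cost.sub_val,
      Cost.mul_val, h5, Cost.add_val, Cost.pure_val, Prod.mk.injEq, true_and]
    constructor <;> ring
  · simp only [unrank, hr, Cost.scope_ops, Cost.scope_val, Cost.bind_ops, hfs.1,
      Cost.div_val, h3, Cost.sub_val, Cost.mul_val, h5, Cost.div_ops, Cost.sub_ops, Cost.mul_ops,
      Cost.add_ops, Cost.pure_ops]
    have h7 : ((findSplit (tbl B) (tbl C) m (boustrophedon m) r 0).ops : ℝ) ≤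
        4 * (2 * (min i (m - i) : ℕ) + 1) + 2 := by
      have : (findSplit (tbl B) (tbl C) m (boustrophedon m) r 0).ops ≤
          4 * (2 * min i (m - i) + 1) + 2 := by have := hfs.2; omega
      exact_mod_cast this
    push_cast at h7 ⊢
    push_cast at hc
    linarith

end Locate
/-! ### The number of operations of unranking -/

/-- A bound for the number of operations that unrank a word of length `m` from a non-terminal of
rank `k`, where `p` is the number of non-terminals. -/
def unrankCost (p m k : ℕ) : ℝ :=
  if m = 0 then 20 * 3 ^ k else
    16 * (m * Real.log m) + (17 + 2 * (21 + 20 * 3 ^ p) * p) * (2 * m - 1) + (21 + 20 * 3 ^ p) * k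

theorem unrankCost_nonneg (p m k : ℕ) : 0 ≤ unrankCost p m k := by
  unfold unrankCost
  split_ifs with h
  · positivity
  · have : (1 : ℝ) ≤ m := by exact_mod_cast Nat.one_le_iff_ne_zero.2 h
    have h1 := Real.log_nonneg this
    have h2 : (0 : ℝ) ≤ 2 * m - 1 := by linarith
    positivity

theorem unrankCost_union {p m k k' : ℕ} (h : k' < k) : 4 + unrankCost p m k' ≤ unrankCost p m k := by
  unfold unrankCost
  split_ifs with h0
  · have h1 : (3 : ℝ) ^ (k' + 1) ≤ 3 ^ k := pow_le_pow_right₀ (by norm_num) h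
    have h2 : (1 : ℝ) ≤ 3 ^ k' := one_le_pow₀ (by norm_num)
    rw [pow_succ] at h1
    linarith
  · have h1 : (k' : ℝ) + 1 ≤ k := by exact_mod_cast h
    have h2 : (0 : ℝ) ≤ 20 * 3 ^ p := by positivity
    nlinarith

/-- One factor is empty, so the length stays and the rank drops. The slope `21 + 20 * 3 ^ p` in the
rank pays for this level and for the empty factor. -/
theorem unrankCost_chain {p m k k' l : ℕ} (hm : m ≠ 0) (h : k' < k) (hl : l ≤ p) :
    17 + unrankCost p m k' + unrankCost p 0 l ≤ unrankCost p m k := by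
  unfold unrankCost
  rw [if_neg hm, if_neg hm, if_pos rfl]
  have h1 : (k' : ℝ) + 1 ≤ k := by exact_mod_cast h
  have h2 : (3 : ℝ) ^ l ≤ 3 ^ p := pow_le_pow_right₀ (by norm_num) hl
  have h3 : (0 : ℝ) ≤ 20 * 3 ^ p := by positivity
  nlinarith

/-- As `i` is at most half of `i + j`, `log i` falls short of `log (i + j)` by at least `log 2 > 1 /
2`; multiplied by `16 * i` this pays for `8 * i`. -/
theorem mul_log_add_min_le {i j : ℕ} (hi : i ≠ 0) (hij : i ≤ j) :
    16 * ((i : ℝ) * Real.log i) + 16 * ((j : ℝ) * Real.log j) + 8 * i ≤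
      16 * (((i + j : ℕ) : ℝ) * Real.log (i + j : ℕ)) := by
  have hi0 : (0 : ℝ) < i := by exact_mod_cast Nat.pos_of_ne_zero hi
  have hij' : (i : ℝ) ≤ j := by exact_mod_cast hij
  have hj0 : (0 : ℝ) < j := by linarith
  push_cast
  have h1 : Real.log i + Real.log 2 ≤ Real.log (i + j) := by
    rw [← Real.log_mul hi0.ne' (by norm_num)]
    exact Real.log_le_log (by positivity) (by linarith)
  have h2 : Real.log j ≤ Real.log (i + j) := Real.log_le_log hj0 (by linarith)
  have h3 := Real.log_two_gt_d9
  have h4 : (i : ℝ) * (Real.log i + 1 / 2) ≤ i * Real.log (i + j) :=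
    mul_le_mul_of_nonneg_left (by linarith) hi0.le
  have h5 : (j : ℝ) * Real.log j ≤ j * Real.log (i + j) := mul_le_mul_of_nonneg_left h2 hj0.le
  linarith

/-- The logarithmic part pays for the search. The linear part has the shape `2 * m - 1` so that
every split frees one unit, which covers the constant 17 and the rank terms of both factors. -/
theorem unrankCost_split {p i j k k₁ k₂ : ℕ} (hi : i ≠ 0) (hj : j ≠ 0) (h₁ : k₁ ≤ p)
    (h₂ : k₂ ≤ p) :
    8 * (min i j : ℕ) + 17 + unrankCost p i k₁ + unrankCost p j k₂ ≤ unrankCost p (i + j) k := by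
  unfold unrankCost
  rw [if_neg hi, if_neg hj, if_neg (by omega)]
  have h3 : (0 : ℝ) ≤ 20 * 3 ^ p := by positivity
  have h4 : (k₁ : ℝ) ≤ p := by exact_mod_cast h₁
  have h5 : (k₂ : ℝ) ≤ p := by exact_mod_cast h₂
  have h6 : 16 * ((i : ℝ) * Real.log i) + 16 * ((j : ℝ) * Real.log j) + 8 * (min i j : ℕ) ≤
      16 * (((i + j : ℕ) : ℝ) * Real.log (i + j : ℕ)) := by
    rcases le_total i j with h | h
    · rw [min_eq_left h]; exact mul_log_add_min_le hi h
    · rw [min_eq_right h, add_comm i j]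
      have := mul_log_add_min_le hj h
      linarith
  have h7 : (21 + 20 * (3 : ℝ) ^ p) * k₁ ≤ (21 + 20 * (3 : ℝ) ^ p) * p :=
    mul_le_mul_of_nonneg_left h4 (by linarith)
  have h8 : (21 + 20 * (3 : ℝ) ^ p) * k₂ ≤ (21 + 20 * (3 : ℝ) ^ p) * p :=
    mul_le_mul_of_nonneg_left h5 (by linarith)
  have h9 : 0 ≤ (21 + 20 * (3 : ℝ) ^ p) * k := by positivity
  have h10 : (2 * ((i + j : ℕ) : ℝ) - 1) = (2 * i - 1) + (2 * j - 1) + 1 := by push_cast; ring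
  rw [h10]
  linarith

/-- For `m = 0` both ranks drop, and two subproblems leave a third of `20 * 3 ^ k` for the constant.
If exactly one part is empty, the rank drops at the other. Otherwise both lengths drop and the ranks
are free. -/
theorem unrankCost_prod {p m i k k₁ k₂ : ℕ} (hi : i ≤ m) (h₁ : k₁ ≤ p) (h₂ : k₂ ≤ p)
    (h₁' : m - i = 0 → k₁ < k) (h₂' : i = 0 → k₂ < k) :
    8 * (min i (m - i) : ℕ) + 17 + unrankCost p i k₁ + unrankCost p (m - i) k₂ ≤
      unrankCost p m k := by
  by_cases hi0 : i = 0
  · by_cases hj0 : m - i = 0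
    · have hm : m = 0 := by omega
      subst hi0
      subst hm
      simp only [unrankCost, if_true, Nat.sub_zero, min_self, Nat.cast_zero, mul_zero, zero_add]
      have h3 : (3 : ℝ) ^ (k₁ + 1) ≤ 3 ^ k := pow_le_pow_right₀ (by norm_num) (h₁' rfl)
      have h4 : (3 : ℝ) ^ (k₂ + 1) ≤ 3 ^ k := pow_le_pow_right₀ (by norm_num) (h₂' rfl)
      have h5 : (1 : ℝ) ≤ 3 ^ k₂ := one_le_pow₀ (by norm_num)
      have h6 : (1 : ℝ) ≤ 3 ^ k₁ := one_le_pow₀ (by norm_num)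
      rw [pow_succ] at h3 h4
      linarith
    · subst hi0
      have := unrankCost_chain (p := p) (m := m) (by omega) (h₂' rfl) h₁
      simp only [Nat.sub_zero, Nat.zero_min, Nat.cast_zero, mul_zero, zero_add]
      linarith
  · by_cases hj0 : m - i = 0
    · have hm : m = i := by omega
      subst hm
      have := unrankCost_chain (p := p) (m := m) hi0 (h₁' hj0) h₂
      simp only [Nat.sub_self, Nat.min_zero, Nat.cast_zero, mul_zero, zero_add]
      linarith
    · have := unrankCost_split (p := p) (k := k) hi0 hj0 h₁ h₂
      rwa [Nat.add_sub_cancel' hi] at this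

/-- The fuel `d` exceeds the measure `m * |N| + rk G A`: a call shortens the word or keeps its
length and lowers the rank. The enumeration is built along the same recursion because the algorithm
fixes its order. -/
theorem exists_locates (hG : G.IsBCNF) {tbl : N → ℕ → ℝ} {n : ℕ}
    (htbl : ∀ A, Good G A → ∀ m ≤ n, tbl A m = total G A m) (d m : ℕ) (A : N) (hA : Good G A)
    (hm : m ≤ n) (hd : m * Fintype.card N + rk G A < d) :
    ∃ l, Lists G A m l ∧
      Locates G (unrank G tbl d A m) l (unrankCost (Fintype.card N) m (rk G A)) := by
  induction d generalizing m A with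
  | zero => omega
  | succ d ih =>
    have hnn := unrankCost_nonneg (Fintype.card N) m (rk G A)
    rcases hr : G.rule A with ⟨B, C⟩ | ⟨B, C⟩ | t | _
    · obtain ⟨hB, hC⟩ := hA.prod hG hr
      have hkB := hB.rk_lt_card hG
      have hkC := hC.rk_lt_card hG
      have hchoose : ∀ i, ∃ lB lC, Lists G B i lB ∧ Lists G C (m - i) lC ∧
          (i ≤ m → lB ≠ [] → lC ≠ [] → ∃ c₁ c₂, Locates G (unrank G tbl d B i) lB c₁ ∧
            Locates G (unrank G tbl d C (m - i)) lC c₂ ∧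
            8 * (min i (m - i) : ℕ) + 17 + c₁ + c₂ ≤ unrankCost (Fintype.card N) m (rk G A)) := by
        intro i
        -- A split for which one factor has no word of the required length is never selected. There
        -- any enumeration serves, and the ranks need not drop.
        by_cases hne : i ≤ m ∧ (wordsOf G B i).Nonempty ∧ (wordsOf G C (m - i)).Nonempty
        · obtain ⟨hi, ⟨u, hu⟩, ⟨v, hv⟩⟩ := hne
          rw [mem_wordsOf] at hu hv
          have h₁' : m - i = 0 → rk G B < rk G A := by
            intro h0
            have : v = [] := List.length_eq_zero_iff.1 (by omega)
            exact Succ.rk_lt hG ⟨C, .inr (.inr (.inl ⟨hr, this ▸ hv.1⟩))⟩ hA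
          have h₂' : i = 0 → rk G C < rk G A := by
            intro h0
            have : u = [] := List.length_eq_zero_iff.1 (by omega)
            exact Succ.rk_lt hG ⟨B, .inr (.inr (.inr ⟨hr, this ▸ hu.1⟩))⟩ hA
          -- A length shorter by one makes room for any rank below `|N|`.
          have hmeas : ∀ j k, j ≤ m → k < Fintype.card N → (j = m → k < rk G A) →
              j * Fintype.card N + k < d := by
            intro j k hj hk hjm
            rcases hj.eq_or_lt with rfl | hlt
            · have := hjm rfl
              omega
            · have : (j + 1) * Fintype.card N ≤ m * Fintype.card N := Nat.mul_le_mul_right _ hlt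
              rw [Nat.succ_mul] at this
              omega
          obtain ⟨lB, h1, h2⟩ := ih i B hB (by omega)
            (hmeas i _ hi hkB fun h => h₁' (by omega))
          obtain ⟨lC, h3, h4⟩ := ih (m - i) C hC (by omega)
            (hmeas (m - i) _ (by omega) hkC fun h => by
              rcases Nat.eq_zero_or_pos m with h0 | h0
              · exact h₂' (by omega)
              · exact h₂' (by omega))
          exact ⟨lB, lC, h1, h3, fun _ _ _ => ⟨_, _, h2, h4,
            unrankCost_prod hi hkB.le hkC.le h₁' h₂'⟩⟩
        · refine ⟨_, _, lists_toList B i, lists_toList C (m - i), fun hi hB hC => ?_⟩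
          exfalso
          rw [ne_eq, Finset.toList_eq_nil, ← ne_eq, ← Finset.nonempty_iff_ne_empty] at hB hC
          exact hne ⟨hi, hB, hC⟩
      choose lB lC h1 h2 h3 using hchoose
      refine ⟨_, Lists.prod hA hr (fun i _ => h1 i) (fun i _ => h2 i),
        locates_prod hr (fun i hi => ?_) (fun i _ => ?_) h3⟩
      · rw [htbl B hB i (by omega), (h1 i).wsum]
      · rw [htbl C hC (m - i) (by omega), (h2 i).wsum]
    · obtain ⟨hB, hC⟩ := hA.union hr
      have hkB := Succ.rk_lt hG ⟨C, .inl hr⟩ hA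
      have hkC := Succ.rk_lt hG ⟨B, .inr (.inl hr)⟩ hA
      obtain ⟨l, h1, h2⟩ := ih m B hB hm (by omega)
      obtain ⟨l', h3, h4⟩ := ih m C hC hm (by omega)
      refine ⟨_, h1.union hG hA hr h3, (locates_union hr h2 h4 ?_).mono ?_⟩
      · rw [htbl B hB m hm, h1.wsum]
      · rw [← max_add_add_left]
        exact max_le (unrankCost_union hkB) (unrankCost_union hkC)
    · by_cases h1 : m = 1
      · refine ⟨[[t]], ⟨by simp, fun w => ?_⟩, (locates_term hr).mono hnn⟩
        rw [mem_wordsOf, lang_term hr, List.mem_singleton, Set.mem_singleton_iff]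
        exact ⟨fun h => ⟨h, by simp [h, h1]⟩, fun h => h.1⟩
      · refine ⟨[], ⟨by simp, fun w => ?_⟩, fun a w b he => by simp at he⟩
        rw [mem_wordsOf, lang_term hr, Set.mem_singleton_iff]
        simp only [List.not_mem_nil, false_iff]
        rintro ⟨rfl, h⟩
        exact h1 (by simpa using h.symm)
    · by_cases h1 : m = 0
      · refine ⟨[[]], ⟨by simp, fun w => ?_⟩, (locates_eps hr).mono hnn⟩
        rw [mem_wordsOf, lang_eps hr, List.mem_singleton, Set.mem_singleton_iff]
        exact ⟨fun h => ⟨h, by simp [h, h1]⟩, fun h => h.1⟩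
      · refine ⟨[], ⟨by simp, fun w => ?_⟩, fun a w b he => by simp at he⟩
        rw [mem_wordsOf, lang_eps hr, Set.mem_singleton_iff]
        simp only [List.not_mem_nil, false_iff]
        rintro ⟨rfl, h⟩
        exact h1 (by simpa using h.symm)

theorem live_unrank_le (tbl : N → ℕ → ℝ) (d : ℕ) (A : N) (m : ℕ) (r : ℝ) :
    (unrank G tbl d A m r).live ≤ 2 := by
  cases d with
  | zero => exact Nat.zero_le _
  | succ d => exact le_rfl

/-- The numbers of the search, at most `4 * (n + 1)`, are released before the recursive calls, so
they count once and not at every level. Apart from them a level holds at most 17 numbers outside its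
recursive calls. -/
theorem peak_unrank_le (tbl : N → ℕ → ℝ) (n d : ℕ) (A : N) (m : ℕ) (hm : m ≤ n) (r : ℝ) :
    (unrank G tbl d A m r).peak ≤ 4 * (n + 1) + 20 * d := by
  induction d generalizing A m r with
  | zero => exact Nat.zero_le _
  | succ d ih =>
    rw [unrank, Cost.scope_peak]
    refine max_le ?_ (by omega)
    rcases hr : G.rule A with ⟨B, C⟩ | ⟨B, C⟩ | t | _
    · have h1 := (tame_findSplit (tbl B) (tbl C) m (boustrophedon m) r 0).2
      have h2 := ops_findSplit_le (tbl B) (tbl C) m (boustrophedon m) r 0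
      rw [length_boustrophedon] at h2
      have h3 := findSplit_index_le (tbl B) (tbl C) m (boustrophedon m) r 0
        fun i hi => mem_boustrophedon.1 hi
      simp only [Cost.bind_peak, Cost.scope_peak, Cost.scope_live, Cost.scope_val,
        Cost.div_peak, Cost.div_live, Cost.sub_peak, Cost.sub_live, Cost.mul_peak, Cost.mul_live,
        Cost.add_peak, Cost.add_live, Cost.pure_peak]
      generalize (findSplit (tbl B) (tbl C) m (boustrophedon m) r 0).val = v at *
      have h4 := ih B v.1 (by omega) (Cost.div v.2.1 (tbl C (m - v.1))).val
      have h5 := live_unrank_le (G := G) tbl d B v.1 (Cost.div v.2.1 (tbl C (m - v.1))).val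
      have h6 : ∀ r, (unrank G tbl d C (m - v.1) r).peak ≤ 4 * (n + 1) + 20 * d := fun r =>
        ih C (m - v.1) (by omega) r
      have h7 : ∀ r, (unrank G tbl d C (m - v.1) r).live ≤ 2 := fun r => live_unrank_le _ _ _ _ _
      generalize unrank G tbl d B v.1 (Cost.div v.2.1 (tbl C (m - v.1))).val = x at *
      generalize hy : unrank G tbl d C (m - v.1) _ = y at *
      have h8 : y.peak ≤ 4 * (n + 1) + 20 * d := hy ▸ h6 _
      have h9 : y.live ≤ 2 := hy ▸ h7 _
      omega
    · have h1 := ih B m hm r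
      have h2 := ih C m hm (Cost.sub r (tbl B m)).val
      have h3 := live_unrank_le (G := G) tbl d C m (Cost.sub r (tbl B m)).val
      simp only [Cost.bind_peak, Cost.lt_peak, Cost.lt_live]
      split_ifs
      · omega
      · simp only [Cost.bind_peak, Cost.sub_peak, Cost.sub_live, Cost.add_peak, Cost.add_live,
          Cost.pure_peak]
        omega
    · exact Nat.zero_le _
    · exact Nat.zero_le _

end WeightedGrammar

/-! ### Shifting past a list of intervals -/

section Shift

variable {α : Type}

/-- The total length of the intervals of a list. -/
def gapSum (l : List (α × ℝ × ℝ)) : ℝ := (l.map fun e => e.2.2 - e.2.1).sum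

@[simp] theorem gapSum_nil : gapSum ([] : List (α × ℝ × ℝ)) = 0 := rfl

@[simp] theorem gapSum_cons (e : α × ℝ × ℝ) (l : List (α × ℝ × ℝ)) :
    gapSum (e :: l) = e.2.2 - e.2.1 + gapSum l := by simp [gapSum]

@[simp] theorem gapSum_append (l l' : List (α × ℝ × ℝ)) :
    gapSum (l ++ l') = gapSum l + gapSum l' := by simp [gapSum]

/-- The intervals of the list are nonempty and occur from left to right. -/
def Separated (l : List (α × ℝ × ℝ)) : Prop :=
  l.Pairwise (fun x y => x.2.2 ≤ y.2.1) ∧ ∀ x ∈ l, x.2.1 < x.2.2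

theorem Separated.tail {e : α × ℝ × ℝ} {l : List (α × ℝ × ℝ)} (h : Separated (e :: l)) :
    Separated l := ⟨(List.pairwise_cons.1 h.1).2, fun x hx => h.2 x (List.mem_cons_of_mem _ hx)⟩

theorem Separated.left {l l' : List (α × ℝ × ℝ)} (h : Separated (l ++ l')) : Separated l :=
  ⟨(List.pairwise_append.1 h.1).1, fun x hx => h.2 x (List.mem_append_left _ hx)⟩

theorem Separated.right {l l' : List (α × ℝ × ℝ)} (h : Separated (l ++ l')) : Separated l' :=
  ⟨(List.pairwise_append.1 h.1).2.1, fun x hx => h.2 x (List.mem_append_right _ hx)⟩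

/-- Shifts `x` to the right past the intervals of the list. -/
def shift (x : ℝ) : List (α × ℝ × ℝ) → ℝ
  | [] => x
  | e :: l => if x < e.2.1 then x else shift (x + (e.2.2 - e.2.1)) l

theorem shift_append_of_lt {l l' : List (α × ℝ × ℝ)} {e : α × ℝ × ℝ} {x : ℝ}
    (h : x < e.2.1 - gapSum l) : shift x (l ++ e :: l') = shift x l := by
  induction l generalizing x with
  | nil =>
    rw [gapSum_nil, sub_zero] at h
    simp [shift, h]
  | cons a l ih =>
    rw [gapSum_cons] at h
    simp only [List.cons_append, shift]
    split_ifs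
    · rfl
    · exact ih (by linarith)

theorem Separated.add_gapSum_le {l l' : List (α × ℝ × ℝ)} {a e : α × ℝ × ℝ}
    (h : Separated (a :: l ++ e :: l')) : a.2.2 + gapSum l ≤ e.2.1 := by
  induction l generalizing a with
  | nil =>
    have := (List.pairwise_cons.1 h.1).1 e (by simp)
    simpa using this
  | cons b l ih =>
    have h1 := (List.pairwise_cons.1 h.1).1 b (by simp)
    have h2 := ih (a := b) h.tail
    rw [gapSum_cons]
    linarith

/-- The thresholds `e.2.1 - gapSum l` do not decrease along a separated list. Reaching that of `e`
means reaching all earlier ones, so a single comparison decides about the whole prefix. -/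
theorem Separated.shift_append_of_le {l l' : List (α × ℝ × ℝ)} {e : α × ℝ × ℝ} {x : ℝ}
    (hs : Separated (l ++ e :: l')) (h : e.2.1 - gapSum l ≤ x) :
    shift x (l ++ e :: l') = shift (x + (gapSum l + (e.2.2 - e.2.1))) l' := by
  induction l generalizing x with
  | nil =>
    rw [gapSum_nil, sub_zero] at h
    simp [shift, not_lt.2 h]
  | cons a l ih =>
    have h1 := hs.add_gapSum_le
    rw [gapSum_cons] at h
    simp only [List.cons_append, shift]
    rw [if_neg (by linarith), ih hs.tail (by linarith)]
    congr 1
    rw [gapSum_cons]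
    ring

theorem Separated.le_shift {l : List (α × ℝ × ℝ)} (hs : Separated l) (x : ℝ) : x ≤ shift x l := by
  induction l generalizing x with
  | nil => exact le_rfl
  | cons e l ih =>
    have h1 := ih hs.tail (x + (e.2.2 - e.2.1))
    have h2 := hs.2 e (by simp)
    simp only [shift]
    split_ifs
    · exact le_rfl
    · linarith

theorem shift_lt {l : List (α × ℝ × ℝ)} {x W : ℝ} (hW : ∀ e ∈ l, e.2.1 < W)
    (hx : x + gapSum l < W) : shift x l < W := by
  induction l generalizing x with
  | nil => simpa [shift] using hx
  | cons e l ih =>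
    simp only [shift]
    split_ifs with h
    · exact h.trans (hW e (by simp))
    · rw [gapSum_cons] at hx
      exact ih (fun e he => hW e (by simp [he])) (by linarith)

theorem Separated.shift_not_mem {l : List (α × ℝ × ℝ)} (hs : Separated l) (x : ℝ)
    {e : α × ℝ × ℝ} (he : e ∈ l) : ¬ (e.2.1 ≤ shift x l ∧ shift x l < e.2.2) := by
  induction l generalizing x with
  | nil => simp at he
  | cons a l ih =>
    simp only [shift]
    rcases List.mem_cons.1 he with rfl | he'
    · split_ifs with h
      · rintro ⟨h1, -⟩; linarith
      · rintro ⟨-, h2⟩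
        have := hs.tail.le_shift (x + (e.2.2 - e.2.1))
        linarith
    · split_ifs with h
      · rintro ⟨h1, -⟩
        have h2 := (List.pairwise_cons.1 hs.1).1 e he'
        have h3 := hs.2 a (by simp)
        linarith
      · exact ih hs.tail _ he'

open Classical in
/-- The total length of the intervals of the list that start before `lo`. -/
def offset (lo : ℝ) (l : List (α × ℝ × ℝ)) : ℝ := gapSum (l.filter fun e => e.2.1 < lo)

theorem offset_cons (lo : ℝ) (e : α × ℝ × ℝ) (l : List (α × ℝ × ℝ)) :
    offset lo (e :: l) = (if e.2.1 < lo then e.2.2 - e.2.1 else 0) + offset lo l := by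
  simp only [offset, List.filter_cons, decide_eq_true_eq]
  split_ifs <;> simp

theorem offset_perm {lo : ℝ} {l l' : List (α × ℝ × ℝ)} (h : l.Perm l') :
    offset lo l = offset lo l' :=
  ((h.filter _).map _).sum_eq

theorem Separated.offset_le {l : List (α × ℝ × ℝ)} (hs : Separated l) {lo b : ℝ} (hb : b ≤ lo)
    (hl : ∀ e ∈ l, b ≤ e.2.1) (hlo : ∀ e ∈ l, e.2.1 < lo → e.2.2 ≤ lo) :
    b + offset lo l ≤ lo := by
  induction l generalizing b with
  | nil => simpa [offset] using hb
  | cons e l ih =>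
    have h1 := hl e (by simp)
    have h2 := hs.2 e (by simp)
    rw [offset_cons]
    split_ifs with h
    · have := ih hs.tail (hlo e (by simp) h) (List.pairwise_cons.1 hs.1).1
        (fun e' he => hlo e' (by simp [he]))
      linarith
    · have := ih hs.tail hb (fun e' he => hl e' (by simp [he]))
        (fun e' he => hlo e' (by simp [he]))
      linarith

theorem offset_eq_zero {l : List (α × ℝ × ℝ)} {lo : ℝ} (h : ∀ e ∈ l, lo ≤ e.2.1) :
    offset lo l = 0 := by
  induction l with
  | nil => rfl
  | cons e l ih =>
    rw [offset_cons, if_neg (not_lt.2 (h e (by simp))), ih fun e he => h e (by simp [he]), zero_add]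

/-- The shift moves a number into a free interval by a constant. -/
theorem Separated.shift_mem_iff {l : List (α × ℝ × ℝ)} (hs : Separated l) {lo hi : ℝ}
    (hlt : lo < hi) (hfree : ∀ e ∈ l, e.2.2 ≤ lo ∨ hi ≤ e.2.1) (x : ℝ) :
    (lo ≤ shift x l ∧ shift x l < hi) ↔ lo ≤ x + offset lo l ∧ x + offset lo l < hi := by
  induction l generalizing x with
  | nil => simp [shift, offset]
  | cons e l ih =>
    have he := hs.2 e (by simp)
    have hpw := (List.pairwise_cons.1 hs.1).1
    have ih' := ih hs.tail (fun e' he => hfree e' (by simp [he])) (x + (e.2.2 - e.2.1))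
    rw [offset_cons]
    rcases hfree e (by simp) with h | h
    · rw [if_pos (by linarith)]
      simp only [shift]
      split_ifs with hx
      -- Here `x` lies left of `e`, and the gaps up to `lo` cannot carry it as far as `lo`: both
      -- sides are false.
      · have := hs.tail.offset_le h hpw (fun e' he' hlo => by
          rcases hfree e' (by simp [he']) with h' | h' <;> linarith)
        constructor <;> rintro ⟨h1, h2⟩ <;> exfalso <;> linarith
      · rw [ih', add_assoc]
    · rw [if_neg (by linarith), offset_eq_zero fun e' he' => by linarith [hpw e' he'], add_zero,
        add_zero]
      simp only [shift]
      split_ifs with hx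
      · rfl
      · have := hs.tail.le_shift (x + (e.2.2 - e.2.1))
        constructor <;> rintro ⟨h1, h2⟩ <;> exfalso <;> linarith

end Shift

/-! ### The AVL tree -/

namespace GapTree

variable {T : Type}

/-- The words and intervals of the tree, from left to right. -/
def inorder : GapTree T → List (List T × ℝ × ℝ)
  | nil => []
  | node l w L R _ r _ => l.inorder ++ (w, L, R) :: r.inorder

/-- The tree is balanced and the redundant data of its nodes are correct. -/
def Valid : GapTree T → Prop
  | nil => True
  | node l _ _ _ δ r h => l.Valid ∧ r.Valid ∧ δ = gapSum l.inorder ∧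
      h = max l.height r.height + 1 ∧ l.height ≤ r.height + 1 ∧ r.height ≤ l.height + 1

@[simp] theorem height_nil : (nil : GapTree T).height = 0 := rfl

@[simp] theorem height_node (l r : GapTree T) (w : List T) (L R δ : ℝ) (h : ℕ) :
    (node l w L R δ r h).height = h := rfl

theorem size_eq (t : GapTree T) : t.size = 3 * t.inorder.length := by
  induction t with
  | nil => rfl
  | node l w L R δ r h ihl ihr =>
    simp only [size, inorder, ihl, ihr, List.length_append, List.length_cons]
    ring

/-- Both subtrees have height at least `max - 1`, so the number of nodes plus one at least doubles
every two levels. -/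
theorem Valid.two_pow_le {t : GapTree T} (h : t.Valid) :
    2 ^ (t.height / 2) ≤ t.inorder.length + 1 := by
  induction t with
  | nil => simp
  | node l w L R δ r h' ihl ihr =>
    obtain ⟨hl, hr, -, rfl, h1, h2⟩ := h
    have ihl := ihl hl
    have ihr := ihr hr
    simp only [height_node, inorder, List.length_append, List.length_cons]
    by_cases h0 : max l.height r.height = 0
    · rw [h0]; simp
    · have e : (max l.height r.height + 1) / 2 = (max l.height r.height - 1) / 2 + 1 := by omega
      have hl' : 2 ^ ((max l.height r.height - 1) / 2) ≤ 2 ^ (l.height / 2) :=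
        Nat.pow_le_pow_right (by norm_num) (by omega)
      have hr' : 2 ^ ((max l.height r.height - 1) / 2) ≤ 2 ^ (r.height / 2) :=
        Nat.pow_le_pow_right (by norm_num) (by omega)
      rw [e, pow_succ]
      omega

theorem tame_modRandom (x : ℝ) (t : GapTree T) : (modRandom x t).Tame := by
  induction t generalizing x with
  | nil => exact Cost.tame_pure _
  | node l w L R δ r h ihl ihr =>
    refine (Cost.tame_sub _ _).bind ((Cost.tame_lt _ _).bind ?_)
    split_ifs
    · exact ihl x
    · exact (Cost.tame_sub _ _).bind ((Cost.tame_add _ _).bind ((Cost.tame_add _ _).bind (ihr _)))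

theorem Valid.ops_modRandom_le {t : GapTree T} (h : t.Valid) (x : ℝ) :
    (modRandom x t).ops ≤ 5 * t.height := by
  induction t generalizing x with
  | nil => exact le_rfl
  | node l w L R δ r h' ihl ihr =>
    obtain ⟨hl, hr, -, rfl, -, -⟩ := h
    have h1 := ihl hl x
    have h2 := ihr hr (x + (δ + (R - L)))
    simp only [modRandom, Cost.bind_ops, Cost.sub_ops, Cost.lt_ops, height_node]
    split_ifs
    · omega
    · simp only [Cost.bind_ops, Cost.sub_ops, Cost.add_ops, Cost.sub_val, Cost.add_val]
      omega

/-- `L - δ` is the threshold of the node within its subtree; the gaps to the left of the subtree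
have already been added to `x` on the way down. -/
theorem Valid.val_modRandom {t : GapTree T} (h : t.Valid) (hs : Separated t.inorder) (x : ℝ) :
    (modRandom x t).val = shift x t.inorder := by
  induction t generalizing x with
  | nil => rfl
  | node l w L R δ r h' ihl ihr =>
    obtain ⟨hl, hr, hδ, -, -, -⟩ := h
    simp only [inorder] at hs ⊢
    simp only [modRandom, Cost.bind_val, Cost.lt_val, Cost.sub_val]
    split_ifs with hx
    · rw [shift_append_of_lt (by rwa [← hδ]), ihl hl hs.left]
    · rw [hs.shift_append_of_le (by rw [← hδ]; exact not_lt.1 hx), Cost.bind_val, Cost.bind_val,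
        Cost.bind_val, ihr hr hs.right.tail, ← hδ]
      rfl

theorem tame_rotateRight (t : GapTree T) : (rotateRight t).Tame := by
  unfold rotateRight
  split
  · exact (Cost.tame_sub _ _).bind ((Cost.tame_add _ _).bind
      ((Cost.tame_sub _ _).bind (Cost.tame_pure _)))
  · exact Cost.tame_pure _

theorem tame_rotateLeft (t : GapTree T) : (rotateLeft t).Tame := by
  unfold rotateLeft
  split
  · exact (Cost.tame_sub _ _).bind ((Cost.tame_add _ _).bind
      ((Cost.tame_add _ _).bind (Cost.tame_pure _)))
  · exact Cost.tame_pure _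

theorem ops_rotateRight_le (t : GapTree T) : (rotateRight t).ops ≤ 3 := by
  unfold rotateRight
  split <;> simp

theorem ops_rotateLeft_le (t : GapTree T) : (rotateLeft t).ops ≤ 3 := by
  unfold rotateLeft
  split <;> simp

theorem tame_rebalance (t : GapTree T) : (rebalance t).Tame := by
  unfold rebalance
  split
  · exact Cost.tame_pure _
  · split_ifs
    · exact (tame_rotateLeft _).bind (tame_rotateRight _)
    · exact tame_rotateRight _
    · exact (tame_rotateRight _).bind (tame_rotateLeft _)
    · exact tame_rotateLeft _
    · exact Cost.tame_pure _

theorem ops_rebalance_le (t : GapTree T) : (rebalance t).ops ≤ 6 := by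
  unfold rebalance
  split
  · simp
  · rename_i l w L R δ r h
    split_ifs
    · have h1 := ops_rotateLeft_le l
      have h2 := ops_rotateRight_le (mk (rotateLeft l).val w L R δ r)
      rw [Cost.bind_ops]
      omega
    · exact (ops_rotateRight_le _).trans (by norm_num)
    · have h1 := ops_rotateRight_le r
      have h2 := ops_rotateLeft_le (mk l w L R δ (rotateRight r).val)
      rw [Cost.bind_ops]
      omega
    · exact (ops_rotateLeft_le _).trans (by norm_num)
    · simp

/-- Heights that differ by two are what one insertion can cause. The last clause is needed because
the general lower bound alone would let an insertion reduce the height of a balanced node. -/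
theorem rebalance_spec {l r : GapTree T} {w : List T} {L R δ : ℝ} (hl : l.Valid) (hr : r.Valid)
    (hδ : δ = gapSum l.inorder) (h1 : l.height ≤ r.height + 2) (h2 : r.height ≤ l.height + 2) :
    (rebalance (mk l w L R δ r)).val.Valid ∧
      (rebalance (mk l w L R δ r)).val.inorder = l.inorder ++ (w, L, R) :: r.inorder ∧
      max l.height r.height ≤ (rebalance (mk l w L R δ r)).val.height ∧
      (rebalance (mk l w L R δ r)).val.height ≤ max l.height r.height + 1 ∧
      (l.height ≤ r.height + 1 → r.height ≤ l.height + 1 →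
        (rebalance (mk l w L R δ r)).val.height = max l.height r.height + 1) := by
  subst hδ
  rw [mk, rebalance]
  split_ifs with h3 h4 h5 h6
  · rcases l with _ | ⟨a, wl, Ll, Rl, δl, b, hh⟩
    · simp at h3
    · rcases b with _ | ⟨b₁, wb, Lb, Rb, δb, b₂, hb⟩
      · simp [rightHeavy] at h4
      · simp only [Valid, height_node, rightHeavy] at *
        have h4 := of_decide_eq_true h4
        obtain ⟨ha, ⟨hb₁, hb₂, rfl, hb, hb3, hb4⟩, rfl, hh, hh3, hh4⟩ := hl
        simp only [rotateLeft, rotateRight, mk, Cost.bind_val, Cost.pure_val, Cost.sub_val,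
          Cost.add_val, Valid, height_node, inorder, gapSum_append, gapSum_cons, List.append_assoc,
          List.cons_append, true_and]
        constructorm* _ ∧ _ <;> first | assumption | omega | ring
  · rcases l with _ | ⟨a, wl, Ll, Rl, δl, b, hh⟩
    · simp at h3
    · simp only [Valid, height_node, rightHeavy] at *
      have h4 := not_lt.1 fun h => h4 (decide_eq_true h)
      obtain ⟨ha, hb, rfl, hh, hh3, hh4⟩ := hl
      simp only [rotateRight, mk, Cost.bind_val, Cost.pure_val, Cost.sub_val,
        Cost.add_val, Valid, height_node, inorder, gapSum_append, gapSum_cons, List.append_assoc,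
        List.cons_append, true_and]
      constructorm* _ ∧ _ <;> first | assumption | omega | ring
  · rcases r with _ | ⟨b, wr, Lr, Rr, δr, c, hh⟩
    · simp at h5
    · rcases b with _ | ⟨b₁, wb, Lb, Rb, δb, b₂, hb⟩
      · simp [leftHeavy] at h6
      · simp only [Valid, height_node, leftHeavy] at *
        have h6 := of_decide_eq_true h6
        obtain ⟨⟨hb₁, hb₂, rfl, hb, hb3, hb4⟩, hc, rfl, hh, hh3, hh4⟩ := hr
        simp only [rotateLeft, rotateRight, mk, Cost.bind_val, Cost.pure_val, Cost.sub_val,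
          Cost.add_val, Valid, height_node, inorder, gapSum_append, gapSum_cons, List.append_assoc,
          List.cons_append, true_and]
        constructorm* _ ∧ _ <;> first | assumption | omega | ring
  · rcases r with _ | ⟨b, wr, Lr, Rr, δr, c, hh⟩
    · simp at h5
    · simp only [Valid, height_node, leftHeavy] at *
      have h6 := not_lt.1 fun h => h6 (decide_eq_true h)
      obtain ⟨hb, hc, rfl, hh, hh3, hh4⟩ := hr
      simp only [rotateLeft, mk, Cost.bind_val, Cost.pure_val, Cost.sub_val,
        Cost.add_val, Valid, height_node, inorder, gapSum_append, gapSum_cons, List.append_assoc,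
        List.cons_append, true_and]
      constructorm* _ ∧ _ <;> first | assumption | omega | ring
  · simp only [Cost.pure_val, Valid, height_node, inorder, true_and]
    constructorm* _ ∧ _ <;> first | assumption | omega | exact fun _ _ => trivial

theorem tame_insert (w : List T) (L R : ℝ) (t : GapTree T) : (insert w L R t).Tame := by
  induction t with
  | nil => exact Cost.tame_pure _
  | node l w' L' R' δ r h ihl ihr =>
    refine (Cost.tame_lt _ _).bind ?_
    split_ifs
    · exact (Cost.tame_sub _ _).bind ((Cost.tame_add _ _).bind (ihl.bind (tame_rebalance _)))
    · exact ihr.bind (tame_rebalance _)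

theorem Valid.ops_insert_le {t : GapTree T} (h : t.Valid) (w : List T) (L R : ℝ) :
    (insert w L R t).ops ≤ 9 * t.height := by
  induction t with
  | nil => exact le_rfl
  | node l w' L' R' δ r h' ihl ihr =>
    obtain ⟨hl, hr, -, rfl, -, -⟩ := h
    have h1 := ihl hl
    have h2 := ihr hr
    simp only [insert, Cost.bind_ops, Cost.lt_ops, height_node]
    split_ifs
    · have h3 := ops_rebalance_le (mk (insert w L R l).val w' L' R' (Cost.add δ (Cost.sub R L).val).val r)
      simp only [Cost.bind_ops, Cost.sub_ops, Cost.add_ops]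
      omega
    · have h3 := ops_rebalance_le (mk l w' L' R' δ (insert w L R r).val)
      simp only [Cost.bind_ops]
      omega

theorem Valid.insert_spec {t : GapTree T} (h : t.Valid)
    (hs : t.inorder.Pairwise fun x y => x.2.1 < y.2.1) (w : List T) (L R : ℝ) :
    (insert w L R t).val.Valid ∧ t.height ≤ (insert w L R t).val.height ∧
      (insert w L R t).val.height ≤ t.height + 1 ∧
      ∃ a b, t.inorder = a ++ b ∧ (insert w L R t).val.inorder = a ++ (w, L, R) :: b ∧
        (∀ e ∈ a, e.2.1 ≤ L) ∧ ∀ e ∈ b, L < e.2.1 := by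
  induction t with
  | nil =>
    refine ⟨?_, ?_, ?_, [], [], rfl, rfl, by simp, by simp⟩ <;> simp [insert, mk, Valid, height_nil, height_node, inorder]
  | node l w' L' R' δ r h' ihl ihr =>
    obtain ⟨hl, hr, hδ, rfl, hb1, hb2⟩ := h
    simp only [inorder] at hs ⊢
    rw [List.pairwise_append, List.pairwise_cons] at hs
    obtain ⟨hsl, ⟨hsr, hsr'⟩, hslr⟩ := hs
    simp only [insert, Cost.bind_val, Cost.lt_val]
    split_ifs with hL
    · obtain ⟨h1, h2, h3, a, b, h4, h5, h6, h7⟩ := ihl hl hsl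
      simp only [Cost.bind_val, Cost.sub_val, Cost.add_val]
      obtain ⟨g1, g2, g3, g4, g5⟩ := rebalance_spec (w := w') (L := L') (R := R')
        (δ := δ + (R - L)) h1 hr (by rw [h5, hδ, h4]; simp; ring) (by omega) (by omega)
      refine ⟨g1, ?_, ?_, a, b ++ (w', L', R') :: r.inorder, by rw [h4]; simp, by
        rw [g2, h5]; simp, h6, ?_⟩
      · simp only [height_node]; omega
      · simp only [height_node]; omega
      · intro e he
        rcases List.mem_append.1 he with he | he
        · exact h7 e he
        · rcases List.mem_cons.1 he with rfl | he
          · exact hL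
          · exact hL.trans (hsr e he)
    · obtain ⟨h1, h2, h3, a, b, h4, h5, h6, h7⟩ := ihr hr hsr'
      simp only [Cost.bind_val]
      obtain ⟨g1, g2, g3, g4, g5⟩ := rebalance_spec (w := w') (L := L') (R := R')
        (δ := δ) hl h1 hδ (by omega) (by omega)
      refine ⟨g1, ?_, ?_, l.inorder ++ (w', L', R') :: a, b, by rw [h4]; simp, by
        rw [g2, h5]; simp, ?_, h7⟩
      · simp only [height_node]; omega
      · simp only [height_node]; omega
      · intro e he
        rcases List.mem_append.1 he with he | he
        · exact (hslr e he (w', L', R') (by simp)).le.trans (not_lt.1 hL)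
        · rcases List.mem_cons.1 he with rfl | he
          · exact not_lt.1 hL
          · exact h6 e he

end GapTree

namespace WeightedGrammar

variable {T N : Type} [Fintype T] [Fintype N] {G : WeightedGrammar T N}

/-! ### Unranking as a partition into intervals -/

/-- The procedure `f` finds the word of `S` to which a rank belongs, where the word `w` has the
interval `[lo w, lo w + π(w))` and these intervals are a partition of `[0, W)`. -/
structure Partition (G : WeightedGrammar T N) (f : ℝ → Cost (List T × ℝ × ℝ))
    (S : Finset (List T)) (W : ℝ) (lo : List T → ℝ) (c : ℝ) : Prop where
  total_eq : W = ∑ w ∈ S, G.wordWeight w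
  lo_nonneg : ∀ w ∈ S, 0 ≤ lo w
  le_total : ∀ w ∈ S, lo w + G.wordWeight w ≤ W
  disjoint : ∀ w ∈ S, ∀ v ∈ S, w ≠ v → lo w + G.wordWeight w ≤ lo v ∨ lo v + G.wordWeight v ≤ lo w
  cover : ∀ r, 0 ≤ r → r < W → ∃ w ∈ S, lo w ≤ r ∧ r < lo w + G.wordWeight w
  val_eq : ∀ w ∈ S, ∀ r, lo w ≤ r → r < lo w + G.wordWeight w →
    (f r).val = (w, lo w, lo w + G.wordWeight w)
  ops_le : ∀ r, 0 ≤ r → r < W → ((f r).ops : ℝ) ≤ c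

/-- The interval of a word starts at the total weight of its predecessors in the list, so the
intervals are consecutive segments between prefix sums. -/
theorem exists_partition {f : ℝ → Cost (List T × ℝ × ℝ)} {A : N} {m : ℕ} {l : List (List T)}
    {c : ℝ} (hl : Lists G A m l) (hf : Locates G f l c) :
    ∃ lo, Partition G f (wordsOf G A m) (total G A m) lo c := by
  classical
  have hsplit : ∀ w ∈ l, l = l.take (l.idxOf w) ++ w :: l.drop (l.idxOf w + 1) := by
    intro w hw
    have h := List.idxOf_lt_length_of_mem hw
    conv_lhs => rw [← List.take_append_drop (l.idxOf w) l, List.drop_eq_getElem_cons h,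
      List.getElem_idxOf h]
  have hmono : ∀ i j, i ≤ j → wsum G (l.take i) ≤ wsum G (l.take j) := by
    intro i j hij
    obtain ⟨s, hs⟩ := List.take_prefix_take_left (l := l) hij
    rw [← hs, wsum_append]
    linarith [wsum_nonneg (G := G) s]
  have hsucc : ∀ w ∈ l, wsum G (l.take (l.idxOf w)) + G.wordWeight w =
      wsum G (l.take (l.idxOf w + 1)) := by
    intro w hw
    have h := List.idxOf_lt_length_of_mem hw
    rw [List.take_add_one, wsum_append, List.getElem?_eq_getElem h, List.getElem_idxOf h]
    simp
  refine ⟨fun w => wsum G (l.take (l.idxOf w)), ⟨rfl, ?_, ?_, ?_, ?_, ?_, ?_⟩⟩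
  · exact fun w _ => wsum_nonneg _
  · intro w hw
    rw [← hl.2] at hw
    rw [hsucc w hw, ← hl.wsum]
    have := hmono (l.idxOf w + 1) (max (l.idxOf w + 1) l.length) (le_max_left _ _)
    rwa [List.take_of_length_le (le_max_right _ _)] at this
  · intro w hw v hv hne
    rw [← hl.2] at hw hv
    rw [hsucc w hw, hsucc v hv]
    have hi : l.idxOf w ≠ l.idxOf v := fun h => hne (List.idxOf_inj hw |>.1 h)
    rcases lt_or_gt_of_ne hi with h | h
    · exact .inl (hmono _ _ h)
    · exact .inr (hmono _ _ h)
  · intro r h0 hr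
    rw [← hl.wsum] at hr
    obtain ⟨a, w, b, rfl, h1, h2⟩ := exists_locate h0 hr
    refine ⟨w, (hl.2 w).1 (by simp), ?_⟩
    have hnd := hl.1
    have hw : w ∉ a := by
      rw [List.nodup_append'] at hnd
      exact fun h => hnd.2.2 h (by simp)
    have : (a ++ w :: b).idxOf w = a.length := by
      rw [List.idxOf_append_of_notMem hw]; simp
    rw [this, List.take_left']
    · exact ⟨h1, h2⟩
    · rfl
  · intro w hw r h1 h2
    rw [← hl.2] at hw
    exact (hf _ _ _ (hsplit w hw) r h1 h2).1
  · intro r h0 hr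
    rw [← hl.wsum] at hr
    obtain ⟨a, w, b, he, h1, h2⟩ := exists_locate h0 hr
    exact (hf a w b he r h1 h2).2

/-! ### One draw -/

/-- The word with its interval. -/
def interval (G : WeightedGrammar T N) (lo : List T → ℝ) (w : List T) : List T × ℝ × ℝ :=
  (w, lo w, lo w + G.wordWeight w)

theorem gapSum_map_interval (lo : List T → ℝ) (F : List (List T)) :
    gapSum (F.map (interval G lo)) = wsum G F := by
  induction F with
  | nil => rfl
  | cons w F ih => simp [interval] at ih ⊢; exact ih

theorem gapSum_perm {α : Type} {l l' : List (α × ℝ × ℝ)} (h : l.Perm l') : gapSum l = gapSum l' :=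
  (h.map _).sum_eq

/-- The tree holds the intervals of the words `F`. -/
structure Holds (G : WeightedGrammar T N) (lo : List T → ℝ) (t : GapTree T)
    (F : List (List T)) : Prop where
  valid : t.Valid
  separated : Separated t.inorder
  perm : t.inorder.Perm (F.map (interval G lo))

section Draw

variable {f : ℝ → Cost (List T × ℝ × ℝ)} {S : Finset (List T)} {W : ℝ} {lo : List T → ℝ} {c : ℝ}

theorem holds_nil : Holds G lo (GapTree.nil : GapTree T) [] :=
  ⟨trivial, ⟨List.Pairwise.nil, by simp [GapTree.inorder]⟩, by simp [GapTree.inorder]⟩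

theorem Holds.mem_iff {t : GapTree T} {F : List (List T)} (h : Holds G lo t F)
    {e : List T × ℝ × ℝ} : e ∈ t.inorder ↔ ∃ w ∈ F, e = interval G lo w := by
  rw [h.perm.mem_iff, List.mem_map]
  simp only [eq_comm]

/-- The insertion compares left ends only; disjointness of the intervals upgrades the order of left
ends to separation. -/
theorem Holds.insert (hP : Partition G f S W lo c) {t : GapTree T} {F : List (List T)}
    (h : Holds G lo t F) (hF : ∀ w ∈ F, w ∈ S) {w : List T} (hw : w ∈ S) (hwF : w ∉ F) :
    Holds G lo (t.insert w (lo w) (lo w + G.wordWeight w)).val (F ++ [w]) := by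
  have hpos := wordWeight_pos G w
  have hlt : t.inorder.Pairwise fun x y => x.2.1 < y.2.1 := by
    refine h.separated.1.imp_of_mem ?_
    intro x y hx _ hxy
    exact (h.separated.2 x hx).trans_le hxy
  obtain ⟨h1, -, -, a, b, h2, h3, h4, h5⟩ := h.valid.insert_spec hlt w (lo w) (lo w + G.wordWeight w)
  have hdis : ∀ e ∈ t.inorder, e.2.2 ≤ lo w ∨ lo w + G.wordWeight w ≤ e.2.1 := by
    intro e he
    obtain ⟨v, hv, rfl⟩ := h.mem_iff.1 he
    have hne : v ≠ w := fun h => hwF (h ▸ hv)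
    exact hP.disjoint v (hF v hv) w hw hne
  have hs := h.separated
  rw [h2] at hdis hs
  refine ⟨h1, ?_, ?_⟩
  · rw [h3]
    refine ⟨?_, ?_⟩
    · obtain ⟨hp1, hp2, hp3⟩ := List.pairwise_append.1 hs.1
      refine List.pairwise_append.2 ⟨hp1, List.pairwise_cons.2 ⟨?_, hp2⟩, ?_⟩
      · intro e he
        have := h5 e he
        have h6 := hs.2 e (by simp [he])
        rcases hdis e (by simp [he]) with h | h
        · linarith
        · exact h
      · intro x hx y hy
        rcases List.mem_cons.1 hy with rfl | hy
        · have := h4 x hx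
          rcases hdis x (by simp [hx]) with h | h
          · exact h
          · linarith
        · exact hp3 x hx y hy
    · intro e he
      rcases List.mem_append.1 he with he | he
      · exact hs.2 e (by simp [he])
      · rcases List.mem_cons.1 he with rfl | he
        · simpa using hpos
        · exact hs.2 e (by simp [he])
  · rw [h3]
    have hp := h.perm
    rw [h2] at hp
    rw [List.map_append]
    refine List.perm_middle.trans ((List.Perm.cons _ hp).trans ?_)
    exact (List.perm_append_singleton _ _).symm

/-- A tree serves here merely as a witness that the intervals of `F` can be sorted into a separated
list. -/
theorem exists_holds (hP : Partition G f S W lo c) (F : List (List T)) (hF : ∀ w ∈ F, w ∈ S)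
    (hnd : F.Nodup) : ∃ t, Holds G lo t F := by
  induction F using List.reverseRecOn with
  | nil => exact ⟨_, holds_nil⟩
  | append_singleton F w ih =>
    rw [List.nodup_append'] at hnd
    obtain ⟨t, ht⟩ := ih (fun v hv => hF v (by simp [hv])) hnd.1
    exact ⟨_, ht.insert hP (fun v hv => hF v (by simp [hv])) (hF w (by simp))
      fun h => hnd.2.2 h (by simp)⟩

theorem wsum_eq_sum {F : List (List T)} (hnd : F.Nodup) [DecidableEq (List T)] :
    wsum G F = ∑ w ∈ F.toFinset, G.wordWeight w := by
  rw [List.sum_toFinset _ hnd, wsum]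

theorem Partition.wsum_lt (hP : Partition G f S W lo c) {F : List (List T)}
    (hF : ∀ w ∈ F, w ∈ S) (hnd : F.Nodup) (hlen : F.length < S.card) : wsum G F < W := by
  classical
  rw [wsum_eq_sum hnd, hP.total_eq]
  have hsub : F.toFinset ⊆ S := fun w hw => hF w (List.mem_toFinset.1 hw)
  have hne : ∃ w ∈ S, w ∉ F.toFinset := by
    by_contra! h
    have := Finset.card_le_card (s := S) (t := F.toFinset) h
    rw [List.toFinset_card_of_nodup hnd] at this
    omega
  obtain ⟨w, hw, hwF⟩ := hne
  exact Finset.sum_lt_sum_of_subset hsub hw hwF (wordWeight_pos G w)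
    fun v _ _ => (wordWeight_pos G v).le

/-- The left end of the numbers in `[0, 1)` that select the word `w` after the words `F`. -/
def selectLeft (G : WeightedGrammar T N) (W : ℝ) (lo : List T → ℝ) (F : List (List T))
    (w : List T) : ℝ :=
  (lo w - offset (lo w) (F.map (interval G lo))) / (W - wsum G F)

/-- The numbers in `[0, 1)` that select the word `w` after the words `F`. -/
def select (G : WeightedGrammar T N) (W : ℝ) (lo : List T → ℝ) (F : List (List T))
    (w : List T) : Set ℝ :=
  Set.Ico (selectLeft G W lo F w)
    (selectLeft G W lo F w + G.wordWeight w / (W - wsum G F))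

theorem mem_select {F : List (List T)} {w : List T} (h : wsum G F < W) (v : ℝ) :
    v ∈ select G W lo F w ↔
      lo w ≤ v * (W - wsum G F) + offset (lo w) (F.map (interval G lo)) ∧
        v * (W - wsum G F) + offset (lo w) (F.map (interval G lo)) < lo w + G.wordWeight w := by
  have h0 : 0 < W - wsum G F := by linarith
  rw [select, selectLeft, Set.mem_Ico, ← add_div, div_le_iff₀ h0, lt_div_iff₀ h0]
  constructor <;> rintro ⟨h1, h2⟩ <;> constructor <;> linarith

/-- Counterpart of `Separated.offset_le` on the right: the gaps that start at or after `lo` fit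
between `b` and `W`. -/
theorem _root_.NonRedundant.Separated.le_total {α : Type} {l : List (α × ℝ × ℝ)}
    (hs : Separated l) {lo b W : ℝ}
    (hb : b ≤ W) (hlo : ∀ e ∈ l, lo ≤ e.2.1 → b ≤ e.2.1) (hW : ∀ e ∈ l, e.2.2 ≤ W) :
    b + (gapSum l - offset lo l) ≤ W := by
  induction l generalizing b with
  | nil => simpa [offset] using hb
  | cons e l ih =>
    have h2 := hs.2 e (by simp)
    have hpw := (List.pairwise_cons.1 hs.1).1
    rw [offset_cons, gapSum_cons]
    split_ifs with h
    · have := ih hs.tail hb (fun e' he => hlo e' (by simp [he])) (fun e' he => hW e' (by simp [he]))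
      linarith
    · have h3 := hlo e (by simp) (not_lt.1 h)
      have := ih hs.tail (hW e (by simp)) (fun e' he _ => hpw e' he)
        (fun e' he => hW e' (by simp [he]))
      linarith

/-- The forbidden intervals left of `w` fit into `[0, lo w)`, the others between the end of `w` and
`W`. Once they are removed, the interval of `w` lies within `[0, W - wsum G F)`. -/
theorem Partition.select_subset (hP : Partition G f S W lo c) {F : List (List T)}
    (hF : ∀ w ∈ F, w ∈ S) (hnd : F.Nodup) (h : wsum G F < W) {w : List T} (hw : w ∈ S)
    (hwF : w ∉ F) : select G W lo F w ⊆ Set.Ico 0 1 := by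
  have h0 : 0 < W - wsum G F := by linarith
  have hpos := wordWeight_pos G w
  obtain ⟨t, ht⟩ := exists_holds hP F hF hnd
  have hdis : ∀ e ∈ t.inorder, e.2.2 ≤ lo w ∨ lo w + G.wordWeight w ≤ e.2.1 := by
    intro e he
    obtain ⟨v, hv, rfl⟩ := ht.mem_iff.1 he
    exact hP.disjoint v (hF v hv) w hw fun h => hwF (h ▸ hv)
  have h1 : 0 + offset (lo w) t.inorder ≤ lo w := by
    refine ht.separated.offset_le (hP.lo_nonneg w hw) ?_ ?_
    · intro e he
      obtain ⟨v, hv, rfl⟩ := ht.mem_iff.1 he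
      exact hP.lo_nonneg v (hF v hv)
    · intro e he hlt
      rcases hdis e he with h | h
      · exact h
      · linarith
  have h2 : lo w + G.wordWeight w + (gapSum t.inorder - offset (lo w) t.inorder) ≤ W := by
    refine ht.separated.le_total (hP.le_total w hw) ?_ ?_
    · intro e he hle
      have := ht.separated.2 e he
      rcases hdis e he with h | h
      · linarith
      · exact h
    · intro e he
      obtain ⟨v, hv, rfl⟩ := ht.mem_iff.1 he
      exact hP.le_total v (hF v hv)
  rw [offset_perm ht.perm] at h1 h2
  rw [gapSum_perm ht.perm, gapSum_map_interval] at h2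
  refine Set.Ico_subset_Ico ?_ ?_
  · exact div_nonneg (by linarith) h0.le
  · rw [selectLeft, ← add_div, div_le_one h0]
    linarith

/-- The random number `v` leads to a new word, which is `w` if and only if `v` selects `w`. -/
theorem Partition.draw (hP : Partition G f S W lo c) {t : GapTree T} {F : List (List T)}
    (ht : Holds G lo t F) (hF : ∀ w ∈ F, w ∈ S) (h : wsum G F < W)
    {v : ℝ} (hv : v ∈ Set.Ico (0 : ℝ) 1) :
    0 ≤ (t.modRandom (v * (W - wsum G F))).val ∧ (t.modRandom (v * (W - wsum G F))).val < W ∧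
    ∃ w ∈ S, w ∉ F ∧ (f (t.modRandom (v * (W - wsum G F))).val).val =
        (w, lo w, lo w + G.wordWeight w) ∧
      ∀ w' ∈ S, w' ∉ F → (w = w' ↔ v ∈ select G W lo F w') := by
  have h0 : 0 < W - wsum G F := by linarith
  rw [ht.valid.val_modRandom ht.separated]
  have hx0 : 0 ≤ v * (W - wsum G F) := mul_nonneg hv.1 h0.le
  have hx1 : v * (W - wsum G F) < W - wsum G F := by
    have := mul_lt_mul_of_pos_right hv.2 h0
    linarith
  have hy0 : 0 ≤ shift (v * (W - wsum G F)) t.inorder := hx0.trans (ht.separated.le_shift _)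
  have hy1 : shift (v * (W - wsum G F)) t.inorder < W := by
    refine shift_lt ?_ ?_
    · intro e he
      obtain ⟨w, hw, rfl⟩ := ht.mem_iff.1 he
      have := hP.le_total w (hF w hw)
      have := wordWeight_pos G w
      simp only [interval]
      linarith
    · rw [gapSum_perm ht.perm, gapSum_map_interval]
      linarith
  obtain ⟨w, hw, h1, h2⟩ := hP.cover _ hy0 hy1
  refine ⟨hy0, hy1, w, hw, fun hwF => ?_, hP.val_eq w hw _ h1 h2, fun w' hw' hwF' => ?_⟩
  · exact ht.separated.shift_not_mem _ (ht.mem_iff.2 ⟨w, hwF, rfl⟩) ⟨h1, h2⟩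
  · rw [mem_select h, ← offset_perm ht.perm, ← ht.separated.shift_mem_iff]
    · constructor
      · rintro rfl
        exact ⟨h1, h2⟩
      · rintro ⟨h3, h4⟩
        by_contra hne
        rcases hP.disjoint w hw w' hw' hne with h | h <;> linarith
    · linarith [wordWeight_pos G w']
    · intro e he
      obtain ⟨u, hu, rfl⟩ := ht.mem_iff.1 he
      exact hP.disjoint u (hF u hu) w' hw' fun h => hwF' (h ▸ hu)

end Draw
end WeightedGrammar

namespace WeightedGrammar

variable {T N : Type} [Fintype T] [Fintype N] {G : WeightedGrammar T N}

/-! ### Repeated draws -/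

/-- The state is correct: its words are distinct words of `S`, the tree holds their intervals and
the mass is the weight of the other words. -/
structure Consistent (G : WeightedGrammar T N) (S : Finset (List T)) (W : ℝ) (lo : List T → ℝ)
    (s : State T) : Prop where
  nodup : s.out.Nodup
  mem : ∀ w ∈ s.out, w ∈ S
  holds : Holds G lo s.tree s.out
  mass_eq : s.mass = W - wsum G s.out

section Run

variable {tbl : N → ℕ → ℝ} {n H : ℕ} {S : Finset (List T)} {W c : ℝ} {lo : List T → ℝ}

theorem Consistent.length_inorder {s : State T} (hs : Consistent G S W lo s) :
    s.tree.inorder.length = s.out.length := by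
  rw [hs.holds.perm.length_eq, List.length_map]

/-- Four operations draw and scale the number and update the mass; `5 * H` and `9 * H` are the two
tree traversals. The three numbers of the new node are all that a step adds, since the mass is
overwritten. -/
theorem step_spec
    (hP : Partition G (unrank G tbl ((n + 1) * (Fintype.card N + 1)) G.start n) S W lo c)
    (hH : ∀ t : GapTree T, t.Valid → t.inorder.length < S.card → t.height ≤ H)
    {s : State T} (hs : Consistent G S W lo s) (hlen : s.out.length < S.card)
    {v : ℝ} (hv : v ∈ Set.Ico (0 : ℝ) 1) :
    Consistent G S W lo (step G tbl n s v).val ∧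
      (∃ w, (step G tbl n s v).val.out = s.out ++ [w] ∧
        ∀ w' ∈ S, w' ∉ s.out → (w = w' ↔ v ∈ select G W lo s.out w')) ∧
      ((step G tbl n s v).ops : ℝ) ≤ 4 + 14 * H + c ∧
      (step G tbl n s v).live = 3 ∧
      (step G tbl n s v).peak ≤
        9 + 14 * H + (4 * (n + 1) + 20 * ((n + 1) * (Fintype.card N + 1))) := by
  obtain ⟨hy0, hy1, w, hw, hwF, hval, hsel⟩ := hP.draw hs.holds hs.mem
    (hP.wsum_lt hs.mem hs.nodup hlen) hv
  have hops := hP.ops_le _ hy0 hy1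
  have hheight := hH s.tree hs.holds.valid (by rwa [hs.length_inorder])
  rw [← hs.mass_eq] at hval hops
  have hv' : (step G tbl n s v).val = ⟨s.out ++ [w],
      (s.tree.insert w (lo w) (lo w + G.wordWeight w)).val,
      s.mass - (lo w + G.wordWeight w - lo w)⟩ := by
    simp only [step, Cost.overwrite, Cost.bind_val, Cost.number_val, Cost.mul_val, hval,
      Cost.sub_val, Cost.pure_val]
  have hins := hs.holds.insert hP hs.mem hw hwF
  have hcons : Consistent G S W lo (step G tbl n s v).val := by
    rw [hv']
    refine ⟨?_, ?_, hins, ?_⟩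
    · rw [List.nodup_append']
      exact ⟨hs.nodup, by simp, by simpa using hwF⟩
    · intro w' hw'
      rcases List.mem_append.1 hw' with h | h
      · exact hs.mem _ h
      · rw [List.mem_singleton] at h
        exact h ▸ hw
    · simp only [hs.mass_eq, wsum_append, wsum_cons, wsum_nil]
      ring
  have hlive : State.size (step G tbl n s v).val - State.size s = 3 := by
    have h1 := hcons.length_inorder
    have h2 := hs.length_inorder
    rw [State.size, State.size, GapTree.size_eq, GapTree.size_eq, h1, h2, hv']
    simp only [List.length_append, List.length_singleton]
    omega
  have hmod := hs.holds.valid.ops_modRandom_le (v * s.mass)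
  have hmod' := (GapTree.tame_modRandom (v * s.mass) s.tree)
  have hin := hs.holds.valid.ops_insert_le w (lo w) (lo w + G.wordWeight w)
  have hin' := GapTree.tame_insert w (lo w) (lo w + G.wordWeight w) s.tree
  refine ⟨hcons, ⟨w, by rw [hv'], hsel⟩, ?_, hlive, ?_⟩
  · have h1 : (step G tbl n s v).ops = 1 + (1 + ((s.tree.modRandom (v * s.mass)).ops +
        ((unrank G tbl ((n + 1) * (Fintype.card N + 1)) G.start n
          (s.tree.modRandom (v * s.mass)).val).ops +
        ((s.tree.insert w (lo w) (lo w + G.wordWeight w)).ops + (1 + (1 + 0)))))) := by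
      simp only [step, Cost.overwrite, Cost.bind_val, Cost.bind_ops, Cost.number_val,
        Cost.number_ops, Cost.mul_val, Cost.mul_ops, hval, Cost.sub_val, Cost.sub_ops,
        Cost.pure_ops]
    have h2 : ((s.tree.modRandom (v * s.mass)).ops : ℝ) +
        (s.tree.insert w (lo w) (lo w + G.wordWeight w)).ops ≤ 14 * H := by
      exact_mod_cast (by omega : (s.tree.modRandom (v * s.mass)).ops +
        (s.tree.insert w (lo w) (lo w + G.wordWeight w)).ops ≤ 14 * H)
    rw [h1]
    push_cast
    linarith
  · have h1 := peak_unrank_le (G := G) tbl n ((n + 1) * (Fintype.card N + 1)) G.start n le_rfl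
      (s.tree.modRandom (v * s.mass)).val
    have h2 := live_unrank_le (G := G) tbl ((n + 1) * (Fintype.card N + 1)) G.start n
      (s.tree.modRandom (v * s.mass)).val
    have h3 : (step G tbl n s v).peak = max (max 1 (1 + max 1 (1 + max
        (s.tree.modRandom (v * s.mass)).peak ((s.tree.modRandom (v * s.mass)).live + max
        (unrank G tbl ((n + 1) * (Fintype.card N + 1)) G.start n
          (s.tree.modRandom (v * s.mass)).val).peak
        ((unrank G tbl ((n + 1) * (Fintype.card N + 1)) G.start n
          (s.tree.modRandom (v * s.mass)).val).live + max
        (s.tree.insert w (lo w) (lo w + G.wordWeight w)).peak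
        ((s.tree.insert w (lo w) (lo w + G.wordWeight w)).live + max 1 (1 + max 1 (1 + 0))))))))
        (State.size (step G tbl n s v).val - State.size s) := by
      simp only [step, Cost.overwrite, Cost.bind_val, Cost.bind_peak, Cost.number_val,
        Cost.number_peak, Cost.number_live, Cost.mul_val, Cost.mul_peak, Cost.mul_live, hval,
        Cost.sub_val, Cost.sub_peak, Cost.sub_live, Cost.pure_peak, Cost.pure_val]
    obtain ⟨h4, h5⟩ := hmod'
    obtain ⟨h6, h7⟩ := hin'
    rw [h3, hlive]
    omega

/-- Given a prescribed output, the condition on each draw depends on the preceding words but on no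
other draw. This is what makes the event a box. -/
theorem run_spec
    (hP : Partition G (unrank G tbl ((n + 1) * (Fintype.card N + 1)) G.start n) S W lo c)
    (hH : ∀ t : GapTree T, t.Valid → t.inorder.length < S.card → t.height ≤ H)
    (us : List ℝ) {s : State T} (hs : Consistent G S W lo s)
    (hlen : s.out.length + us.length ≤ S.card) (hu : ∀ v ∈ us, v ∈ Set.Ico (0 : ℝ) 1) :
    Consistent G S W lo (run G tbl n s us).val ∧
      (∃ z, (run G tbl n s us).val.out = s.out ++ z ∧ z.length = us.length) ∧
      (∀ ws, ws.length = us.length → (s.out ++ ws).Nodup → (∀ w ∈ ws, w ∈ S) →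
        ((run G tbl n s us).val.out = s.out ++ ws ↔ ∀ i < us.length,
          us.getD i 0 ∈ select G W lo (s.out ++ ws.take i) (ws.getD i []))) ∧
      ((run G tbl n s us).ops : ℝ) ≤ us.length * (4 + 14 * H + c) ∧
      (run G tbl n s us).live = 3 * us.length ∧
      (run G tbl n s us).peak ≤ 3 * us.length +
        (9 + 14 * H + (4 * (n + 1) + 20 * ((n + 1) * (Fintype.card N + 1)))) := by
  induction us generalizing s with
  | nil =>
    refine ⟨hs, ⟨[], by simp [run], rfl⟩, ?_, by simp [run], by simp [run], by simp [run]⟩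
    intro ws hws _ _
    rw [List.length_nil, List.length_eq_zero_iff] at hws
    simp [hws, run]
  | cons v us ih =>
    rw [List.length_cons] at hlen
    obtain ⟨h1, ⟨w, h2, h3⟩, h4, h5, h6⟩ := step_spec hP hH hs (by omega) (hu v (by simp))
    have hlen' : (step G tbl n s v).val.out.length = s.out.length + 1 := by rw [h2]; simp
    obtain ⟨g1, ⟨z, g2, g3⟩, g4, g5, g6, g7⟩ := ih h1 (by omega) fun v hv => hu v (by simp [hv])
    simp only [run, Cost.bind_val, Cost.bind_ops, Cost.bind_live, Cost.bind_peak, List.length_cons]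
    refine ⟨g1, ⟨w :: z, by rw [g2, h2]; simp, by simp [g3]⟩, ?_, ?_, by omega, by omega⟩
    · intro ws hws hnd hmem
      rcases ws with _ | ⟨w', ws⟩
      · simp at hws
      · rw [List.length_cons, Nat.add_right_cancel_iff] at hws
        have hw'F : w' ∉ s.out := by
          rw [List.nodup_append'] at hnd
          exact fun h => hnd.2.2 h (by simp)
        have hsel := h3 w' (hmem w' (by simp)) hw'F
        by_cases hww : w = w'
        · subst hww
          have g4' := g4 ws hws (by rw [h2]; simpa using hnd) fun u hu => hmem u (by simp [hu])
          rw [h2, List.append_assoc, List.singleton_append] at g4'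
          rw [g4', Nat.forall_lt_succ_left]
          simp only [List.getD_cons_zero, List.getD_cons_succ, List.take_succ_cons, List.take_zero,
            List.append_nil, List.append_assoc, List.singleton_append]
          exact (and_iff_right (hsel.1 rfl)).symm
        -- A wrong first word falsifies both sides: outputs are only extended, and the first draw
        -- selects one word.
        · refine iff_of_false ?_ ?_
          · rw [g2, h2]
            intro he
            rw [List.append_assoc, List.append_cancel_left_eq, List.singleton_append] at he
            exact hww (List.cons.inj he).1
          · intro hall
            exact hww (hsel.2 (by simpa using hall 0 (by omega)))
    · push_cast
      linarith

end Run

/-! ### The height of the tree -/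

theorem card_wordsOf_le (A : N) (n : ℕ) : (wordsOf G A n).card ≤ Fintype.card T ^ n := by
  classical
  rw [← card_vector]
  refine (Finset.card_le_card (t := Finset.univ.image fun v : List.Vector T n => v.toList)
    ?_).trans Finset.card_image_le
  intro w hw
  rw [mem_wordsOf] at hw
  exact Finset.mem_image.2 ⟨⟨w, hw.2⟩, Finset.mem_univ _, rfl⟩

/-- There are at most `|T| ^ n ≤ 2 ^ (|T| * n)` words, so a height logarithmic in their number is
linear in `n`. -/
theorem height_le (A : N) (n : ℕ) {t : GapTree T} (ht : t.Valid)
    (h : t.inorder.length < (wordsOf G A n).card) : t.height ≤ 2 * (Fintype.card T * n) + 1 := by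
  have h1 : 2 ^ (t.height / 2) ≤ 2 ^ (Fintype.card T * n) := by
    calc 2 ^ (t.height / 2) ≤ t.inorder.length + 1 := ht.two_pow_le
      _ ≤ (wordsOf G A n).card := h
      _ ≤ Fintype.card T ^ n := card_wordsOf_le A n
      _ ≤ (2 ^ Fintype.card T) ^ n := Nat.pow_le_pow_left Nat.lt_two_pow_self.le n
      _ = 2 ^ (Fintype.card T * n) := (pow_mul _ _ _).symm
  have := (Nat.pow_le_pow_iff_right (by norm_num)).1 h1
  omega

/-! ### The generator -/

/-- The data of a run of the generator. -/
theorem exists_generate_spec (hG : G.IsBCNF) (hU : G.Unambiguous) {D : N → Recurrence}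
    (hD : ∀ A, Good G A → (D A).Computes (total G A)) (n : ℕ) :
    ∃ lo f c, c = unrankCost (Fintype.card N) n (rk G G.start) ∧
      Partition G f (wordsOf G G.start n) (total G G.start n) lo c ∧
      ∀ k ≤ (wordsOf G G.start n).card, ∀ u : Fin k → ℝ, (∀ i, u i ∈ Set.Ico (0 : ℝ) 1) →
        ((generate G D n k u).val.length = k ∧ (generate G D n k u).val.Nodup ∧
          ∀ w ∈ (generate G D n k u).val, w ∈ wordsOf G G.start n) ∧
        (∀ σ : Fin k → List T, Function.Injective σ → (∀ i, σ i ∈ wordsOf G G.start n) →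
          ((generate G D n k u).val = List.ofFn σ ↔ ∀ i : Fin k, u i ∈
            select G (total G G.start n) lo ((List.ofFn σ).take i) (σ i))) ∧
        ((generate G D n k u).ops : ℝ) ≤ (n + 1) * (∑ A, (D A).entryCost : ℕ) +
          k * (4 + 14 * (2 * (Fintype.card T * n) + 1 : ℕ) + c) ∧
        (generate G D n k u).peak ≤ (Fintype.card T + ∑ A, (D A).size) +
          (Fintype.card N * (n + 1) + ∑ A, (D A).entryCost) + 1 + 3 * k +
          (9 + 14 * (2 * (Fintype.card T * n) + 1) +
            (4 * (n + 1) + 20 * ((n + 1) * (Fintype.card N + 1)))) := by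
  have hgood : Good G G.start := hU.unique_start
  let tbl : N → ℕ → ℝ := fun A m => ((precompute D n).val A).getD m 0
  have htbl : ∀ A, Good G A → ∀ m ≤ n, tbl A m = total G A m := fun A hA m hm =>
    val_precompute (hD A hA) hm
  -- The fuel fixed in `step` exceeds the measure of `exists_locates` at the axiom.
  have hfuel : n * Fintype.card N + rk G G.start < (n + 1) * (Fintype.card N + 1) := by
    have := hgood.rk_lt_card hG
    have e : (n + 1) * (Fintype.card N + 1) = n * Fintype.card N + Fintype.card N + n + 1 := by ring
    omega
  obtain ⟨l, hl, hloc⟩ := exists_locates hG htbl _ n G.start hgood le_rfl hfuel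
  obtain ⟨lo, hP⟩ := exists_partition hl hloc
  refine ⟨lo, _, _, rfl, hP, fun k hk u hu => ?_⟩
  have hs0 : Consistent G (wordsOf G G.start n) (total G G.start n) lo
      ⟨[], GapTree.nil, tbl G.start n⟩ :=
    ⟨List.nodup_nil, by simp, holds_nil, by
      simp only [wsum_nil, sub_zero]; exact htbl _ hgood n le_rfl⟩
  obtain ⟨h1, ⟨z, h2, h3⟩, h4, h5, h6, h7⟩ := run_spec hP
    (fun t ht hlt => height_le G.start n ht hlt) (List.ofFn u) hs0 (by simpa using hk) (by
      intro v hv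
      obtain ⟨i, rfl⟩ := (List.mem_ofFn' _ _).1 hv
      exact hu i)
  have hval : (generate G D n k u).val =
      (run G tbl n ⟨[], GapTree.nil, tbl G.start n⟩ (List.ofFn u)).val.out := rfl
  have hops : (generate G D n k u).ops = 0 + ((precompute D n).ops + (0 +
      ((run G tbl n ⟨[], GapTree.nil, tbl G.start n⟩ (List.ofFn u)).ops + 0))) := rfl
  have hpeak : (generate G D n k u).peak = max (Fintype.card T + ∑ A, (D A).size)
      (Fintype.card T + ∑ A, (D A).size + max (precompute D n).peak ((precompute D n).live + max 1
      (1 + max (run G tbl n ⟨[], GapTree.nil, tbl G.start n⟩ (List.ofFn u)).peak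
        ((run G tbl n ⟨[], GapTree.nil, tbl G.start n⟩ (List.ofFn u)).live + 0)))) := rfl
  simp only [List.length_ofFn, List.nil_append] at h2 h3 h4 h5 h6 h7
  refine ⟨⟨?_, ?_, ?_⟩, ?_, ?_, ?_⟩
  · rw [hval, h2, h3]
  · rw [hval]; exact h1.nodup
  · rw [hval]; exact h1.mem
  · intro σ hσ hσS
    rw [hval, h4 (List.ofFn σ) (by simp) (List.nodup_ofFn.2 hσ) (by
      intro w hw
      obtain ⟨i, rfl⟩ := (List.mem_ofFn' _ _).1 hw
      exact hσS i)]
    constructor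
    · intro h i
      simpa [List.getD_eq_getElem?_getD] using h i i.2
    · intro h i hi
      simpa [List.getD_eq_getElem?_getD, hi] using h ⟨i, hi⟩
  · have h8 : ((precompute D n).ops : ℝ) ≤ (n + 1) * (∑ A, (D A).entryCost : ℕ) := by
      exact_mod_cast ops_precompute_le D n
    rw [hops]
    push_cast at h5 h8 ⊢
    linarith
  · have h8 := peak_precompute_le D n
    have h9 := live_precompute D n
    rw [hpeak]
    omega

/-! ### The probability of a set of words -/

-- The event splits according to the order `σ` in which the words of `R` appear. Each part is a box
-- with sides `π(σ i) / (W - π(earlier words))`, which gives both measurability and the sum over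
-- orderings.
open MeasureTheory in
theorem volume_eq_setProb (hG : G.IsBCNF) (hU : G.Unambiguous) {D : N → Recurrence}
    (hD : ∀ A, Good G A → (D A).Computes (total G A)) {n k : ℕ} (R : Finset (List T))
    (hR : (R : Set (List T)) ⊆ G.words n) (hk : R.card = k) :
    MeasurableSet {u : Fin k → ℝ | (∀ i, u i ∈ Set.Ico (0 : ℝ) 1) ∧
        {w | w ∈ (generate G D n k u).val} = (R : Set (List T))} ∧
      volume {u : Fin k → ℝ | (∀ i, u i ∈ Set.Ico (0 : ℝ) 1) ∧
        {w | w ∈ (generate G D n k u).val} = (R : Set (List T))} =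
        ENNReal.ofReal (G.setProb n k R) := by
  classical
  obtain ⟨lo, f, c, -, hP, hgen⟩ := exists_generate_spec hG hU hD n
  have hRS : R ⊆ wordsOf G G.start n := by
    intro w hw
    have := hR hw
    rwa [← coe_wordsOf_start] at this
  have hkS : k ≤ (wordsOf G G.start n).card := hk ▸ Finset.card_le_card hRS
  have hinj : ∀ σ : Fin k ≃ R, Function.Injective fun i => (σ i : List T) := fun σ =>
    Subtype.val_injective.comp σ.injective
  have hmem : ∀ (σ : Fin k ≃ R) i, (σ i : List T) ∈ wordsOf G G.start n := fun σ i =>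
    hRS (σ i).2
  let F : (Fin k ≃ R) → Fin k → List (List T) := fun σ i =>
    (List.ofFn fun j => (σ j : List T)).take i
  have hFnd : ∀ σ i, (F σ i).Nodup := fun σ i => (List.nodup_ofFn.2 (hinj σ)).take
  have hFmem : ∀ σ i, ∀ w ∈ F σ i, w ∈ wordsOf G G.start n := by
    intro σ i w hw
    obtain ⟨j, rfl⟩ := (List.mem_ofFn' _ _).1 (List.mem_of_mem_take hw)
    exact hmem σ j
  have hFnot : ∀ σ i, (σ i : List T) ∉ F σ i := by
    intro σ i h
    have hnd := List.nodup_ofFn.2 (hinj σ)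
    have hi : (i : ℕ) < (List.ofFn fun j => (σ j : List T)).length := by simp
    have e := List.take_append_drop (i : ℕ) (List.ofFn fun j => (σ j : List T))
    rw [List.drop_eq_getElem_cons hi] at e
    rw [← e, List.nodup_append'] at hnd
    exact hnd.2.2 h (by simp)
  have hFlt : ∀ σ i, wsum G (F σ i) < total G G.start n := by
    intro σ i
    refine hP.wsum_lt (hFmem σ i) (hFnd σ i) ?_
    have := i.2
    simp only [F, List.length_take, List.length_ofFn]
    omega
  let box : (Fin k ≃ R) → Set (Fin k → ℝ) := fun σ =>
    Set.univ.pi fun i => select G (total G G.start n) lo (F σ i) (σ i)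
  have hbox : ∀ σ u, u ∈ box σ → ∀ i, u i ∈ Set.Ico (0 : ℝ) 1 := fun σ u hu i =>
    hP.select_subset (hFmem σ i) (hFnd σ i) (hFlt σ i) (hmem σ i) (hFnot σ i) (hu i trivial)
  have hbox' : ∀ σ u, u ∈ box σ → (generate G D n k u).val = List.ofFn fun j => (σ j : List T) :=
    fun σ u hu => ((hgen k hkS u (hbox σ u hu)).2.1 _ (hinj σ) (hmem σ)).2 fun i => hu i trivial
  have hset : {u : Fin k → ℝ | (∀ i, u i ∈ Set.Ico (0 : ℝ) 1) ∧
      {w | w ∈ (generate G D n k u).val} = (R : Set (List T))} = ⋃ σ, box σ := by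
    ext u
    simp only [Set.mem_ofPred_eq, Set.mem_iUnion]
    constructor
    · rintro ⟨hu, he⟩
      obtain ⟨⟨h1, h2, -⟩, h4, -⟩ := hgen k hkS u hu
      have h5 : ∀ i : Fin k, (generate G D n k u).val[i]'(by rw [h1]; exact i.2) ∈ R := by
        intro i
        have : (generate G D n k u).val[i]'(by rw [h1]; exact i.2) ∈
            {w | w ∈ (generate G D n k u).val} := List.getElem_mem _
        rwa [he] at this
      -- The output has `k` distinct entries in `R`, and `R` has `k` elements, so the output is an
      -- ordering of `R`.
      let g : Fin k → R := fun i => ⟨_, h5 i⟩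
      have hg : Function.Injective g := by
        intro i j hij
        have := (List.Nodup.getElem_inj_iff h2).1 (Subtype.ext_iff.1 hij)
        exact Fin.ext this
      have hgb : Function.Bijective g :=
        (Fintype.bijective_iff_injective_and_card g).2 ⟨hg, by simp [hk]⟩
      refine ⟨Equiv.ofBijective g hgb, fun i _ => ?_⟩
      refine (h4 (fun j => (Equiv.ofBijective g hgb j : List T)) (hinj _) (hmem _)).1 ?_ i
      apply List.ext_getElem
      · simp [h1]
      · intro i h6 h7
        simp [g]
    · rintro ⟨σ, hσ⟩
      refine ⟨hbox σ u hσ, ?_⟩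
      rw [hbox' σ u hσ]
      ext w
      simp only [List.mem_ofFn', Set.mem_range, Set.mem_ofPred_eq, Finset.mem_coe]
      constructor
      · rintro ⟨i, rfl⟩
        exact (σ i).2
      · intro hw
        exact ⟨σ.symm ⟨w, hw⟩, by simp⟩
  have hmeas : ∀ σ, MeasurableSet (box σ) := fun σ =>
    MeasurableSet.univ_pi fun i => measurableSet_Ico
  -- The draws determine the output list and thereby the order.
  have hdis : Pairwise (Function.onFun Disjoint box) := by
    intro σ τ hne
    rw [Function.onFun, Set.disjoint_left]
    intro u h1 h2
    have := (hbox' σ u h1).symm.trans (hbox' τ u h2)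
    apply hne
    ext i : 2
    exact congrFun (List.ofFn_injective this) i
  have hvol : ∀ σ, volume (box σ) = ENNReal.ofReal
      (∏ i, G.wordWeight (σ i) / (total G G.start n - wsum G (F σ i))) := by
    intro σ
    simp only [box, select]
    rw [Real.volume_pi_Ico, ← ENNReal.ofReal_prod_of_nonneg]
    · simp
    · intro i _
      rw [add_sub_cancel_left]
      exact div_nonneg (wordWeight_pos G _).le (by linarith [hFlt σ i])
  rw [hset]
  refine ⟨MeasurableSet.iUnion hmeas, ?_⟩
  rw [measure_iUnion hdis hmeas, tsum_fintype, setProb, setWeight_words]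
  simp only [hvol]
  rw [← ENNReal.ofReal_sum_of_nonneg]
  · congr 1
    refine Finset.sum_congr rfl fun σ _ => Finset.prod_congr rfl fun i _ => ?_
    congr 2
    simp only [F, wsum, List.map_take, List.map_ofFn]
    rw [List.sum_take_ofFn]
    exact Finset.sum_congr (by ext; simp) fun _ _ => rfl
  · intro σ _
    exact Finset.prod_nonneg fun i _ =>
      div_nonneg (wordWeight_pos G _).le (by linarith [hFlt σ i])

end WeightedGrammar

/-! ### The constants -/

theorem unrankCost_le {p n r : ℕ} (hn : 1 ≤ n) (hr : r ≤ p) :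
    WeightedGrammar.unrankCost p n r ≤ 16 * (n * Real.log n) +
      (2 * (17 + 2 * (21 + 20 * 3 ^ p) * p) + (21 + 20 * 3 ^ p) * p) * n := by
  have h1 : (1 : ℝ) ≤ n := by exact_mod_cast hn
  have h2 : (r : ℝ) ≤ p := by exact_mod_cast hr
  have hK : (0 : ℝ) ≤ 21 + 20 * 3 ^ p := by positivity
  have hb : (0 : ℝ) ≤ 17 + 2 * (21 + 20 * 3 ^ p) * p := by positivity
  rw [WeightedGrammar.unrankCost, if_neg (by omega)]
  generalize (21 + 20 * 3 ^ p : ℝ) = K at *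
  have h3 : K * r ≤ K * p := mul_le_mul_of_nonneg_left h2 hK
  have h4 : K * p * 1 ≤ K * p * n := mul_le_mul_of_nonneg_left h1 (by positivity)
  nlinarith

/-- Here `y` stands for `n log n`. For `n ≥ 2` the terms linear in `n` are absorbed by `n ≤ 2 * y`.
For `n = 1` the logarithm vanishes, but then `k` is at most the size `t` of the alphabet, and the
term `n * p` absorbs everything. -/
theorem ops_bound {E t p n k c X y : ℝ} (hE : 0 ≤ E) (ht : 0 ≤ t) (hp : 1 ≤ p) (hk : 0 ≤ k)
    (hX : 0 ≤ X) (hn : n = 1 ∧ k ≤ t ∧ y = 0 ∨ 1 ≤ n ∧ n ≤ 2 * y)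
    (hc : c ≤ 16 * y + X * n) :
    (n + 1) * E + k * (4 + 14 * (2 * (t * n) + 1) + c) ≤
      (2 * E + t * (18 + 28 * t + X) + 16 + 2 * (18 + 28 * t + X)) * (n * p + k * y) := by
  have hn1 : 1 ≤ n := by rcases hn with h | h <;> linarith [h.1]
  have hY : (0 : ℝ) ≤ 18 + 28 * t + X := by positivity
  have h0 : 4 + 14 * (2 * (t * n) + 1) + c ≤ 16 * y + (18 + 28 * t + X) * n := by linarith
  generalize 18 + 28 * t + X = Y at *
  have h1 : (n + 1) * E ≤ 2 * E * (n * p) := by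
    have : 0 ≤ E * n * (p - 1) := mul_nonneg (by positivity) (by linarith)
    nlinarith
  have h2 := mul_le_mul_of_nonneg_left h0 hk
  have hnp : 0 ≤ n * p := by positivity
  rcases hn with ⟨rfl, hkt, rfl⟩ | ⟨-, hny⟩
  · have h3 : k * Y ≤ t * Y * p :=
      (mul_le_mul_of_nonneg_right hkt hY).trans (le_mul_of_one_le_right (by positivity) hp)
    have h4 : 0 ≤ Y * p := by positivity
    nlinarith
  · have hy : 0 ≤ y := by linarith
    have h3 : k * Y * n ≤ k * Y * (2 * y) := mul_le_mul_of_nonneg_left hny (by positivity)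
    have h4 : 0 ≤ (2 * E + t * Y) * (k * y) := by positivity
    have h5 : 0 ≤ (t * Y + 16 + 2 * Y) * (n * p) := by positivity
    nlinarith

theorem peak_bound {g E t p n k : ℝ} (hg : 0 ≤ g) (hE : 0 ≤ E) (ht : 0 ≤ t) (hp : 1 ≤ p)
    (hn : 1 ≤ n) (hk : 0 ≤ k) :
    g + (p * (n + 1) + E) + 1 + 3 * k +
        (9 + 14 * (2 * (t * n) + 1) + (4 * (n + 1) + 20 * ((n + 1) * (p + 1)))) ≤
      (g + E + 28 * t + 114) * (n * p + k) := by
  have h1 : 1 ≤ n * p := one_le_mul_of_one_le_of_one_le hn hp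
  have h2 : n ≤ n * p := le_mul_of_one_le_right (by linarith) hp
  have h3 : p ≤ n * p := le_mul_of_one_le_left (by linarith) hn
  have h4 : g * 1 ≤ g * (n * p) := mul_le_mul_of_nonneg_left h1 hg
  have h5 : E * 1 ≤ E * (n * p) := mul_le_mul_of_nonneg_left h1 hE
  have h6 : t * n ≤ t * (n * p) := mul_le_mul_of_nonneg_left h2 ht
  have h7 : 0 ≤ (g + E + 28 * t) * k := by positivity
  nlinarith

end NonRedundant

end

/-! ### The main theorem -/

open NonRedundant MeasureTheory in
theorem mainTheorem2 {T N : Type} [Fintype T] [Fintype N] (G : WeightedGrammar T N)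
    (hG : G.IsBCNF) (hU : G.Unambiguous) :
    ∃ (D : N → Recurrence) (C : ℝ), ∀ n k : ℕ, 1 ≤ n → 1 ≤ k → k ≤ (G.words n).ncard →
      (∀ u : Fin k → ℝ, (∀ i, u i ∈ Set.Ico (0 : ℝ) 1) →
        (generate G D n k u).val.length = k ∧
        (generate G D n k u).val.Nodup ∧
        (∀ w ∈ (generate G D n k u).val, w ∈ G.words n) ∧
        ((generate G D n k u).ops : ℝ) ≤
          C * ((n : ℝ) * Fintype.card N + (k : ℝ) * n * Real.log n) ∧
        ((generate G D n k u).peak : ℝ) ≤ C * ((n : ℝ) * Fintype.card N + k)) ∧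
      ∀ R : Finset (List T), (R : Set (List T)) ⊆ G.words n → R.card = k →
        MeasurableSet {u : Fin k → ℝ | (∀ i, u i ∈ Set.Ico (0 : ℝ) 1) ∧
          {w | w ∈ (generate G D n k u).val} = (R : Set (List T))} ∧
        volume {u : Fin k → ℝ | (∀ i, u i ∈ Set.Ico (0 : ℝ) 1) ∧
          {w | w ∈ (generate G D n k u).val} = (R : Set (List T))} =
          ENNReal.ofReal (G.setProb n k R) := by
  classical
  obtain ⟨D, hD⟩ := WeightedGrammar.exists_recurrences hG
  have hgood : WeightedGrammar.Good G G.start := hU.unique_start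
  have hr := hgood.rk_lt_card hG
  -- There is a non-terminal, because the rank of the axiom is less than their number.
  have hp : (1 : ℝ) ≤ Fintype.card N := by exact_mod_cast (Nat.zero_le _).trans_lt hr
  let E : ℝ := (∑ A, (D A).entryCost : ℕ)
  let t : ℝ := Fintype.card T
  let p : ℝ := Fintype.card N
  let g : ℝ := (Fintype.card T + ∑ A, (D A).size : ℕ)
  let X : ℝ := 2 * (17 + 2 * (21 + 20 * 3 ^ Fintype.card N) * p) +
    (21 + 20 * 3 ^ Fintype.card N) * p
  have hE : 0 ≤ E := Nat.cast_nonneg _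
  have ht : 0 ≤ t := Nat.cast_nonneg _
  have hg : 0 ≤ g := Nat.cast_nonneg _
  have hX : 0 ≤ X := by positivity
  let C₁ := 2 * E + t * (18 + 28 * t + X) + 16 + 2 * (18 + 28 * t + X)
  let C₂ := g + E + 28 * t + 114
  have hC₁ : 0 ≤ C₁ := by positivity
  have hC₂ : 0 ≤ C₂ := by positivity
  refine ⟨D, C₁ + C₂, fun n k hn _ hk => ⟨fun u hu => ?_, fun R hR hRk =>
    WeightedGrammar.volume_eq_setProb hG hU hD R hR hRk⟩⟩
  have hn1 : (1 : ℝ) ≤ n := by exact_mod_cast hn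
  have hk0 : (0 : ℝ) ≤ k := Nat.cast_nonneg _
  have hlog : 0 ≤ Real.log n := Real.log_nonneg hn1
  rw [← WeightedGrammar.coe_wordsOf_start, Set.ncard_coe_finset] at hk
  obtain ⟨lo, f, c, hc, -, hgen⟩ := WeightedGrammar.exists_generate_spec hG hU hD n
  obtain ⟨⟨h1, h2, h3⟩, -, h4, h5⟩ := hgen k hk u hu
  refine ⟨h1, h2, fun w hw => ?_, ?_, ?_⟩
  · rw [← WeightedGrammar.coe_wordsOf_start]
    exact h3 w hw
  · have hcase : (n : ℝ) = 1 ∧ (k : ℝ) ≤ t ∧ (n : ℝ) * Real.log n = 0 ∨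
        (1 : ℝ) ≤ n ∧ (n : ℝ) ≤ 2 * (n * Real.log n) := by
      rcases hn.eq_or_lt with rfl | hn2
      · left
        refine ⟨by simp, ?_, by simp⟩
        have := hk.trans (WeightedGrammar.card_wordsOf_le G.start 1)
        rw [pow_one] at this
        exact (Nat.cast_le (α := ℝ)).2 this
      · refine Or.inr ⟨hn1, ?_⟩
        -- `log n ≥ log 2 > 1 / 2` is the source of the factor 2 in `n ≤ 2 * (n * log n)`.
        have h6 : Real.log 2 ≤ Real.log n :=
          Real.log_le_log two_pos (by exact_mod_cast hn2)
        have := Real.log_two_gt_d9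
        nlinarith
    have hb := ops_bound hE ht hp hk0 hX hcase (hc.trans_le (unrankCost_le hn hr.le))
    have hnn : 0 ≤ (n : ℝ) * p + k * (n * Real.log n) := by positivity
    calc _ ≤ (n + 1) * E + k * (4 + 14 * (2 * (t * n) + 1) + c) := h4.trans_eq (by
            simp only [E, t]
            push_cast
            ring)
      _ ≤ C₁ * (n * p + k * (n * Real.log n)) := hb
      _ ≤ (C₁ + C₂) * (n * p + k * (n * Real.log n)) :=
        mul_le_mul_of_nonneg_right (le_add_of_nonneg_right hC₂) hnn
      _ = _ := by rw [mul_assoc (k : ℝ)]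
  · have hb := peak_bound hg hE ht hp hn1 hk0
    have hnn : 0 ≤ (n : ℝ) * p + k := by positivity
    have h6 : ((generate G D n k u).peak : ℝ) ≤ C₂ * (n * p + k) :=
      ((Nat.cast_le (α := ℝ)).2 h5).trans (hb.trans_eq' (by
        simp only [E, t, g]
        push_cast
        ring))
    exact h6.trans (mul_le_mul_of_nonneg_right (le_add_of_nonneg_left hC₁) hnn)
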